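/- **Setting.** Let $a>0$, $p>1/2$, let $\langle j\rangle=\max\{1,|j|\}$ and let $\ell^{a,p}$ be the Hilbert space of complex sequences $z=(z_j)_{j\in\mathbb Z}$ with $\|z\|_{a,p}^2=\sum_j|z_j|^2e^{2a|j|}\langle j\rangle^{2p}<\infty$; $B_r\subset\ell^{a,p}$ is the open ball of radius $r$ centred at $0$. On $\ell^{a,p}\times\ell^{a,p}$ we use independent complex variables $(u,\bar u)=(u^+,u^-)$, the symplectic form $i\sum_j du_j\wedge d\bar u_j$, and the real subspace on which $\bar u_j$ is the complex conjugate of $u_j$ for all $j$. For $\vec\jmath\in\mathbb Z^d$, $\vec\sigma\in\{\pm\}^d$ put $u^{\vec\sigma}_{\vec\jmath}=u^{\sigma_1}_{j_1}\cdots u^{\sigma_d}_{j_d}$ and $\vec\sigma\cdot\vec\jmath=\sum_i\sigma_ij_i$. For $\mathrm m>0$ let $\lambda_j=\sqrt{j^2+\mathrm m}$ and $$H=N+G,\qquad N=\sum_{j\in\mathbb Z}\lambda_ju_j\bar u_j,\qquad G=\sum_{\vec\jmath\in\mathbb Z^4,\ \vec\sigma\in\{\pm\}^4,\ \vec\sigma\cdot\vec\jmath=0}u^{\vec\sigma}_{\vec\jmath}.$$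 For a finite set $\mathcal I\subset\mathbb Z$, with complement $\mathcal I^c$ and $\kappa=\max_{j\in\mathcal I}|j|$ ($\kappa=0$ if $\mathcal I=\emptyset$), let $$\overline G=\tfrac12\sum_{i\text{ or }j\in\mathcal I}12(2-\delta_{ij})\,u_i\bar u_iu_j\bar u_j,\qquad \hat G=\sum_{\vec\jmath\in(\mathcal I^c)^4,\ \vec\sigma\in\{\pm\}^4,\ \vec\sigma\cdot\vec\jmath=0}u^{\vec\sigma}_{\vec\jmath}.$$ **Norms.** For a formal power series $f=\sum f_{\alpha,\beta}u^\alpha\bar u^\beta$ (finitely supported multi-indices) put $\pi(\alpha,\beta)=\sum_jj(\alpha_j-\beta_j)$ and $X_f=(-i\partial_{\bar u}f,\,i\partial_uf)$. The majorant norm of a formal vector field $X=\sum X_{\alpha,\beta}u^\alpha\bar u^\beta$ is $$\|X\|_r=\frac1r\sup_{(u,\bar u)\in B_r\times B_r}\Big\|\sum_{\alpha,\beta}|X_{\alpha,\beta}|\,|u^\alpha|\,|\bar u^\beta|\Big\|,$$ where absolute values of coefficients are taken componentwise and $\|(z,\bar z)\|=\|z\|_{a,p}+\|\bar z\|_{a,p}$;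 $f$ is M-regular on $B_r\times B_r$ if $\|X_f\|_r<\infty$. Let $0<L<1$ and $\theta,\mu>1$. A monomial $u^\alpha\bar u^\beta$ is $(N,\mu)$-low if $\sum_j|j|(\alpha_j+\beta_j)<\mu N^L$. For $h\in\mathbb Z$, $\mathcal L_r(N,\mu,h)$ is the set of M-regular $f$ whose monomials are all $(N,\mu)$-low with $\pi(\alpha,\beta)+h=0$. The projection $\Pi_{N,\theta,\mu}$ keeps exactly the monomials of zero momentum $\pi$ that are the product of some $u_m^\sigma u_n^{\sigma'}$, $|m|,|n|>\theta N$, and of an $(N,\mu)$-low monomial. The Töplitz space $\mathcal T_r(N,\theta,\mu)$ consists of the M-regular $f$, all of whose monomials have zero momentum, of the form $$f=\sum_{|m|,|n|>\theta N,\ \sigma,\sigma'=\pm}f^{\sigma,\sigma'}\big(\mathrm{sign}(m),\sigma m+\sigma'n\big)\,u_m^\sigma u_n^{\sigma'},\qquad f^{\sigma,\sigma'}(\varsigma,h)\in\mathcal L_r(N,\mu,h).$$ The quasi-Töplitz norm (which depends on $L$; $N$ is real) is $$\|f\|^T_{r,N_0,\theta,\mu}=\sup_{N\ge N_0}\ \inf_{\tilde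 f\in\mathcal T_r(N,\theta,\mu)}\max\big\{\|X_f\|_r,\ \|X_{\tilde f}\|_r,\ \|X_{\hat f}\|_r\big\},\qquad \hat f=N\big(\Pi_{N,\theta,\mu}f-\tilde f\big).$$ **Proposition (Birkhoff normal form).** Let $\mathcal I\subset\mathbb Z$ be finite and $\mathrm m>0$. There are positive integers $N_0'=N_0'(\mathrm m,\mathcal I,L,b)$, one for each choice of $0<b<L<1$, with $12(N_0')^{L-1}+2\kappa (N_0')^{b-1}<1$, such that the following holds. For all $a>0$ and $p>1/2$ there are $R_0>0$ and $C>0$, depending on $\mathrm m,\mathcal I,a,p$ only, such that for every $0<R<R_0$ there exist a map $$\Gamma:B_{R/2}\times B_{R/2}\subset\ell^{a,p}\times\ell^{a,p}\ \to\ B_R\times B_R\subset\ell^{a,p}\times\ell^{a,p},$$ which is an analytic diffeomorphism onto an open set with analytic inverse, maps real points to real points and is symplectic, and coefficients $K_{\alpha,\beta}$ ($\Gamma$ and $K$ not depending on $L,b$) such that on $B_{R/2}\times B_{R/2}$ $$H\circ\Gamma=N+\overline G+\hat G+K,\qquad K=\sum_{|\alpha|+|\beta|\in\{6,8,10,\dots\},\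 \pi(\alpha,\beta)=0}K_{\alpha,\beta}\,u^\alpha\bar u^\beta,$$ the series being absolutely convergent there, and, for all $0<b<L<1$, $$\|K\|^T_{R/2,\,N_0',\,2,\,3}\le C\,R^4 .$$ -/

import Mathlib

open scoped ENNReal

noncomputable section

namespace DNLW

/-- `⟨j⟩ = max {1, |j|}`. -/
def japanese (j : ℤ) : ℝ := max 1 |(j : ℝ)|

/-- The squared weight `e^{2a|j|} ⟨j⟩^{2p}`. -/
def weight (a p : ℝ) (j : ℤ) : ℝ := Real.exp (2 * a * |(j : ℝ)|) * japanese j ^ (2 * p)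

theorem weight_pos (a p : ℝ) (j : ℤ) : 0 < weight a p j :=
  mul_pos (Real.exp_pos _)
    (Real.rpow_pos_of_pos (lt_of_lt_of_le one_pos (le_max_left _ _)) _)

/-- Rescaling of a sequence by the square root of the weight, a linear map. -/
def rescale (a p : ℝ) : (ℤ → ℂ) →ₗ[ℂ] (ℤ → ℂ) where
  toFun z j := (Real.sqrt (weight a p j) : ℂ) * z j
  map_add' x y := by funext j; simp [mul_add]
  map_smul' c x := by funext j; simp; ring

theorem norm_rescale_sq (a p : ℝ) (z : ℤ → ℂ) (j : ℤ) :
    ‖rescale a p z j‖ ^ 2 = ‖z j‖ ^ 2 * weight a p j := by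
  simp only [rescale, LinearMap.coe_mk, AddHom.coe_mk, norm_mul, Complex.norm_real, mul_pow,
    Real.norm_eq_abs, sq_abs]
  rw [Real.sq_sqrt (weight_pos a p j).le, mul_comm]

theorem memlp_rescale_iff (a p : ℝ) (z : ℤ → ℂ) :
    Memℓp (rescale a p z) 2 ↔ Summable fun j => ‖z j‖ ^ 2 * weight a p j := by
  rw [memℓp_gen_iff (by norm_num)]
  refine summable_congr fun j => ?_
  rw [← norm_rescale_sq]
  norm_num

/-- The set of `z : ℤ → ℂ` with `∑ |z_j|² e^{2a|j|} ⟨j⟩^{2p} < ∞`, as a complex vector space. -/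
def ellSubmodule (a p : ℝ) : Submodule ℂ (ℤ → ℂ) where
  carrier := {z | Summable fun j => ‖z j‖ ^ 2 * weight a p j}
  add_mem' {x y} hx hy := by
    rw [Set.mem_ofPred_eq, ← memlp_rescale_iff] at *
    rw [map_add]; exact hx.add hy
  zero_mem' := by simp [summable_zero]
  smul_mem' c x hx := by
    rw [Set.mem_ofPred_eq, ← memlp_rescale_iff] at *
    rw [map_smul]; exact hx.const_smul c

/-- The Hilbert space `ℓ^{a,p}` of sequences `(z_j)_{j ∈ ℤ}` with
`‖z‖² = ∑ |z_j|² e^{2a|j|} ⟨j⟩^{2p} < ∞` (see `Ell.norm_sq`). -/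
def Ell (a p : ℝ) : Type := ellSubmodule a p

namespace Ell

variable {a p : ℝ}

instance : AddCommGroup (Ell a p) := inferInstanceAs (AddCommGroup (ellSubmodule a p))

instance : Module ℂ (Ell a p) := inferInstanceAs (Module ℂ (ellSubmodule a p))

instance : CoeFun (Ell a p) (fun _ => ℤ → ℂ) := ⟨fun z => z.1⟩

/-- The embedding `z ↦ (e^{a|j|} ⟨j⟩^p z_j)_j` into the unweighted `ℓ²`. -/
def toLp (a p : ℝ) : Ell a p →ₗ[ℂ] lp (fun _ : ℤ => ℂ) 2 where
  toFun z := ⟨rescale a p z, (memlp_rescale_iff a p z).2 z.2⟩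
  map_add' x y := Subtype.ext ((rescale a p).map_add x.1 y.1)
  map_smul' c x := Subtype.ext ((rescale a p).map_smul c x.1)

theorem toLp_injective (a p : ℝ) : Function.Injective (toLp a p) := by
  intro x y h
  refine Subtype.ext (funext fun j => ?_)
  have h1 : rescale a p x j = rescale a p y j := congrFun (congrArg Subtype.val h) j
  have h2 : (Real.sqrt (weight a p j) : ℂ) ≠ 0 :=
    Complex.ofReal_ne_zero.2 (Real.sqrt_pos.2 (weight_pos a p j)).ne'
  exact mul_left_cancel₀ h2 h1

/-- The norm of `ℓ^{a,p}`. -/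
instance : NormedAddCommGroup (Ell a p) :=
  NormedAddCommGroup.induced (Ell a p) (lp (fun _ : ℤ => ℂ) 2) (toLp a p) (toLp_injective a p)

instance : NormedSpace ℂ (Ell a p) := NormedSpace.induced ℂ (Ell a p) _ (toLp a p)

theorem norm_sq (z : Ell a p) :
    ‖z‖ ^ 2 = ∑' j : ℤ, ‖z j‖ ^ 2 * (Real.exp (2 * a * |(j : ℝ)|) * japanese j ^ (2 * p)) := by
  have h : ‖z‖ = ‖toLp a p z‖ := rfl
  have h2 := lp.norm_rpow_eq_tsum (p := 2) (by norm_num) (toLp a p z)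
  norm_num at h2
  rw [h, h2]
  exact tsum_congr fun j => norm_rescale_sq a p z j

end Ell

/-- Indices of the coordinates: `(j, σ)` stands for the variable `u_j^σ`, where `u_j^+ = u_j`
and `u_j^- = ū_j`. -/
abbrev Mode : Type := ℤ × ℤˣ

/-- The phase space `ℓ^{a,p} × ℓ^{a,p}`, with independent complex variables `(u, ū)`. -/
abbrev Phase (a p : ℝ) : Type := Ell a p × Ell a p

/-- The coordinate `u_j^σ` of a point `(u, ū)`. -/
def coord {a p : ℝ} (w : Phase a p) (s : Mode) : ℂ := if s.2 = 1 then w.1 s.1 else w.2 s.1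

/-- `B_r × B_r`. -/
def bidisc (a p r : ℝ) : Set (Phase a p) := Metric.ball 0 r ×ˢ Metric.ball 0 r

/-- The real subspace, in which `ū_j` is the complex conjugate of `u_j`. -/
def IsRealPoint {a p : ℝ} (w : Phase a p) : Prop := ∀ j, w.2 j = starRingEnd ℂ (w.1 j)

/-- The symplectic form `i ∑_j du_j ∧ dū_j`. -/
def symplecticForm {a p : ℝ} (v w : Phase a p) : ℂ :=
  Complex.I * ∑' j : ℤ, (v.1 j * w.2 j - w.1 j * v.2 j)

/-! ### The Hamiltonian -/

/-- `λ_j = √(j² + m)`. -/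
def freq (m : ℝ) (j : ℤ) : ℝ := Real.sqrt ((j : ℝ) ^ 2 + m)

/-- `N = ∑_j λ_j u_j ū_j`. -/
def quadHam (m : ℝ) {a p : ℝ} (w : Phase a p) : ℂ :=
  ∑' j : ℤ, (freq m j : ℂ) * w.1 j * w.2 j

open Classical in
/-- `∑ u_{j₁}^{σ₁} u_{j₂}^{σ₂} u_{j₃}^{σ₃} u_{j₄}^{σ₄}`, over all `j ∈ S⁴`, `σ ∈ {+,-}⁴` with
`σ₁ j₁ + σ₂ j₂ + σ₃ j₃ + σ₄ j₄ = 0`. -/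
def quarticOn (S : Set ℤ) {a p : ℝ} (w : Phase a p) : ℂ :=
  ∑' J : Fin 4 → Mode,
    if (∀ i, (J i).1 ∈ S) ∧ ∑ i, ((J i).2 : ℤ) * (J i).1 = 0 then ∏ i, coord w (J i) else 0

/-- `H = N + G`, with `G` the quartic form over all the sites. -/
def hamiltonian (m : ℝ) {a p : ℝ} (w : Phase a p) : ℂ := quadHam m w + quarticOn Set.univ w

/-- `Ḡ = ½ ∑_{i or j ∈ I} Ḡ_{ij} u_i ū_i u_j ū_j` with `Ḡ_{ij} = 12 (2 - δ_{ij})`. -/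
def Gbar (I : Finset ℤ) {a p : ℝ} (w : Phase a p) : ℂ :=
  (1 / 2) * ∑' q : ℤ × ℤ, if q.1 ∈ I ∨ q.2 ∈ I then
    (12 * (2 - if q.1 = q.2 then 1 else 0)) * (w.1 q.1 * w.2 q.1 * w.1 q.2 * w.2 q.2) else 0

/-- `Ĝ`: the part of `G` supported on the normal sites. -/
def Ghat (I : Finset ℤ) {a p : ℝ} (w : Phase a p) : ℂ := quarticOn ((I : Set ℤ)ᶜ) w

/-! ### Formal power series in infinitely many variables and majorant norms -/

/-- Multi-indices of finite support; `γ (j, 1)` and `γ (j, -1)` are the exponents `α_j`, `β_j` of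
`u_j`, `ū_j` in the monomial `u^α ū^β`. -/
abbrev MIdx : Type := Mode →₀ ℕ

/-- Formal power series in the variables `u_j^σ`. -/
abbrev Series : Type := MvPowerSeries Mode ℂ

/-- The value of the monomial `u^α ū^β`. -/
def monom {a p : ℝ} (w : Phase a p) (γ : MIdx) : ℂ := γ.prod fun s k => coord w s ^ k

/-- The momentum `π(α, β) = ∑_j j (α_j - β_j)`. -/
def momentum (γ : MIdx) : ℤ := γ.sum fun s k => (k : ℤ) * ((s.2 : ℤ) * s.1)

/-- The components of the Hamiltonian vector field `X_f = (-i ∂_ū f, i ∂_u f)`, as formal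
series. -/
def hamField (f : Series) (s : Mode) : Series :=
  (-(((s.2 : ℤ) : ℂ) * Complex.I)) • MvPowerSeries.pderiv ℂ (s.1, -s.2) f

/-- The majorant norm of a formal vector field on `B_r × B_r`, the target being endowed with the
norm `(‖u‖_{a,p} + ‖ū‖_{a,p}) / r`. -/
def majorantNorm (a p r : ℝ) (X : Mode → Series) : ℝ≥0∞ :=
  ⨆ w ∈ bidisc a p r,
    (∑ σ : ℤˣ, (∑' l : ℤ,
      (∑' γ : MIdx, ‖MvPowerSeries.coeff γ (X (l, σ))‖ₑ * γ.prod fun s k => ‖coord w s‖ₑ ^ k) ^ 2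
        * ENNReal.ofReal (weight a p l)) ^ (1 / 2 : ℝ)) / ENNReal.ofReal r

/-- `f` is M-regular: its Hamiltonian vector field has finite majorant norm. -/
def MRegular (a p r : ℝ) (f : Series) : Prop := majorantNorm a p r (hamField f) < ⊤

/-! ### Quasi-Töplitz functions -/

/-- `(N, μ)`-low momentum monomials: `∑_j |j| (α_j + β_j) < μ N^L`. -/
def IsLow (L N μ : ℝ) (γ : MIdx) : Prop := (γ.sum fun s k => |(s.1 : ℝ)| * k) < μ * N ^ L

/-- The space `𝓛_r(N, μ, h)` of M-regular series all of whose monomials are `(N, μ)`-low momentum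
and have momentum `-h`. -/
def lowSpace (a p L r N μ : ℝ) (h : ℤ) : Set Series :=
  {g | MRegular a p r g ∧
    ∀ γ, MvPowerSeries.coeff γ g ≠ 0 → IsLow L N μ γ ∧ momentum γ + h = 0}

open Classical in
/-- The formal series `∑_{|m|, |n| > θN, σ, σ' = ±} c_{m,n}^{σ,σ'} u_m^σ u_n^{σ'}`. For each
monomial `γ`, only the finitely many terms for which both `(m, σ)` and `(n, σ')` are in the support
of `γ` can contribute to its coefficient. -/
def bilinearSum (θ N : ℝ) (c : Mode → Mode → Series) : Series := fun γ =>
  ∑ q ∈ (γ.support ×ˢ γ.support).filter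
      (fun q => θ * N < |(q.1.1 : ℝ)| ∧ θ * N < |(q.2.1 : ℝ)|),
    MvPowerSeries.coeff γ (c q.1 q.2 * MvPowerSeries.X q.1 * MvPowerSeries.X q.2)

/-- The space `𝓣_r(N, θ, μ)` of Töplitz functions: the momentum preserving, M-regular bilinear
functions whose coefficients have the form
`f_{m,n}^{σ,σ'} = f^{σ,σ'}(sign m, σ m + σ' n)`, `f^{σ,σ'}(ς, h) ∈ 𝓛_r(N, μ, h)`. -/
def toplitzSpace (a p L r N θ μ : ℝ) : Set Series :=
  {f | MRegular a p r f ∧ (∀ γ, MvPowerSeries.coeff γ f ≠ 0 → momentum γ = 0) ∧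
    ∃ φ : ℤˣ → ℤˣ → SignType → ℤ → Series,
      (∀ σ σ' ς h, φ σ σ' ς h ∈ lowSpace a p L r N μ h) ∧
      f = bilinearSum θ N fun s s' =>
        φ s.2 s'.2 (SignType.sign s.1) ((s.2 : ℤ) * s.1 + (s'.2 : ℤ) * s'.1)}

/-- The `(N, θ, μ)`-bilinear monomials of zero momentum: products of two high modes `u_m^σ u_n^{σ'}`
with `|m|, |n| > θN` and of an `(N, μ)`-low momentum monomial. -/
def IsBilinear (L N θ μ : ℝ) (γ : MIdx) : Prop :=
  ∃ (s s' : Mode) (γ₀ : MIdx), θ * N < |(s.1 : ℝ)| ∧ θ * N < |(s'.1 : ℝ)| ∧ IsLow L N μ γ₀ ∧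
    momentum γ₀ = -((s.2 : ℤ) * s.1) - (s'.2 : ℤ) * s'.1 ∧
    γ = γ₀ + Finsupp.single s 1 + Finsupp.single s' 1

open Classical in
/-- The projection `Π_{N,θ,μ}` on the `(N, θ, μ)`-bilinear functions. -/
def bilinearProj (L N θ μ : ℝ) (f : Series) : Series := fun γ =>
  if IsBilinear L N θ μ γ then MvPowerSeries.coeff γ f else 0

/-- The quasi-Töplitz norm
`‖f‖^T = sup_{N ≥ N₀} inf_{f̃ ∈ 𝓣_r(N,θ,μ)} max {‖X_f‖_r, ‖X_f̃‖_r, ‖X_f̂‖_r}`,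
with the defect `f̂ = N (Π_{N,θ,μ} f - f̃)`; the cut-off `N` is real. -/
def quasiToplitzNorm (a p L r : ℝ) (N₀ : ℕ) (θ μ : ℝ) (f : Series) : ℝ≥0∞ :=
  ⨆ (N : ℝ) (_ : (N₀ : ℝ) ≤ N), ⨅ g ∈ toplitzSpace a p L r N θ μ,
    max (majorantNorm a p r (hamField f)) (max (majorantNorm a p r (hamField g))
      (majorantNorm a p r (hamField ((N : ℂ) • (bilinearProj L N θ μ f - g)))))

/-- `κ = max_{j ∈ I} |j|` (zero for `I = ∅`). -/
def kappa (I : Finset ℤ) : ℕ := I.sup Int.natAbs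

/-- The standing condition on the threshold: `12 N₀^{L-1} + 2 κ N₀^{b-1} < 1`. -/
def Admissible (I : Finset ℤ) (L b : ℝ) (N₀ : ℕ) : Prop :=
  0 < N₀ ∧ 12 * (N₀ : ℝ) ^ (L - 1) + 2 * (kappa I : ℝ) * (N₀ : ℝ) ^ (b - 1) < 1

end DNLW

end

open DNLW

/-! The change of variables is not a time-one flow but the implicit midpoint map of a cubic
Hamiltonian field `X`: if `w = z - X(z)/2`, then `Γ(w) = z + X(z)/2`. This makes two things exact.
The derivative of `Γ` is the Cayley transform of a symplectically skew map, so `Γ` is symplectic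
(`symplecticForm_cayley`). And since `N` is quadratic, `N(Γ w) - N(w)` is exactly the derivative of
`N` at `z` along `X(z)`, with no higher terms. For the field `X` of `i ∑ u_J / divisor(J)`, summed
over the non-resonant quadruples `J` (zero momentum, a mode in `I`, not two conjugate pairs), that
increment is minus the non-resonant form `G_nr(z)` (`quadHam_midpoint`). Since `G - G_nr` is `Ḡ + Ĝ`
by inclusion-exclusion over the three pairings (`Gbar_add_Ghat`), the remainder is `K(w) = G(2z - w)
- G(w) - G_nr(z) + G_nr(w)`.

The field is bounded because the divisors are bounded below (`exists_divisor_bound`): one mode of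
each quadruple lies in the finite set `I`, and strict convexity and subadditivity of `j ↦ √(j² + m)`
then give a bound for each pattern of signs. Momentum conservation turns the multilinear sums into
convolutions, and `ℓ^{a,p}` is a convolution algebra (`enorm2_conv_le`).

Solving `z = w + X(z)/2` by iteration writes `z` as a sum over ternary trees whose leaves carry the
modes of `w` (`coord_eq_treeSum`). A node has as momentum the sum of the momenta of its leaves; the
momentum fixes a mode only up to its sign, so nodes also carry signs. Thus `K` is a sum over
quadruples of trees, not all of them leaves, and its coefficients are at most exponential in the
degree times the number of orderings of the monomial (`ordBound_remainder`). Such a bound controls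
the majorant norm by a geometric series whose first term, from degree six, is of order `R^4`
(`majorantNorm_le`).

For the quasi-Töplitz norm, take a monomial with two high modes, the rest being low. Replace these
two by other high modes with the same signs and the same total momentum, each momentum keeping its
sign. In every node of every tree the divisor either is large or changes by `O(1/N)`, because high
frequencies are linear in the momentum up to `O(1/N)` (`ShiftPair.divisor_sub`), and the resonance
pattern does not change (`ShiftQuad.nonRes_iff`). Hence coefficients of `K` move by `O(1/N)`
(`HighPair.enorm_remainder_sub_le`). The Töplitz approximation freezes the high pair at reference
modes of size about `4N` (`toplitzPart`), and the defect, multiplied by `N`, obeys the same kind of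
bound as `K`. -/

namespace DNLW

/-! ### Modes, small divisors -/

/-- The conjugate mode. -/
def cj (s : Mode) : Mode := (s.1, -s.2)

/-- The momentum `σ j` of the mode `(j, σ)`. -/
def mo (s : Mode) : ℤ := (s.2 : ℤ) * s.1

theorem cj_cj (s : Mode) : cj (cj s) = s := by simp [cj]

theorem mo_cj (s : Mode) : mo (cj s) = -mo s := by simp [mo, cj]

theorem mo_mk (σ : ℤˣ) (k : ℤ) : mo ((σ : ℤ) * k, σ) = k := by
  rcases Int.units_eq_one_or σ with h | h <;> simp [mo, h]

theorem mode_eq (s : Mode) : s = ((s.2 : ℤ) * mo s, s.2) := by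
  obtain ⟨j, σ⟩ := s
  rcases Int.units_eq_one_or σ with h | h <;> simp [mo, h]

theorem mode_ext {s t : Mode} (h1 : mo s = mo t) (h2 : s.2 = t.2) : s = t := by
  rw [mode_eq s, mode_eq t, h1, h2]

theorem abs_mo (s : Mode) : |mo s| = |s.1| := by
  rcases Int.units_eq_one_or s.2 with h | h <;> simp [mo, h]

/-! ### Convexity of the frequencies and lower bounds for the divisors. -/

section freq

variable {m : ℝ}

theorem freq_sq (hm : 0 < m) (j : ℤ) : freq m j ^ 2 = (j : ℝ) ^ 2 + m :=
  Real.sq_sqrt (by positivity)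

theorem freq_nonneg (m : ℝ) (j : ℤ) : 0 ≤ freq m j := Real.sqrt_nonneg _

theorem freq_neg (m : ℝ) (j : ℤ) : freq m (-j) = freq m j := by simp [freq]

theorem freq_eq_of_abs {j k : ℤ} (h : |j| = |k|) : freq m j = freq m k := by
  rcases abs_eq_abs.1 h with h | h
  · rw [h]
  · rw [h, freq_neg]

theorem freq_mo (s : Mode) : freq m (mo s) = freq m s.1 := freq_eq_of_abs (abs_mo s)

theorem abs_lt_freq (hm : 0 < m) (j : ℤ) : |(j : ℝ)| < freq m j := by
  rw [← Real.sqrt_sq_eq_abs]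
  exact Real.sqrt_lt_sqrt (sq_nonneg _) (by linarith)

theorem freq_le (hm : 0 < m) (j : ℤ) : freq m j ≤ |(j : ℝ)| + Real.sqrt m := by
  apply Real.sqrt_le_iff.2 ⟨by positivity, ?_⟩
  have := Real.sq_sqrt hm.le
  nlinarith [sq_abs (j : ℝ), mul_nonneg (abs_nonneg (j : ℝ)) (Real.sqrt_nonneg m)]

theorem sqrt_le_freq (j : ℤ) : Real.sqrt m ≤ freq m j :=
  Real.sqrt_le_sqrt (by nlinarith [sq_nonneg (j : ℝ)])

theorem freq_sub_abs_le (hm : 0 < m) {M : ℝ} (hM : 0 < M) {j : ℤ} (hj : M ≤ |(j : ℝ)|) :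
    freq m j - |(j : ℝ)| ≤ m / M := by
  have h1 := abs_lt_freq hm j
  have h2 := freq_sq hm j
  rw [le_div_iff₀ hM]
  have : (freq m j - |(j : ℝ)|) * (freq m j + |(j : ℝ)|) = m := by
    have := sq_abs (j : ℝ); nlinarith
  nlinarith [freq_nonneg m j]

/-- Cauchy–Schwarz for the plane vectors `(x, √m)` and `(y, √m)`, whose lengths are the frequencies;
the gap between the squares is `m (x - y)²`. -/
theorem freq_mul_ge (hm : 0 < m) (x y : ℤ) : (x : ℝ) * y + m ≤ freq m x * freq m y := by
  refine le_trans (le_abs_self _) (abs_le_of_sq_le_sq ?_ (by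
    have := freq_nonneg m x; have := freq_nonneg m y; positivity))
  rw [mul_pow, freq_sq hm, freq_sq hm]
  nlinarith [sq_nonneg ((x : ℝ) - y)]

/-- Triangle inequality for the same vectors. The second component of the sum is `2√m`, hence `4 m`
in place of `m`; this surplus is what keeps three-to-one divisors away from zero. -/
theorem freq_add_ge (hm : 0 < m) (x y : ℤ) :
    Real.sqrt (((x : ℝ) + y) ^ 2 + 4 * m) ≤ freq m x + freq m y := by
  apply Real.sqrt_le_iff.2 ⟨add_nonneg (freq_nonneg _ _) (freq_nonneg _ _), ?_⟩
  nlinarith [freq_mul_ge hm x y, freq_sq hm x, freq_sq hm y]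

theorem freq_add_ge' (hm : 0 < m) (x y : ℤ) : freq m (x + y) ≤ freq m x + freq m y := by
  refine le_trans ?_ (freq_add_ge hm x y)
  apply Real.sqrt_le_sqrt
  push_cast
  linarith

/-- The frequency is 1-Lipschitz in the site. -/
theorem freq_add_le (hm : 0 < m) (x y : ℤ) : freq m (x + y) ≤ |(x : ℝ)| + freq m y := by
  apply Real.sqrt_le_iff.2 ⟨add_nonneg (abs_nonneg _) (freq_nonneg _ _), ?_⟩
  have h := abs_lt_freq hm y
  have h2 := freq_sq hm y
  push_cast
  nlinarith [sq_abs (x : ℝ), abs_mul (x : ℝ) y, le_abs_self ((x : ℝ) * y),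
    mul_le_mul_of_nonneg_left h.le (abs_nonneg (x : ℝ))]

/-- The second difference of the frequencies at `t`. -/
noncomputable def bend (m : ℝ) (t : ℤ) : ℝ := freq m (t + 1) - 2 * freq m t + freq m (t - 1)

/-- Strict convexity: equality in `freq_mul_ge` at `t + 1` and `t - 1` would require `4 m = 0`. -/
theorem bend_pos (hm : 0 < m) (t : ℤ) : 0 < bend m t := by
  have h1 := freq_mul_ge hm (t + 1) (t - 1)
  have h2 := freq_sq hm (t + 1)
  have h3 := freq_sq hm (t - 1)
  have h4 := freq_sq hm t
  push_cast at *
  have h5 : (2 * freq m t) ^ 2 < (freq m (t + 1) + freq m (t - 1)) ^ 2 := by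
    have : (freq m (t + 1) + freq m (t - 1)) ^ 2 ≥ 4 * (t : ℝ) ^ 2 + 4 * m := by nlinarith
    by_contra! hc
    have e1 : freq m (t + 1) * freq m (t - 1) = ((t : ℝ) + 1) * (t - 1) + m := by nlinarith
    have e2 : (freq m (t + 1) * freq m (t - 1)) ^ 2 = (((t : ℝ) + 1) ^ 2 + m) * ((t - 1) ^ 2 + m) := by
      rw [mul_pow, h2, h3]
    rw [e1] at e2
    nlinarith
  have := lt_of_pow_lt_pow_left₀ 2 (add_nonneg (freq_nonneg m (t+1)) (freq_nonneg m (t-1))) h5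
  unfold bend
  linarith

theorem freq_step_mono (hm : 0 < m) {x y : ℤ} (h : x ≤ y) :
    freq m (x + 1) - freq m x ≤ freq m (y + 1) - freq m y := by
  induction y, h using Int.leInduction with
  | base => rfl
  | succ n _ ih =>
    have := bend_pos hm (n + 1)
    simp only [bend, add_sub_cancel_right] at this
    linarith

theorem freq_incr_mono (hm : 0 < m) {x y : ℤ} (h : x ≤ y) (n : ℕ) :
    freq m (x + n) - freq m x ≤ freq m (y + n) - freq m y := by
  induction n with
  | zero => simp
  | succ n ih =>
    have := freq_step_mono hm (x := x + n) (y := y + n) (by omega)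
    push_cast
    rw [← add_assoc, ← add_assoc]
    linarith

/-- Second differences with a larger step dominate the second difference with step one. -/
theorem bend_le (hm : 0 < m) (t : ℤ) (n : ℕ) :
    bend m t ≤ freq m (t + (n + 1)) - 2 * freq m t + freq m (t - (n + 1)) := by
  have h1 := freq_incr_mono hm (x := t) (y := t + 1) (by omega) n
  have h2 := freq_incr_mono hm (x := t - (n + 1)) (y := t - 1) (by omega) n
  have h0 := freq_incr_mono hm (x := t - (n + 1)) (y := t) (by omega) n
  have e1 : t - (n + 1) + (n : ℤ) = t - 1 := by ring
  have e2 : t - 1 + (n : ℤ) = t - 1 + n := rfl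
  have e3 : t + 1 + (n : ℤ) = t + (n + 1) := by ring
  rw [e1] at h2 h0
  rw [e3] at h1
  unfold bend
  linarith

/-- Lower bound for the divisor `λ_i + λ_j - λ_k - λ_l`, `i + j = k + l`, when `i ≤ j`. -/
theorem divisor22_aux (hm : 0 < m) {c : ℝ} {κ : ℕ} (hc : ∀ t : ℤ, |t| ≤ κ + 1 → c ≤ bend m t)
    {i j k l : ℤ} (hi : |i| ≤ κ) (hij : i ≤ j) (hkl : k ≤ l) (hs : i + j = k + l) (hne : i ≠ k) :
    c ≤ |freq m i + freq m j - freq m k - freq m l| := by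
  rw [abs_le] at hi
  rcases lt_or_gt_of_ne hne with h | h
  -- Here `[k, l]` lies inside `[i, j]`. Only `i` is bounded, so the convexity must be measured at
  -- `i + 1` and not at `k`; for this reason `bend` is controlled up to `κ + 1`.
  · obtain ⟨n, hn⟩ := Int.eq_ofNat_of_zero_le (show 0 ≤ k - i - 1 by omega)
    have h1 := freq_incr_mono hm (x := i + (n + 1)) (y := l) (by omega) (n + 1)
    have h2 := bend_le hm (i + (n + 1)) n
    have h3 := bend_le hm (i + 1) 0
    have hb := hc (i + 1) (by rw [abs_le]; omega)
    have h4 := freq_incr_mono hm (x := i + 1) (y := i + (n + 1)) (by omega) (n+1)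
    have e1 : l + ((n + 1 : ℕ) : ℤ) = j := by push_cast; omega
    have e2 : i + (n + 1) = k := by omega
    have e3 : i + ((n + 1 : ℕ) : ℤ) = k := by push_cast; omega
    have h5 := freq_incr_mono hm (x := i) (y := i + 1) (by omega) n
    have e4 : i + 1 + (n : ℤ) = k := by omega
    have h6 := freq_step_mono hm (x := i + 1) (y := k) (by omega)
    have h7 := freq_incr_mono hm (x := i+1) (y := k + 1) (by omega) n
    have e5 : k + 1 + (n : ℤ) = k + (n + 1) := by ring
    refine le_trans ?_ (le_abs_self _)
    rw [e2] at h1 h2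
    rw [e1] at h1
    rw [e4] at h5 h7
    rw [e5] at h7
    unfold bend at hb
    simp only [add_sub_cancel_right] at hb
    push_cast at h1
    linarith
  -- Here `[i, j]` lies inside `[k, l]`, and the second difference of step `i - k` centred at the
  -- bounded site `i` suffices.
  · obtain ⟨n, hn⟩ := Int.eq_ofNat_of_zero_le (show 0 ≤ i - k - 1 by omega)
    have h1 := freq_incr_mono hm (x := i) (y := j) (by omega) (n + 1)
    have h2 := bend_le hm i n
    have hb := hc i (by rw [abs_le]; omega)
    have e1 : j + ((n + 1 : ℕ) : ℤ) = l := by push_cast; omega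
    have e2 : i - (n + 1) = k := by omega
    rw [e1] at h1
    rw [e2] at h2
    push_cast at h1
    rw [← neg_le_neg_iff] at hb
    refine le_trans ?_ (neg_le_abs _)
    linarith

/-- The reflection `j ↦ -j` preserves the frequencies and reverses the order, so both orders of `i`
and `j` reduce to one. -/
theorem divisor22 (hm : 0 < m) {c : ℝ} {κ : ℕ} (hc : ∀ t : ℤ, |t| ≤ κ + 1 → c ≤ bend m t)
    {i j k l : ℤ} (hi : |i| ≤ κ) (hs : i + j = k + l) (h1 : i ≠ k) (h2 : i ≠ l) :
    c ≤ |freq m i + freq m j - freq m k - freq m l| := by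
  wlog hkl : k ≤ l generalizing k l
  · have := this (k := l) (l := k) (by omega) h2 h1 (by omega)
    convert this using 2; ring
  by_cases hij : i ≤ j
  · exact divisor22_aux hm hc hi hij hkl hs h1
  · have := divisor22_aux hm hc (i := -i) (j := -j) (k := -l) (l := -k) (by simpa using hi)
      (by omega) (by omega) (by omega) (by omega)
    simp only [freq_neg] at this
    convert this using 2; ring

/-- Subadditivity in `q`, `r` and the Lipschitz bound in `i` leave `λ_i - |i|`, which decreases with
`|i|` and is therefore smallest at `κ`. -/
theorem divisor31 (hm : 0 < m) {κ : ℕ} {i : ℤ} (hi : |i| ≤ κ) (q r : ℤ) :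
    freq m κ - κ ≤ freq m i + freq m q + freq m r - freq m (i + q + r) := by
  have h1 := freq_add_ge' hm q r
  have h2 := freq_add_le hm i (q + r)
  have h3 : freq m κ - κ ≤ freq m i - |(i : ℝ)| := by
    have e : freq m i = freq m |i| := freq_eq_of_abs (by simp)
    obtain ⟨n, hn⟩ := Int.eq_ofNat_of_zero_le (show 0 ≤ κ - |i| by omega)
    have e2 : (κ : ℤ) = n + |i| := by omega
    have := freq_add_le hm n |i|
    rw [← e2] at this
    have e3 : (κ : ℝ) = n + |(i : ℝ)| := by exact_mod_cast e2
    rw [e, e3]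
    simp at this
    linarith
  rw [add_assoc i]
  linarith

/-- The sum of the three frequencies is at least `√(i² + 4m)`; its excess over `λ_i` decreases with
`|i|`. -/
theorem divisor13 (hm : 0 < m) {κ : ℕ} {i : ℤ} (hi : |i| ≤ κ) {q r s : ℤ} (h : q + r + s = i) :
    Real.sqrt ((κ : ℝ) ^ 2 + 4 * m) - freq m κ ≤ freq m q + freq m r + freq m s - freq m i := by
  have h1 := freq_add_ge' hm q r
  have h2 := freq_add_ge hm (q + r) s
  have e : ((q + r : ℤ) : ℝ) + s = i := by exact_mod_cast h
  rw [e] at h2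
  have h3 : Real.sqrt ((κ : ℝ) ^ 2 + 4 * m) - freq m κ ≤
      Real.sqrt ((i : ℝ) ^ 2 + 4 * m) - freq m i := by
    have hi' : (i : ℝ) ^ 2 ≤ (κ : ℝ) ^ 2 := by
      have : |(i : ℝ)| ≤ κ := by exact_mod_cast hi
      nlinarith [sq_abs (i : ℝ), abs_nonneg (i : ℝ)]
    have a1 := freq_sq hm κ
    have a2 := freq_sq hm i
    have a3 := Real.sq_sqrt (show 0 ≤ (κ : ℝ) ^ 2 + 4 * m by positivity)
    have a4 := Real.sq_sqrt (show 0 ≤ (i : ℝ) ^ 2 + 4 * m by positivity)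
    have b1 : freq m i ≤ freq m κ := Real.sqrt_le_sqrt (by push_cast; linarith)
    have b2 : Real.sqrt ((i : ℝ) ^ 2 + 4 * m) ≤ Real.sqrt ((κ : ℝ) ^ 2 + 4 * m) :=
      Real.sqrt_le_sqrt (by linarith)
    have b3 : freq m i < Real.sqrt ((i : ℝ) ^ 2 + 4 * m) := by
      apply Real.sqrt_lt_sqrt (by positivity); linarith
    have b4 := freq_nonneg m i
    push_cast at *
    set A := Real.sqrt ((κ : ℝ) ^ 2 + 4 * m)
    set B := Real.sqrt ((i : ℝ) ^ 2 + 4 * m)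
    -- The two products agree, so the larger sum `A + λ_κ` goes with the smaller difference.
    have e1 : (A - freq m κ) * (A + freq m κ) = 3 * m := by linear_combination a3 - a1
    have e2 : (B - freq m i) * (B + freq m i) = 3 * m := by linear_combination a4 - a2
    by_contra! hcon
    have : (B - freq m i) * (B + freq m i) < (A - freq m κ) * (A + freq m κ) := by
      apply mul_lt_mul hcon (by linarith) (by linarith) (by linarith)
    linarith
  linarith

end freq

end DNLW


noncomputable section

namespace DNLW

/-! ### Quadruples of modes -/

/-- The divisor `σ₁ λ_{j₁} + ⋯ + σ₄ λ_{j₄}`. -/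
def divisor (m : ℝ) (J : Fin 4 → Mode) : ℝ := ∑ i, (((J i).2 : ℤ) : ℝ) * freq m (J i).1

/-- The quadruple splits into two pairs of conjugate modes. -/
def Paired (J : Fin 4 → Mode) : Prop :=
  ∃ τ : Equiv.Perm (Fin 4), J (τ 0) = cj (J (τ 1)) ∧ J (τ 2) = cj (J (τ 3))

/-- The momentum preserving quadruples with a mode in `I` that are not paired. -/
def NonRes (I : Finset ℤ) (J : Fin 4 → Mode) : Prop :=
  ∑ i, mo (J i) = 0 ∧ (∃ i, (J i).1 ∈ I) ∧ ¬ Paired J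

theorem eq_cj_comm {s t : Mode} : s = cj t ↔ t = cj s :=
  ⟨fun h => by rw [h, cj_cj], fun h => by rw [h, cj_cj]⟩

theorem cj_injective : Function.Injective cj := fun s t h => by rw [← cj_cj s, h, cj_cj]

theorem paired_perm (τ : Equiv.Perm (Fin 4)) (J : Fin 4 → Mode) : Paired (J ∘ τ) ↔ Paired J := by
  constructor
  · rintro ⟨π, h⟩
    exact ⟨π.trans τ, h⟩
  · rintro ⟨π, h⟩
    exact ⟨π.trans τ.symm, by simpa using h⟩

theorem paired_iff (J : Fin 4 → Mode) : Paired J ↔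
    (J 1 = cj (J 0) ∧ J 3 = cj (J 2)) ∨ (J 2 = cj (J 0) ∧ J 3 = cj (J 1)) ∨
    (J 3 = cj (J 0) ∧ J 2 = cj (J 1)) := by
  constructor
  · rintro ⟨τ, h1, h2⟩
    have key : ∀ a b c d : Fin 4, a ≠ b → a ≠ c → a ≠ d → b ≠ c → b ≠ d → c ≠ d →
        J a = cj (J b) → J c = cj (J d) → (J 1 = cj (J 0) ∧ J 3 = cj (J 2)) ∨
          (J 2 = cj (J 0) ∧ J 3 = cj (J 1)) ∨ (J 3 = cj (J 0) ∧ J 2 = cj (J 1)) := by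
      intro a b c d hab hac had hbc hbd hcd h1 h2
      have h1' := eq_cj_comm.1 h1
      have h2' := eq_cj_comm.1 h2
      fin_cases a <;> fin_cases b <;> first | exact absurd rfl hab | skip
      all_goals fin_cases c <;> first | exact absurd rfl hac | exact absurd rfl hbc | skip
      all_goals fin_cases d <;>
        first | exact absurd rfl had | exact absurd rfl hbd | exact absurd rfl hcd | skip
      all_goals first
        | exact Or.inl ⟨by assumption, by assumption⟩
        | exact Or.inr (Or.inl ⟨by assumption, by assumption⟩)
        | exact Or.inr (Or.inr ⟨by assumption, by assumption⟩)
    refine key (τ 0) (τ 1) (τ 2) (τ 3) ?_ ?_ ?_ ?_ ?_ ?_ h1 h2 <;> simp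
  · rintro (h | h | h)
    · exact ⟨1, eq_cj_comm.1 h.1, eq_cj_comm.1 h.2⟩
    · refine ⟨Equiv.swap 1 2, ?_, ?_⟩
      · simpa [Equiv.swap_apply_of_ne_of_ne] using eq_cj_comm.1 h.1
      · have : (Equiv.swap (1 : Fin 4) 2) 3 = 3 := by decide
        rw [this]
        simpa using eq_cj_comm.1 h.2
    · refine ⟨Equiv.swap 1 3, ?_, ?_⟩
      · simpa [Equiv.swap_apply_of_ne_of_ne] using eq_cj_comm.1 h.1
      · have : (Equiv.swap (1 : Fin 4) 3) 2 = 2 := by decide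
        rw [this]
        simpa using h.2

theorem paired_cj (J : Fin 4 → Mode) : Paired (cj ∘ J) ↔ Paired J := by
  simp only [Paired, Function.comp]
  refine exists_congr fun τ => ?_
  rw [cj_injective.eq_iff, cj_injective.eq_iff]

theorem nonRes_perm (I : Finset ℤ) (τ : Equiv.Perm (Fin 4)) (J : Fin 4 → Mode) :
    NonRes I (J ∘ τ) ↔ NonRes I J := by
  unfold NonRes
  rw [paired_perm]
  have h1 : ∑ i, mo ((J ∘ τ) i) = ∑ i, mo (J i) := Equiv.sum_comp τ fun i => mo (J i)
  have h2 : (∃ i, ((J ∘ τ) i).1 ∈ I) ↔ ∃ i, (J i).1 ∈ I :=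
    (Equiv.exists_congr_left τ (p := fun i => ((J ∘ τ) i).1 ∈ I)).trans (by simp)
  rw [h1, h2]

theorem nonRes_cj (I : Finset ℤ) (J : Fin 4 → Mode) : NonRes I (cj ∘ J) ↔ NonRes I J := by
  unfold NonRes
  rw [paired_cj]
  have h : ∑ i, mo ((cj ∘ J) i) = -∑ i, mo (J i) := by
    simp only [Function.comp, mo_cj, Finset.sum_neg_distrib]
  rw [h, neg_eq_zero]
  rfl

theorem divisor_perm (m : ℝ) (τ : Equiv.Perm (Fin 4)) (J : Fin 4 → Mode) :
    divisor m (J ∘ τ) = divisor m J :=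
  Equiv.sum_comp τ fun i => (((J i).2 : ℤ) : ℝ) * freq m (J i).1

theorem divisor_cj (m : ℝ) (J : Fin 4 → Mode) : divisor m (cj ∘ J) = -divisor m J := by
  simp [divisor, cj, Finset.sum_neg_distrib]

/-- The small divisors of quadruples that are not paired and have a mode in a finite set are bounded
away from zero. -/
theorem exists_divisor_bound (I : Finset ℤ) {m : ℝ} (hm : 0 < m) :
    ∃ c : ℝ, 0 < c ∧ ∀ J, NonRes I J → c ≤ |divisor m J| := by
  set κ := kappa I
  -- Second differences tend to zero at infinity, so a positive lower bound is available only on a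
  -- finite window.
  obtain ⟨t₀, ht₀, hmin⟩ := Finset.exists_min_image (Finset.Icc (-((κ : ℤ) + 1)) (κ + 1)) (bend m)
    ⟨0, by simp; omega⟩
  have hb : ∀ t : ℤ, |t| ≤ κ + 1 → bend m t₀ ≤ bend m t := fun t ht =>
    hmin t (Finset.mem_Icc.2 (abs_le.1 ht))
  have hA : 0 < freq m κ - κ := by
    have := abs_lt_freq hm κ
    simp at this
    linarith
  have hB : 0 < Real.sqrt ((κ : ℝ) ^ 2 + 4 * m) - freq m κ :=
    sub_pos.2 (Real.sqrt_lt_sqrt (by positivity) (by push_cast; linarith))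
  have hC : 0 < Real.sqrt m := Real.sqrt_pos.2 hm
  refine ⟨min (min (bend m t₀) (freq m κ - κ))
    (min (Real.sqrt ((κ : ℝ) ^ 2 + 4 * m) - freq m κ) (Real.sqrt m)),
    lt_min (lt_min (bend_pos hm _) hA) (lt_min hB hC), ?_⟩
  set c := min (min (bend m t₀) (freq m κ - κ))
    (min (Real.sqrt ((κ : ℝ) ^ 2 + 4 * m) - freq m κ) (Real.sqrt m))
  have c1 : c ≤ bend m t₀ := (min_le_left _ _).trans (min_le_left _ _)
  have c2 : c ≤ freq m κ - κ := (min_le_left _ _).trans (min_le_right _ _)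
  have c3 : c ≤ Real.sqrt ((κ : ℝ) ^ 2 + 4 * m) - freq m κ :=
    (min_le_right _ _).trans (min_le_left _ _)
  have c4 : c ≤ Real.sqrt m := (min_le_right _ _).trans (min_le_right _ _)
  -- the case of a distinguished first mode with positive sign
  have key : ∀ J, NonRes I J → (J 0).1 ∈ I → (J 0).2 = 1 → c ≤ |divisor m J| := by
    rintro J ⟨hmom, -, hP⟩ h0 hs
    have hi : |(J 0).1| ≤ κ := by
      have : (J 0).1.natAbs ≤ κ := Finset.le_sup (f := Int.natAbs) h0
      rw [Int.abs_eq_natAbs]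
      exact_mod_cast this
    rw [paired_iff] at hP
    push Not at hP
    obtain ⟨p1, p2, p3⟩ := hP
    simp only [divisor, Fin.sum_univ_four] at hmom ⊢
    generalize J 0 = s0 at *
    generalize J 1 = s1 at *
    generalize J 2 = s2 at *
    generalize J 3 = s3 at *
    obtain ⟨j0, σ0⟩ := s0
    obtain ⟨j1, σ1⟩ := s1
    obtain ⟨j2, σ2⟩ := s2
    obtain ⟨j3, σ3⟩ := s3
    simp only [] at hs hi
    subst hs
    have d1 := divisor31 hm hi j1 j2
    have d2 := divisor31 hm hi j1 j3
    have d3 := divisor31 hm hi j2 j3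
    have f0 := freq_nonneg m j0
    have f1 := freq_nonneg m j1
    have f2 := freq_nonneg m j2
    have f3 := freq_nonneg m j3
    have g0 := sqrt_le_freq (m := m) j0
    -- The first sign is `+`, so there are eight patterns. No minus sign: the divisor exceeds `√m`.
    -- One: `divisor31`. Two: `divisor22`, where the absence of a pairing excludes the cancelling
    -- sites. Three: `divisor13`.
    rcases Int.units_eq_one_or σ1 with rfl | rfl <;> rcases Int.units_eq_one_or σ2 with rfl | rfl <;>
      rcases Int.units_eq_one_or σ3 with rfl | rfl <;>
      simp [mo, cj] at hmom p1 p2 p3 ⊢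
    · exact le_trans (by linarith) (le_abs_self _)
    · have e : j0 + j1 + j2 = j3 := by omega
      rw [e] at d1
      exact le_trans (by linarith) (le_abs_self _)
    · have e : j0 + j1 + j3 = j2 := by omega
      rw [e] at d2
      exact le_trans (by linarith) (le_abs_self _)
    · have := divisor22 hm hb (i := j0) (j := j1) (k := j2) (l := j3) hi (by omega)
        (fun h => p2 h.symm (by omega)) (fun h => p3 h.symm (by omega))
      refine (c1.trans this).trans_eq (congrArg _ ?_); ring
    · have e : j0 + j2 + j3 = j1 := by omega
      rw [e] at d3
      exact le_trans (by linarith) (le_abs_self _)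
    · have := divisor22 hm hb (i := j0) (j := j2) (k := j1) (l := j3) hi (by omega)
        (fun h => p1 h.symm (by omega)) (fun h => p3 h.symm (by omega))
      refine (c1.trans this).trans_eq (congrArg _ ?_); ring
    · have := divisor22 hm hb (i := j0) (j := j3) (k := j1) (l := j2) hi (by omega)
        (fun h => p1 h.symm (by omega)) (fun h => p2 h.symm (by omega))
      refine (c1.trans this).trans_eq (congrArg _ ?_); ring
    · have := divisor13 hm hi (q := j1) (r := j2) (s := j3) (by omega)
      exact le_trans (by linarith) (neg_le_abs _)
  have key2 : ∀ J, NonRes I J → (J 0).1 ∈ I → c ≤ |divisor m J| := by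
    intro J hJ h0
    rcases Int.units_eq_one_or (J 0).2 with hs | hs
    · exact key J hJ h0 hs
    · rw [← abs_neg, ← divisor_cj]
      exact key _ ((nonRes_cj I J).2 hJ) h0 (by simp [cj, hs])
  intro J hJ
  obtain ⟨i, hi⟩ := hJ.2.1
  rw [← divisor_perm m (Equiv.swap 0 i)]
  exact key2 _ ((nonRes_perm I _ J).2 hJ) (by simpa using hi)

/-! ### The inverse divisors and their symmetries. -/

open Classical in
/-- The coefficients `1 / (σ₁ λ_{j₁} + ⋯ + σ₄ λ_{j₄})` of the non-resonant quadruples. -/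
def symb (m : ℝ) (I : Finset ℤ) (J : Fin 4 → Mode) : ℝ :=
  if NonRes I J then (divisor m J)⁻¹ else 0

theorem symb_perm (m : ℝ) (I : Finset ℤ) (τ : Equiv.Perm (Fin 4)) (J : Fin 4 → Mode) :
    symb m I (J ∘ τ) = symb m I J := by
  unfold symb
  rw [divisor_perm]
  classical
  exact if_congr (nonRes_perm I τ J) rfl rfl

theorem symb_cj (m : ℝ) (I : Finset ℤ) (J : Fin 4 → Mode) :
    symb m I (cj ∘ J) = -symb m I J := by
  unfold symb
  rw [divisor_cj]
  by_cases h : NonRes I J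
  · rw [if_pos h, if_pos ((nonRes_cj I J).2 h), inv_neg]
  · rw [if_neg h, if_neg fun h' => h ((nonRes_cj I J).1 h'), neg_zero]

theorem symb_eq_zero {m : ℝ} {I : Finset ℤ} {J : Fin 4 → Mode} (h : ∑ i, mo (J i) ≠ 0) :
    symb m I J = 0 := if_neg fun h' => h h'.1

theorem exists_symb_bound (I : Finset ℤ) {m : ℝ} (hm : 0 < m) :
    ∃ c : ℝ, 0 < c ∧ (∀ J, |symb m I J| ≤ c) ∧ ∀ J, NonRes I J → c⁻¹ ≤ |divisor m J| := by
  obtain ⟨c, hc, h⟩ := exists_divisor_bound I hm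
  refine ⟨c⁻¹, inv_pos.2 hc, fun J => ?_, fun J hJ => by simpa using h J hJ⟩
  unfold symb
  split_ifs with hJ
  · rw [abs_inv]
    exact inv_anti₀ hc (h J hJ)
  · simpa using hc.le

/-! ### Quadruples with two high modes -/

/-- The mode `r'` is obtained from `r` by a shift of the momentum by `d δ`: no shift if `d = 0` and
then the mode is low; if `d = ± 1` then the momenta of both modes are high and of sign `± ε`. -/
structure Shift (N : ℝ) (δ : ℤ) (ε : ℤˣ) (d : ℤ) (r r' : Mode) : Prop where
  sign : r.2 = r'.2
  mom : mo r' = mo r + d * δ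
  low : d = 0 → |(mo r : ℝ)| ≤ N / 4
  high : d = 1 ∨ d = -1 → N < (d * (ε : ℤ) * mo r : ℤ) ∧ N < (d * (ε : ℤ) * mo r' : ℤ)

theorem Shift.cj {N : ℝ} {δ : ℤ} {ε : ℤˣ} {d : ℤ} {r r' : Mode} (h : Shift N δ ε d r r') :
    Shift N δ ε (-d) (cj r) (cj r') where
  sign := by simp [DNLW.cj, h.sign]
  mom := by rw [mo_cj, mo_cj, h.mom]; ring
  low h0 := by rw [mo_cj]; simpa using h.low (by omega)
  high h1 := by
    rw [mo_cj, mo_cj]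
    have := h.high (by omega)
    convert this using 3 <;> ring

theorem Shift.eq {N : ℝ} {δ : ℤ} {ε : ℤˣ} {r r' : Mode} (h : Shift N δ ε 0 r r') : r' = r :=
  mode_ext (by simpa using h.mom) h.sign.symm

/-- Two modes are shifted in opposite directions, the other two are low. -/
structure ShiftPair (N : ℝ) (δ : ℤ) (ε : ℤˣ) (J J' : Fin 4 → Mode) : Prop where
  fst : Shift N δ ε 1 (J 0) (J' 0)
  snd : Shift N δ ε (-1) (J 1) (J' 1)
  trd : Shift N δ ε 0 (J 2) (J' 2)
  fth : Shift N δ ε 0 (J 3) (J' 3)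

theorem ShiftPair.symm {N : ℝ} {δ : ℤ} {ε : ℤˣ} {J J' : Fin 4 → Mode} (h : ShiftPair N δ ε J J') :
    ShiftPair N (-δ) ε J' J where
  fst := ⟨h.fst.sign.symm, by rw [h.fst.mom]; ring, by simp, fun _ => (h.fst.high (by simp)).symm⟩
  snd := ⟨h.snd.sign.symm, by rw [h.snd.mom]; ring, by simp, fun _ => (h.snd.high (by simp)).symm⟩
  trd := ⟨h.trd.sign.symm, by rw [h.trd.mom]; ring, fun _ => by
    rw [h.trd.eq]; exact h.trd.low rfl, by simp⟩
  fth := ⟨h.fth.sign.symm, by rw [h.fth.mom]; ring, fun _ => by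
    rw [h.fth.eq]; exact h.fth.low rfl, by simp⟩

theorem abs_fst_eq (s : Mode) : |(s.1 : ℝ)| = |(mo s : ℝ)| := by
  have := abs_mo s
  exact_mod_cast this.symm

theorem high_abs {N : ℝ} {ε : ℤˣ} {d : ℤ} {r : Mode} (hd : d = 1 ∨ d = -1)
    (h : N < (d * (ε : ℤ) * mo r : ℤ)) : N < |(r.1 : ℝ)| := by
  rw [abs_fst_eq]
  rcases hd with rfl | rfl <;> rcases Int.units_eq_one_or ε with rfl | rfl <;> simp at h <;>
    first | exact h.trans_le (le_abs_self _) | exact h.trans_le (neg_le_abs _)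

/-- A high mode cannot be conjugate to a low one, so the two shifted modes are paired with each
other; opposite shifts keep them conjugate, and the low pair does not move. -/
theorem ShiftPair.paired_of {N : ℝ} (hN : 0 < N) {δ : ℤ} {ε : ℤˣ} {J J' : Fin 4 → Mode}
    (h : ShiftPair N δ ε J J') (hP : Paired J) : Paired J' := by
  rw [paired_iff] at hP ⊢
  have h0 := high_abs (by simp) (h.fst.high (by simp)).1
  have h2 := h.trd.low rfl
  have h3 := h.fth.low rfl
  rw [← abs_fst_eq] at h2 h3
  rcases hP with hP | hP | hP
  · left
    rw [h.trd.eq, h.fth.eq]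
    refine ⟨mode_ext ?_ ?_, hP.2⟩
    · rw [h.snd.mom, mo_cj, h.fst.mom, hP.1, mo_cj]; ring
    · rw [← h.snd.sign, hP.1]
      simp [DNLW.cj, h.fst.sign]
  · rw [hP.1] at h2
    simp only [DNLW.cj] at h2
    linarith
  · rw [hP.1] at h3
    simp only [DNLW.cj] at h3
    linarith

/-- A mode in `I` has size at most `κ < N`, so it is one of the two low modes, which are not moved.
-/
theorem ShiftPair.nonRes_of {N : ℝ} {I : Finset ℤ} (hN : (kappa I : ℝ) < N) {δ : ℤ} {ε : ℤˣ}
    {J J' : Fin 4 → Mode} (h : ShiftPair N δ ε J J') (hJ : NonRes I J) : NonRes I J' := by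
  have hN0 : 0 < N := lt_of_le_of_lt (Nat.cast_nonneg _) hN
  obtain ⟨h1, ⟨i, hi⟩, h3⟩ := hJ
  have hk : ∀ j ∈ I, |(j : ℝ)| < N := fun j hj => by
    have : j.natAbs ≤ kappa I := Finset.le_sup (f := Int.natAbs) hj
    refine lt_of_le_of_lt ?_ hN
    rw [← Int.cast_abs, Int.abs_eq_natAbs]
    exact_mod_cast this
  refine ⟨?_, ?_, fun hP => h3 (h.symm.paired_of hN0 hP)⟩
  · rw [Fin.sum_univ_four] at h1 ⊢
    rw [h.fst.mom, h.snd.mom, h.trd.mom, h.fth.mom]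
    linear_combination h1
  · have h0 := high_abs (by simp) (h.fst.high (by simp)).1
    have h1 := high_abs (by simp) (h.snd.high (by simp)).1
    fin_cases i
    · exact absurd (hk _ hi) (not_lt.2 h0.le)
    · exact absurd (hk _ hi) (not_lt.2 h1.le)
    · exact ⟨2, by rw [h.trd.eq]; exact hi⟩
    · exact ⟨3, by rw [h.fth.eq]; exact hi⟩

theorem ShiftPair.nonRes_iff {N : ℝ} {I : Finset ℤ} (hN : (kappa I : ℝ) < N) {δ : ℤ} {ε : ℤˣ}
    {J J' : Fin 4 → Mode} (h : ShiftPair N δ ε J J') : NonRes I J' ↔ NonRes I J :=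
  ⟨h.symm.nonRes_of hN, h.nonRes_of hN⟩

theorem abs_unit (σ : ℤˣ) : |((σ : ℤ) : ℝ)| = 1 := by
  rcases Int.units_eq_one_or σ with h | h <;> simp [h]

/-- With equal signs the high frequencies add up to more than `2N`, while each low one is at most
`N/4 + √m ≤ N/2`. -/
theorem ShiftPair.divisor_ge {m N : ℝ} (hm : 0 < m) (hN : Real.sqrt m ≤ N / 4) {δ : ℤ} {ε : ℤˣ}
    {J J' : Fin 4 → Mode} (h : ShiftPair N δ ε J J') (hs : (J 0).2 = (J 1).2) :
    N ≤ |divisor m J| := by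
  have h0 := high_abs (by simp) (h.fst.high (by simp)).1
  have h1 := high_abs (by simp) (h.snd.high (by simp)).1
  have h2 := h.trd.low rfl
  have h3 := h.fth.low rfl
  rw [← abs_fst_eq] at h2 h3
  have f0 := abs_lt_freq hm (J 0).1
  have f1 := abs_lt_freq hm (J 1).1
  have f2 := freq_le hm (J 2).1
  have f3 := freq_le hm (J 3).1
  have e : divisor m J = (((J 0).2 : ℤ) : ℝ) * (freq m (J 0).1 + freq m (J 1).1) -
      -((((J 2).2 : ℤ) : ℝ) * freq m (J 2).1 + (((J 3).2 : ℤ) : ℝ) * freq m (J 3).1) := by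
    rw [divisor, Fin.sum_univ_four, hs]; ring
  have a1 := abs_sub_abs_le_abs_sub (((J 0).2 : ℤ) * (freq m (J 0).1 + freq m (J 1).1) : ℝ)
    (-((((J 2).2 : ℤ) : ℝ) * freq m (J 2).1 + (((J 3).2 : ℤ) : ℝ) * freq m (J 3).1))
  have a2 := abs_add_le ((((J 2).2 : ℤ) : ℝ) * freq m (J 2).1) ((((J 3).2 : ℤ) : ℝ) * freq m (J 3).1)
  rw [← e, abs_neg] at a1
  simp only [abs_mul, abs_unit, one_mul] at a1 a2
  rw [abs_of_nonneg (freq_nonneg _ _), abs_of_nonneg (freq_nonneg _ _)] at a2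
  have := le_abs_self (freq m (J 0).1 + freq m (J 1).1)
  linarith

theorem sub_freq_bound {m N : ℝ} (hm : 0 < m) (hN : 0 < N) {ε : ℤˣ} {j : ℤ}
    (h : N < ((ε : ℤ) * j : ℤ)) : 0 ≤ freq m j - (ε : ℤ) * (j : ℝ) ∧
      freq m j - (ε : ℤ) * (j : ℝ) ≤ m / N := by
  have e : (((ε : ℤ) : ℝ) * (j : ℝ)) = |(j : ℝ)| := by
    have hp : 0 < ((ε : ℤ) : ℝ) * (j : ℝ) := by push_cast at h; exact hN.trans h
    rw [← abs_of_pos hp, abs_mul, abs_unit, one_mul]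
  push_cast at h
  rw [e] at h ⊢
  exact ⟨sub_nonneg.2 (abs_lt_freq hm j).le, freq_sub_abs_le hm hN h.le⟩

/-- With opposite signs each high frequency is `±` its momentum up to an error `m/N`. The linear
parts combine into a multiple of the total momentum of the two modes, which the shift preserves;
four errors remain. -/
theorem ShiftPair.divisor_sub {m N : ℝ} (hm : 0 < m) (hN : 0 < N) {δ : ℤ} {ε : ℤˣ}
    {J J' : Fin 4 → Mode} (h : ShiftPair N δ ε J J') (hs : (J 0).2 ≠ (J 1).2) :
    |divisor m J - divisor m J'| ≤ 4 * m / N := by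
  have hs' : (J 1).2 = -(J 0).2 := by
    rcases Int.units_eq_one_or (J 0).2 with h | h <;> rcases Int.units_eq_one_or (J 1).2 with h' | h'
      <;> simp_all
  obtain ⟨h0, h0'⟩ := h.fst.high (by simp)
  obtain ⟨h1, h1'⟩ := h.snd.high (by simp)
  have e0 := h.fst.mom
  have e1 := h.snd.mom
  simp only [one_mul, mul_assoc] at h0 h0' h1 h1' e0 e1
  have k1 : ∀ s : Mode, (-1 * ((ε : ℤ) * mo s) : ℤ) = (ε : ℤ) * (-mo s) := fun s => by ring
  rw [k1] at h1 h1'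
  have b0 := sub_freq_bound hm hN h0
  have b0' := sub_freq_bound hm hN h0'
  have b1 := sub_freq_bound hm hN h1
  have b1' := sub_freq_bound hm hN h1'
  have ee : (mo (J' 0) : ℝ) + mo (J' 1) = mo (J 0) + mo (J 1) := by
    rw [e0, e1]; push_cast; ring
  have key : divisor m J - divisor m J' = (((J 0).2 : ℤ) : ℝ) *
      ((freq m (mo (J 0)) - (ε : ℤ) * (mo (J 0) : ℝ)) -
        (freq m (-mo (J 1)) - (ε : ℤ) * ((-mo (J 1) : ℤ) : ℝ)) -
        ((freq m (mo (J' 0)) - (ε : ℤ) * (mo (J' 0) : ℝ)) -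
        (freq m (-mo (J' 1)) - (ε : ℤ) * ((-mo (J' 1) : ℤ) : ℝ)))) := by
    simp only [divisor, Fin.sum_univ_four, h.trd.eq, h.fth.eq, ← h.fst.sign, ← h.snd.sign, hs']
    simp only [freq_neg, freq_mo]
    push_cast
    linear_combination (-(((J 0).2 : ℤ) : ℝ) * (ε : ℤ)) * ee
  rw [key, abs_mul, abs_unit, one_mul, abs_le]
  have : 4 * m / N = 4 * (m / N) := by ring
  rw [this]
  have : 0 ≤ m / N := by positivity
  constructor <;> linarith [b0.1, b0.2, b0'.1, b0'.2, b1.1, b1.2, b1'.1, b1'.2]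

/-- Equal signs: both inverse divisors are at most `1/N`. Opposite signs: the difference of inverses
is the difference of the divisors times two factors bounded by `c`. -/
theorem ShiftPair.symb_sub {m N c : ℝ} {I : Finset ℤ} (hm : 0 < m) (hN : (kappa I : ℝ) < N)
    (hN' : Real.sqrt m ≤ N / 4) (hc : 0 < c) (hcd : ∀ J, NonRes I J → c⁻¹ ≤ |divisor m J|)
    {δ : ℤ} {ε : ℤˣ} {J J' : Fin 4 → Mode} (h : ShiftPair N δ ε J J') :
    |symb m I J - symb m I J'| ≤ (2 + 4 * m * c ^ 2) / N := by
  have hN0 : 0 < N := lt_of_le_of_lt (Nat.cast_nonneg _) hN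
  unfold symb
  rw [h.nonRes_iff hN]
  split_ifs with hJ
  swap
  · simp only [sub_self, abs_zero]; positivity
  have hJ' := (h.nonRes_iff hN).2 hJ
  have p1 : 0 < |divisor m J| := (inv_pos.2 hc).trans_le (hcd J hJ)
  have p2 : 0 < |divisor m J'| := (inv_pos.2 hc).trans_le (hcd J' hJ')
  by_cases hs : (J 0).2 = (J 1).2
  · have a1 := h.divisor_ge hm hN' hs
    have a2 := h.symm.divisor_ge hm hN' (by rw [← h.fst.sign, ← h.snd.sign, hs])
    have b1 := inv_anti₀ hN0 a1
    have b2 := inv_anti₀ hN0 a2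
    calc _ ≤ |(divisor m J)⁻¹| + |(divisor m J')⁻¹| := abs_sub _ _
      _ ≤ N⁻¹ + N⁻¹ := by rw [abs_inv, abs_inv]; exact add_le_add b1 b2
      _ = 2 / N := by ring
      _ ≤ _ := by gcongr; nlinarith [sq_nonneg c]
  · have a1 := h.divisor_sub hm hN0 hs
    rw [inv_sub_inv (abs_pos.1 p1) (abs_pos.1 p2), abs_div, abs_mul, div_eq_mul_inv, mul_inv,
      abs_sub_comm]
    have b1 := inv_anti₀ (inv_pos.2 hc) (hcd J hJ)
    have b2 := inv_anti₀ (inv_pos.2 hc) (hcd J' hJ')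
    rw [inv_inv] at b1 b2
    calc _ ≤ (4 * m / N) * (c * c) := by gcongr
      _ = (4 * m * c ^ 2) / N := by ring
      _ ≤ _ := by gcongr; linarith

/-- Four modes are shifted, in total by zero, at most two of them being shifted. -/
structure ShiftQuad (N : ℝ) (δ : ℤ) (ε : ℤˣ) (J J' : Fin 4 → Mode) : Prop where
  out : ∃ d : Fin 4 → ℤ, (∀ i, Shift N δ ε (d i) (J i) (J' i)) ∧ ∑ i, d i = 0 ∧ ∑ i, |d i| ≤ 2

/-- An integer vector of zero sum and `ℓ¹` norm at most two is zero or has one entry `1`, one entry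
`-1` and zeros elsewhere. -/
theorem ShiftQuad.cases {N : ℝ} {δ : ℤ} {ε : ℤˣ} {J J' : Fin 4 → Mode}
    (h : ShiftQuad N δ ε J J') : J' = J ∨ ∃ τ : Equiv.Perm (Fin 4), ShiftPair N δ ε (J ∘ τ) (J' ∘ τ) := by
  obtain ⟨d, hd, h0, h2⟩ := h.out
  by_cases hz : ∀ i, d i = 0
  · left
    funext i
    have := hd i
    rw [hz i] at this
    exact this.eq
  · right
    push Not at hz
    have : ∃ a b, d a = 1 ∧ d b = -1 ∧ ∀ i, i ≠ a → i ≠ b → d i = 0 := by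
      rw [Fin.sum_univ_four] at h0 h2
      obtain ⟨i, hi⟩ := hz
      have H : ∀ a b : Fin 4, a ≠ b → d a = 1 → d b = -1 → ∀ i, i ≠ a → i ≠ b → d i = 0 := by
        intro a b hab ha hb i hia hib
        have h3 := Finset.sum_le_univ_sum_of_nonneg (s := {a, b, i}) fun i => abs_nonneg (d i)
        rw [Finset.sum_insert (by simp [hab, hia.symm]), Finset.sum_pair hib.symm,
          Fin.sum_univ_four] at h3
        rw [ha, hb] at h3
        simp only [abs_one, abs_neg] at h3
        have := abs_nonneg (d i)
        exact abs_eq_zero.1 (by omega)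
      have l := fun i => le_abs_self (d i)
      have l' := fun i => neg_le_abs (d i)
      have l0 := l 0; have l1 := l 1; have l2 := l 2; have l3 := l 3
      have n0 := l' 0; have n1 := l' 1; have n2 := l' 2; have n3 := l' 3
      have A : ∃ a, d a = 1 := by
        by_contra! hc
        have c0 := hc 0
        have c1 := hc 1
        have c2 := hc 2
        have c3 := hc 3
        fin_cases i <;> simp at hi <;> omega
      have B : ∃ a, d a = -1 := by
        by_contra! hc
        have c0 := hc 0
        have c1 := hc 1
        have c2 := hc 2
        have c3 := hc 3
        fin_cases i <;> simp at hi <;> omega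
      obtain ⟨a, ha⟩ := A
      obtain ⟨b, hb⟩ := B
      have hab : a ≠ b := by rintro rfl; omega
      exact ⟨a, b, ha, hb, H a b hab ha hb⟩
    obtain ⟨a, b, ha, hb, hab⟩ := this
    have hne : a ≠ b := by rintro rfl; omega
    have : ∃ τ : Equiv.Perm (Fin 4), τ 0 = a ∧ τ 1 = b := by
      clear ha hb hab
      revert a b
      decide
    obtain ⟨τ, h0, h1⟩ := this
    refine ⟨τ, ?_, ?_, ?_, ?_⟩
    · have := hd (τ 0); rw [h0, ha] at this; simpa [h0] using this
    · have := hd (τ 1); rw [h1, hb] at this; simpa [h1] using this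
    · have := hd (τ 2)
      rwa [hab (τ 2) (by rw [← h0]; simp) (by rw [← h1]; simp)] at this
    · have := hd (τ 3)
      rwa [hab (τ 3) (by rw [← h0]; simp) (by rw [← h1]; simp)] at this

theorem ShiftQuad.nonRes_iff {N : ℝ} {I : Finset ℤ} (hN : (kappa I : ℝ) < N) {δ : ℤ} {ε : ℤˣ}
    {J J' : Fin 4 → Mode} (h : ShiftQuad N δ ε J J') : NonRes I J' ↔ NonRes I J := by
  rcases h.cases with rfl | ⟨τ, h⟩
  · rfl
  · rw [← nonRes_perm I τ, ← nonRes_perm I τ J]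
    exact h.nonRes_iff hN

theorem ShiftQuad.symb_sub {m N c : ℝ} {I : Finset ℤ} (hm : 0 < m) (hN : (kappa I : ℝ) < N)
    (hN' : Real.sqrt m ≤ N / 4) (hc : 0 < c) (hcd : ∀ J, NonRes I J → c⁻¹ ≤ |divisor m J|)
    {δ : ℤ} {ε : ℤˣ} {J J' : Fin 4 → Mode} (h : ShiftQuad N δ ε J J') :
    |symb m I J - symb m I J'| ≤ (2 + 4 * m * c ^ 2) / N := by
  have hN0 : 0 < N := lt_of_le_of_lt (Nat.cast_nonneg _) hN
  rcases h.cases with rfl | ⟨τ, h⟩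
  · simp only [sub_self, abs_zero]; positivity
  · rw [← symb_perm m I τ, ← symb_perm m I τ J']
    exact h.symb_sub hm hN hN' hc hcd

end DNLW
end


noncomputable section

namespace DNLW

/-! ### Weighted `ℓ²` norms of sequences with values in `[0, ∞]` -/

/-- Cauchy–Schwarz with the square roots of `A` and `B` as factors; in `[0, ∞]` no summability has
to be checked. -/
theorem tsum_sq_le {ι : Type*} {c A B : ι → ℝ≥0∞} (h : ∀ i, c i ^ 2 ≤ A i * B i) :
    (∑' i, c i) ^ 2 ≤ (∑' i, A i) * ∑' i, B i := by
  have h2 : ∀ x : ℝ≥0∞, (x ^ (1 / 2 : ℝ)) ^ (2 : ℝ) = x := fun x => by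
    rw [← ENNReal.rpow_mul]; norm_num
  have hc : ∀ i, c i ≤ A i ^ (1 / 2 : ℝ) * B i ^ (1 / 2 : ℝ) := fun i => by
    rw [← ENNReal.mul_rpow_of_nonneg _ _ (by norm_num)]
    calc c i = (c i ^ 2) ^ (1 / 2 : ℝ) := by
          rw [← ENNReal.rpow_natCast, ← ENNReal.rpow_mul]; norm_num
      _ ≤ _ := ENNReal.rpow_le_rpow (h i) (by norm_num)
  have key : ∑' i, c i ≤ (∑' i, A i) ^ (1 / 2 : ℝ) * (∑' i, B i) ^ (1 / 2 : ℝ) := by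
    rw [ENNReal.tsum_eq_iSup_sum]
    refine iSup_le fun s => ?_
    have h1 := ENNReal.inner_le_Lp_mul_Lq s (fun i => A i ^ (1 / 2 : ℝ))
      (fun i => B i ^ (1 / 2 : ℝ)) Real.HolderConjugate.two_two
    simp only [h2] at h1
    refine ((Finset.sum_le_sum fun i _ => hc i).trans h1).trans ?_
    gcongr <;> exact ENNReal.sum_le_tsum s
  calc (∑' i, c i) ^ 2 = (∑' i, c i) ^ (2 : ℝ) := by rw [← ENNReal.rpow_natCast]; norm_num
    _ ≤ ((∑' i, A i) ^ (1 / 2 : ℝ) * (∑' i, B i) ^ (1 / 2 : ℝ)) ^ (2 : ℝ) :=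
        ENNReal.rpow_le_rpow key (by norm_num)
    _ = _ := by rw [ENNReal.mul_rpow_of_nonneg _ _ (by norm_num), h2, h2]

theorem rpow_half_sq (x : ℝ≥0∞) : (x ^ (1 / 2 : ℝ)) ^ 2 = x := by
  rw [← ENNReal.rpow_natCast, ← ENNReal.rpow_mul]; norm_num

theorem le_of_sq_le_sq' {x y : ℝ≥0∞} (h : x ^ 2 ≤ y ^ 2) : x ≤ y :=
  (ENNReal.pow_le_pow_left_iff (by norm_num)).1 h

/-- The weight of `ℓ^{a,p}` with values in `[0, ∞]`. -/
def eweight (a p : ℝ) (l : ℤ) : ℝ≥0∞ := ENNReal.ofReal (weight a p l)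

/-- The norm of `ℓ^{a,p}` on sequences with values in `[0, ∞]`. -/
def enorm2 (a p : ℝ) (f : ℤ → ℝ≥0∞) : ℝ≥0∞ := (∑' l, f l ^ 2 * eweight a p l) ^ (1 / 2 : ℝ)

section

variable {a p : ℝ}

theorem enorm2_sq (f : ℤ → ℝ≥0∞) : enorm2 a p f ^ 2 = ∑' l, f l ^ 2 * eweight a p l :=
  rpow_half_sq _

theorem enorm2_mono {f g : ℤ → ℝ≥0∞} (h : ∀ l, f l ≤ g l) : enorm2 a p f ≤ enorm2 a p g :=
  ENNReal.rpow_le_rpow (ENNReal.tsum_le_tsum fun l => by gcongr; exact h l) (by norm_num)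

theorem enorm2_const_mul (c : ℝ≥0∞) (f : ℤ → ℝ≥0∞) :
    enorm2 a p (fun l => c * f l) = c * enorm2 a p f := by
  have : enorm2 a p (fun l => c * f l) ^ 2 = (c * enorm2 a p f) ^ 2 := by
    rw [mul_pow, enorm2_sq, enorm2_sq, ← ENNReal.tsum_mul_left]
    exact tsum_congr fun l => by ring
  exact le_antisymm (le_of_sq_le_sq' this.le) (le_of_sq_le_sq' this.ge)

theorem enorm2_inner (f g : ℤ → ℝ≥0∞) :
    ∑' l, f l * g l * eweight a p l ≤ enorm2 a p f * enorm2 a p g := by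
  apply le_of_sq_le_sq'
  rw [mul_pow, enorm2_sq, enorm2_sq]
  exact tsum_sq_le fun l => le_of_eq (by ring)

/-- Minkowski's inequality for infinite sums. -/
theorem enorm2_tsum_le {ι : Type*} (f : ι → ℤ → ℝ≥0∞) :
    enorm2 a p (fun l => ∑' i, f i l) ≤ ∑' i, enorm2 a p (f i) := by
  apply le_of_sq_le_sq'
  rw [enorm2_sq]
  calc ∑' l, (∑' i, f i l) ^ 2 * eweight a p l
      = ∑' l, ∑' i, ∑' k, f i l * f k l * eweight a p l := by
        refine tsum_congr fun l => ?_
        rw [pow_two, mul_assoc, ← ENNReal.tsum_mul_right]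
        refine tsum_congr fun i => ?_
        rw [mul_comm _ (eweight a p l), ← mul_assoc, ← ENNReal.tsum_mul_left]
        exact tsum_congr fun k => by ring
    _ = ∑' i, ∑' k, ∑' l, f i l * f k l * eweight a p l := by
        rw [ENNReal.tsum_comm]
        exact tsum_congr fun i => ENNReal.tsum_comm
    _ ≤ ∑' i, ∑' k, enorm2 a p (f i) * enorm2 a p (f k) :=
        ENNReal.tsum_le_tsum fun i => ENNReal.tsum_le_tsum fun k => enorm2_inner _ _
    _ = (∑' i, enorm2 a p (f i)) ^ 2 := by
        rw [pow_two, ← ENNReal.tsum_mul_right]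
        exact tsum_congr fun i => ENNReal.tsum_mul_left

theorem enorm2_add_le (f g : ℤ → ℝ≥0∞) :
    enorm2 a p (fun l => f l + g l) ≤ enorm2 a p f + enorm2 a p g := by
  have := enorm2_tsum_le (a := a) (p := p) (fun b : Bool => if b then f else g)
  simpa [tsum_bool] using this

theorem japanese_neg (j : ℤ) : japanese (-j) = japanese j := by simp [japanese]

theorem weight_neg (j : ℤ) : weight a p (-j) = weight a p j := by simp [weight, japanese_neg]

theorem enorm2_neg (f : ℤ → ℝ≥0∞) : enorm2 a p (fun l => f (-l)) = enorm2 a p f := by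
  unfold enorm2
  congr 1
  rw [← (Equiv.neg ℤ).tsum_eq fun l => f l ^ 2 * eweight a p l]
  exact tsum_congr fun l => by simp [eweight, weight_neg]

theorem enorm2_enorm (z : Ell a p) : enorm2 a p (fun l => ‖z l‖ₑ) = ‖z‖ₑ := by
  have h1 : ‖z‖ₑ ^ 2 = ∑' l, ‖z l‖ₑ ^ 2 * eweight a p l := by
    have hs : Summable fun j => ‖z j‖ ^ 2 * weight a p j := z.2
    rw [← ofReal_norm, ← ENNReal.ofReal_pow (norm_nonneg _), Ell.norm_sq]
    change ENNReal.ofReal (∑' j, ‖z j‖ ^ 2 * weight a p j) = _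
    rw [ENNReal.ofReal_tsum_of_nonneg
      (fun j => mul_nonneg (sq_nonneg _) (weight_pos a p j).le) hs]
    refine tsum_congr fun j => ?_
    rw [ENNReal.ofReal_mul (sq_nonneg _), ENNReal.ofReal_pow (norm_nonneg _), ofReal_norm]
    rfl
  have h2 := enorm2_sq (a := a) (p := p) fun l => ‖z l‖ₑ
  rw [← h1] at h2
  exact le_antisymm (le_of_sq_le_sq' h2.le) (le_of_sq_le_sq' h2.ge)

/-- The element of `ℓ^{a,p}` given by a sequence of finite norm. -/
def Ell.mk (z : ℤ → ℂ) (h : enorm2 a p (fun l => ‖z l‖ₑ) < ⊤) : Ell a p := ⟨z, by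
  change Summable fun j => ‖z j‖ ^ 2 * weight a p j
  have h2 := enorm2_sq (a := a) (p := p) fun l => ‖z l‖ₑ
  have h3 : ∑' l, ‖z l‖ₑ ^ 2 * eweight a p l ≠ ⊤ := by
    rw [← h2]; exact (ENNReal.pow_lt_top h).ne
  have h4 := ENNReal.summable_toReal h3
  refine h4.congr fun j => ?_
  rw [ENNReal.toReal_mul, ENNReal.toReal_pow, toReal_enorm, eweight,
    ENNReal.toReal_ofReal (weight_pos a p j).le]⟩

theorem Ell.ext {x y : Ell a p} (h : ∀ j, x j = y j) : x = y := Subtype.ext (funext h)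

theorem one_le_japanese (j : ℤ) : 1 ≤ japanese j := le_max_left _ _

theorem japanese_pos (j : ℤ) : 0 < japanese j := one_pos.trans_le (one_le_japanese j)

theorem exp_le_weight (hp : 0 < p) (j : ℤ) : Real.exp (2 * a * |(j : ℝ)|) ≤ weight a p j :=
  le_mul_of_one_le_right (Real.exp_pos _).le
    (Real.one_le_rpow (one_le_japanese j) (by linarith))

theorem japanese_le_weight (ha : 0 < a) (j : ℤ) : japanese j ^ (2 * p) ≤ weight a p j :=
  le_mul_of_one_le_left (Real.rpow_nonneg (japanese_pos j).le _) (Real.one_le_exp (by positivity))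

/-- The exponential weight beats the linear growth of the frequencies. Since `a > 0`, the form `N`
converges absolutely on all of `ℓ^{a,p}`, without extra regularity. -/
theorem freq_le_weight {m : ℝ} (hm : 0 < m) (ha : 0 < a) (hp : 0 < p) (j : ℤ) :
    freq m j ≤ (1 / (2 * a) + Real.sqrt m) * weight a p j := by
  have h1 := freq_le hm j
  have h2 := exp_le_weight (a := a) hp j
  have h3 := Real.add_one_le_exp (2 * a * |(j : ℝ)|)
  have h4 : 1 ≤ weight a p j := (Real.one_le_exp (by positivity)).trans h2
  have h5 : |(j : ℝ)| ≤ 1 / (2 * a) * weight a p j := by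
    rw [one_div_mul_eq_div, le_div_iff₀ (by positivity)]; linarith
  nlinarith [Real.sqrt_nonneg m]

theorem japanese_sub_le (k i : ℤ) : japanese k ≤ 2 * max (japanese i) (japanese (k - i)) := by
  have h1 : |(k : ℝ)| ≤ |(i : ℝ)| + |((k - i : ℤ) : ℝ)| := by
    refine le_trans (le_of_eq ?_) (abs_add_le _ _)
    push_cast; ring_nf
  have h2 : |(i : ℝ)| ≤ max (japanese i) (japanese (k - i)) :=
    (le_max_right _ _).trans (le_max_left _ _)
  have h3 : |((k - i : ℤ) : ℝ)| ≤ max (japanese i) (japanese (k - i)) :=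
    (le_max_right 1 _).trans (le_max_right _ _)
  have h4 : 1 ≤ max (japanese i) (japanese (k - i)) := (one_le_japanese i).trans (le_max_left _ _)
  exact max_le (by linarith) (by linarith)

/-- As `⟨k⟩ ≤ 2 max(⟨i⟩, ⟨k - i⟩)`, one of the two polynomial factors on the right is not needed and
survives as a gain that is summable in `i` when `p > 1/2`. -/
theorem weight_le (ha : 0 < a) (hp : 0 < p) (k i : ℤ) :
    weight a p k ≤ 2 ^ (2 * p) * (japanese i ^ (-(2 * p)) + japanese (k - i) ^ (-(2 * p))) *
      (weight a p i * weight a p (k - i)) := by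
  have hi := japanese_pos i
  have hk := japanese_pos (k - i)
  have e1 : Real.exp (2 * a * |(k : ℝ)|) ≤
      Real.exp (2 * a * |(i : ℝ)|) * Real.exp (2 * a * |((k - i : ℤ) : ℝ)|) := by
    rw [← Real.exp_add, ← mul_add]
    apply Real.exp_le_exp.2
    apply mul_le_mul_of_nonneg_left _ (by positivity)
    refine le_trans (le_of_eq ?_) (abs_add_le _ _)
    push_cast; ring_nf
  have e2 : japanese k ^ (2 * p) ≤
      2 ^ (2 * p) * (japanese i ^ (2 * p) + japanese (k - i) ^ (2 * p)) := by
    calc japanese k ^ (2 * p) ≤ (2 * max (japanese i) (japanese (k - i))) ^ (2 * p) :=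
          Real.rpow_le_rpow (japanese_pos k).le (japanese_sub_le k i) (by linarith)
      _ = 2 ^ (2 * p) * (max (japanese i) (japanese (k - i))) ^ (2 * p) :=
          Real.mul_rpow (by norm_num) (hi.le.trans (le_max_left _ _))
      _ ≤ _ := by
          gcongr
          rcases max_choice (japanese i) (japanese (k - i)) with h | h <;> rw [h]
          · exact le_add_of_nonneg_right (Real.rpow_nonneg hk.le _)
          · exact le_add_of_nonneg_left (Real.rpow_nonneg hi.le _)
  have p1 := Real.rpow_pos_of_pos hi (2 * p)
  have p2 := Real.rpow_pos_of_pos hk (2 * p)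
  rw [Real.rpow_neg hi.le, Real.rpow_neg hk.le]
  calc weight a p k ≤ (Real.exp (2 * a * |(i : ℝ)|) * Real.exp (2 * a * |((k - i : ℤ) : ℝ)|)) *
        (2 ^ (2 * p) * (japanese i ^ (2 * p) + japanese (k - i) ^ (2 * p))) :=
        mul_le_mul e1 e2 (Real.rpow_nonneg (japanese_pos k).le _) (by positivity)
    _ = _ := by
        unfold weight
        field_simp
        ring

theorem summable_japanese (hp : 1 / 2 < p) : Summable fun j : ℤ => japanese j ^ (-(2 * p)) := by
  refine (summable_congr_cofinite ?_).1 (Real.summable_abs_int_rpow (b := 2 * p) (by linarith))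
  rw [Filter.eventuallyEq_iff_exists_mem]
  refine ⟨{0}ᶜ, (Set.finite_singleton 0).compl_mem_cofinite, fun j hj => ?_⟩
  have : (1 : ℝ) ≤ |(j : ℝ)| := by exact_mod_cast Int.one_le_abs hj
  simp only [japanese]
  rw [max_eq_right this]

/-- The constant of the embedding of `ℓ^{a,p}` into `ℓ¹`, squared. -/
def japSum (p : ℝ) : ℝ≥0∞ := ∑' j : ℤ, ENNReal.ofReal (japanese j ^ (-(2 * p)))

theorem japSum_lt_top (hp : 1 / 2 < p) : japSum p < ⊤ := by
  unfold japSum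
  rw [← ENNReal.ofReal_tsum_of_nonneg (fun j => Real.rpow_nonneg (japanese_pos j).le _)
    (summable_japanese hp)]
  exact ENNReal.ofReal_lt_top

theorem tsum_le_enorm2 (ha : 0 < a) (f : ℤ → ℝ≥0∞) :
    ∑' l, f l ≤ japSum p ^ (1 / 2 : ℝ) * enorm2 a p f := by
  apply le_of_sq_le_sq'
  rw [mul_pow, rpow_half_sq, enorm2_sq]
  refine tsum_sq_le fun l => ?_
  have h : 1 ≤ ENNReal.ofReal (japanese l ^ (-(2 * p))) * eweight a p l := by
    rw [eweight, ← ENNReal.ofReal_mul (Real.rpow_nonneg (japanese_pos l).le _),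
      ENNReal.one_le_ofReal, Real.rpow_neg (japanese_pos l).le, inv_mul_eq_div,
      one_le_div (Real.rpow_pos_of_pos (japanese_pos l) _)]
    exact japanese_le_weight ha l
  calc f l ^ 2 = f l ^ 2 * 1 := (mul_one _).symm
    _ ≤ f l ^ 2 * (ENNReal.ofReal (japanese l ^ (-(2 * p))) * eweight a p l) := by gcongr
    _ = _ := by ring

/-- The constant of the algebra property of `ℓ^{a,p}`. -/
def algConst (p : ℝ) : ℝ≥0∞ := (ENNReal.ofReal (2 ^ (2 * p)) * (2 * japSum p)) ^ (1 / 2 : ℝ)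

theorem algConst_lt_top (hp : 1 / 2 < p) : algConst p < ⊤ :=
  ENNReal.rpow_lt_top_of_nonneg (by norm_num) (ENNReal.mul_lt_top ENNReal.ofReal_lt_top
    (ENNReal.mul_lt_top (by simp) (japSum_lt_top hp))).ne

/-- Cauchy–Schwarz in `i` against the kernel `u` coming from `weight_le`. The sum of `u` does not
depend on `k`, so what remains is an ordinary convolution of the weighted squares, summed over `k`
by translation. -/
theorem enorm2_conv_le (ha : 0 < a) (hp : 0 < p) (f g : ℤ → ℝ≥0∞) :
    enorm2 a p (fun k => ∑' i, f i * g (k - i)) ≤ algConst p * (enorm2 a p f * enorm2 a p g) := by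
  apply le_of_sq_le_sq'
  rw [mul_pow, mul_pow, enorm2_sq, enorm2_sq, enorm2_sq, algConst, rpow_half_sq]
  set A := ENNReal.ofReal (2 ^ (2 * p)) * (2 * japSum p)
  have key : ∀ k, (∑' i, f i * g (k - i)) ^ 2 * eweight a p k ≤
      A * ∑' i, (f i ^ 2 * eweight a p i) * (g (k - i) ^ 2 * eweight a p (k - i)) := by
    intro k
    have hw0 : eweight a p k ≠ 0 := by simpa [eweight] using weight_pos a p k
    have hwt : eweight a p k ≠ ⊤ := ENNReal.ofReal_ne_top
    set u : ℤ → ℝ≥0∞ := fun i => ENNReal.ofReal (2 ^ (2 * p)) *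
      (ENNReal.ofReal (japanese i ^ (-(2 * p))) + ENNReal.ofReal (japanese (k - i) ^ (-(2 * p))))
    have hu : ∑' i, u i = A := by
      rw [ENNReal.tsum_mul_left, ENNReal.tsum_add]
      have : ∑' i, ENNReal.ofReal (japanese (k - i) ^ (-(2 * p))) = japSum p :=
        (Equiv.subLeft k).tsum_eq fun i => ENNReal.ofReal (japanese i ^ (-(2 * p)))
      rw [this]
      change _ * (japSum p + japSum p) = _
      rw [← two_mul]
    have h1 : ∀ i, (f i * g (k - i)) ^ 2 ≤ ((eweight a p k)⁻¹ * u i) *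
        ((f i ^ 2 * eweight a p i) * (g (k - i) ^ 2 * eweight a p (k - i))) := by
      intro i
      have h2 : eweight a p k ≤ u i * (eweight a p i * eweight a p (k - i)) := by
        have := ENNReal.ofReal_le_ofReal (weight_le ha hp k i)
        rw [ENNReal.ofReal_mul (by
            have := Real.rpow_pos_of_pos (japanese_pos i) (-(2 * p))
            have := Real.rpow_pos_of_pos (japanese_pos (k - i)) (-(2 * p))
            positivity),
          ENNReal.ofReal_mul (by positivity), ENNReal.ofReal_add
            (Real.rpow_nonneg (japanese_pos i).le _) (Real.rpow_nonneg (japanese_pos (k - i)).le _),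
          ENNReal.ofReal_mul (weight_pos a p i).le] at this
        exact this
      have h3 : 1 ≤ (eweight a p k)⁻¹ * (u i * (eweight a p i * eweight a p (k - i))) := by
        rw [← ENNReal.inv_mul_cancel hw0 hwt]
        gcongr
      calc (f i * g (k - i)) ^ 2 = (f i * g (k - i)) ^ 2 * 1 := (mul_one _).symm
        _ ≤ (f i * g (k - i)) ^ 2 *
            ((eweight a p k)⁻¹ * (u i * (eweight a p i * eweight a p (k - i)))) := by gcongr
        _ = _ := by ring
    have h4 := tsum_sq_le h1
    rw [ENNReal.tsum_mul_left, hu] at h4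
    calc _ ≤ _ := mul_le_mul_left h4 _
      _ = ((eweight a p k)⁻¹ * eweight a p k) * (A * ∑' i, (f i ^ 2 * eweight a p i) *
          (g (k - i) ^ 2 * eweight a p (k - i))) := by ring
      _ = _ := by rw [ENNReal.inv_mul_cancel hw0 hwt, one_mul]
  calc _ ≤ ∑' k, A * ∑' i, (f i ^ 2 * eweight a p i) * (g (k - i) ^ 2 * eweight a p (k - i)) :=
        ENNReal.tsum_le_tsum key
    _ = A * ∑' i, (f i ^ 2 * eweight a p i) * ∑' k, (g (k - i) ^ 2 * eweight a p (k - i)) := by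
        rw [ENNReal.tsum_mul_left, ENNReal.tsum_comm]
        simp_rw [ENNReal.tsum_mul_left]
    _ = _ := by
        have : ∀ i, ∑' k, (g (k - i) ^ 2 * eweight a p (k - i)) = ∑' l, g l ^ 2 * eweight a p l :=
          fun i => (Equiv.subRight i).tsum_eq fun l => g l ^ 2 * eweight a p l
        simp_rw [this, ENNReal.tsum_mul_right]

end

/-! ### Sums over tuples of modes of given momentum -/

/-- `∑_{mo s = j} x_s`. -/
def fold (x : Mode → ℝ≥0∞) (j : ℤ) : ℝ≥0∞ := x (j, 1) + x (-j, -1)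

theorem tsum_mode (x : Mode → ℝ≥0∞) : ∑' s, x s = ∑' j, (x (j, 1) + x (j, -1)) := by
  rw [ENNReal.tsum_prod']
  refine tsum_congr fun j => ?_
  rw [tsum_fintype]
  simp

theorem tsum_fold (x : Mode → ℝ≥0∞) (g : ℤ → ℝ≥0∞) :
    ∑' s, x s * g (mo s) = ∑' j, fold x j * g j := by
  rw [tsum_mode, ENNReal.tsum_add]
  simp only [fold, add_mul, ENNReal.tsum_add]
  congr 1
  · simp [mo]
  · rw [← (Equiv.neg ℤ).tsum_eq]
    simp [mo]

theorem tsum_mode_eq_fold (x : Mode → ℝ≥0∞) : ∑' s, x s = ∑' j, fold x j := by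
  simpa using tsum_fold x fun _ => 1

/-- The sum of the products `x₀(s₀) ⋯ x_{n-1}(s_{n-1})` over all modes of total momentum `k`. -/
def momSum {n : ℕ} (x : Fin n → Mode → ℝ≥0∞) (k : ℤ) : ℝ≥0∞ :=
  ∑' J : Fin n → Mode, if ∑ i, mo (J i) = k then ∏ i, x i (J i) else 0

theorem momSum_one (x : Fin 1 → Mode → ℝ≥0∞) (k : ℤ) : momSum x k = fold (x 0) k := by
  unfold momSum
  rw [← (Equiv.funUnique (Fin 1) Mode).symm.tsum_eq]
  have := tsum_fold (x 0) (fun j => if j = k then 1 else 0)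
  simp at this
  simpa using this

theorem momSum_succ {n : ℕ} (x : Fin (n + 1) → Mode → ℝ≥0∞) (k : ℤ) :
    momSum x k = ∑' j, fold (x 0) j * momSum (fun i => x i.succ) (k - j) := by
  rw [← tsum_fold (x 0) fun j => momSum (fun i => x i.succ) (k - j)]
  unfold momSum
  rw [← (Fin.consEquiv fun _ => Mode).tsum_eq, ENNReal.tsum_prod']
  refine tsum_congr fun s => ?_
  rw [← ENNReal.tsum_mul_left]
  refine tsum_congr fun J => ?_
  simp only [Fin.consEquiv, Equiv.coe_fn_mk, Fin.sum_univ_succ, Fin.prod_univ_succ, Fin.cons_zero,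
    Fin.cons_succ]
  have : (mo s + ∑ i, mo (J i) = k) ↔ ∑ i, mo (J i) = k - mo s := by omega
  rw [if_congr this rfl rfl, mul_ite, mul_zero]

/-- Prescribing the total momentum makes the sum of products an iterated convolution of the folded
sequences; each convolution costs one factor `algConst`. -/
theorem enorm2_momSum_le {a p : ℝ} (ha : 0 < a) (hp : 0 < p) :
    ∀ {n : ℕ} (x : Fin (n + 1) → Mode → ℝ≥0∞),
      enorm2 a p (momSum x) ≤ algConst p ^ n * ∏ i, enorm2 a p (fold (x i))
  | 0, x => by
    rw [pow_zero, one_mul, Fin.prod_univ_succ, Finset.univ_eq_empty, Finset.prod_empty, mul_one]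
    exact enorm2_mono fun l => (momSum_one x l).le
  | n + 1, x => by
    have h1 : enorm2 a p (momSum x) ≤ _ :=
      (enorm2_mono fun l => (momSum_succ x l).le).trans (enorm2_conv_le ha hp _ _)
    refine h1.trans ?_
    rw [Fin.prod_univ_succ, pow_succ']
    calc _ ≤ algConst p * (enorm2 a p (fold (x 0)) *
          (algConst p ^ n * ∏ i : Fin (n + 1), enorm2 a p (fold (x i.succ)))) := by
          gcongr
          exact enorm2_momSum_le ha hp fun i => x i.succ
      _ = _ := by ring

/-! ### Moduli of the coordinates of a phase point. -/

section

variable {a p : ℝ}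

/-- The moduli of the coordinates of a point of the phase space. -/
def ecoord (w : Phase a p) (s : Mode) : ℝ≥0∞ := ‖coord w s‖ₑ

theorem coord_one (w : Phase a p) (j : ℤ) : coord w (j, 1) = w.1 j := by simp [coord]

theorem coord_neg_one (w : Phase a p) (j : ℤ) : coord w (j, -1) = w.2 j := by
  simp [coord, show (-1 : ℤˣ) ≠ 1 by decide]

theorem enorm2_fold_ecoord (w : Phase a p) :
    enorm2 a p (fold (ecoord w)) ≤ ‖w.1‖ₑ + ‖w.2‖ₑ := by
  refine (enorm2_add_le _ _).trans ?_
  refine add_le_add (le_of_eq ?_) (le_of_eq ?_)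
  · rw [← enorm2_enorm w.1]
    simp [ecoord, coord_one]
  · rw [← enorm2_enorm w.2, ← enorm2_neg]
    simp [ecoord, coord_neg_one]

theorem tsum_ecoord_le (ha : 0 < a) (w : Phase a p) :
    ∑' s, ecoord w s ≤ japSum p ^ (1 / 2 : ℝ) * (‖w.1‖ₑ + ‖w.2‖ₑ) := by
  rw [tsum_mode_eq_fold]
  refine (tsum_le_enorm2 (p := p) ha _).trans ?_
  gcongr
  exact enorm2_fold_ecoord w

theorem Phase.ext {v w : Phase a p} (h : ∀ s, coord v s = coord w s) : v = w :=
  Prod.ext (Ell.ext fun j => by simpa [coord_one] using h (j, 1))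
    (Ell.ext fun j => by simpa [coord_neg_one] using h (j, -1))

end

end DNLW
end


noncomputable section

namespace DNLW

/-! ### Ternary trees -/

/-- Ternary trees with labelled leaves and signed nodes. -/
inductive Ternary (α : Type) : Type
  | leaf (a : α) : Ternary α
  | node (σ : ℤˣ) (t₁ t₂ t₃ : Ternary α) : Ternary α

namespace Ternary

variable {α β : Type}

/-- The list of the labels of the leaves. -/
def leaves : Ternary α → List α
  | leaf a => [a]
  | node _ t₁ t₂ t₃ => t₁.leaves ++ (t₂.leaves ++ t₃.leaves)

/-- The number of nodes. -/
def nodes : Ternary α → ℕ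
  | leaf _ => 0
  | node _ t₁ t₂ t₃ => t₁.nodes + t₂.nodes + t₃.nodes + 1

/-- Relabelling of the leaves. -/
def map (f : α → β) : Ternary α → Ternary β
  | leaf a => leaf (f a)
  | node σ t₁ t₂ t₃ => node σ (t₁.map f) (t₂.map f) (t₃.map f)

/-- The depth of a tree. -/
def depth : Ternary α → ℕ
  | leaf _ => 0
  | node _ t₁ t₂ t₃ => max t₁.depth (max t₂.depth t₃.depth) + 1

theorem length_leaves (t : Ternary α) : t.leaves.length = 2 * t.nodes + 1 := by
  induction t with
  | leaf a => rfl
  | node σ t₁ t₂ t₃ h₁ h₂ h₃ => simp only [leaves, nodes, List.length_append, h₁, h₂, h₃]; ring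

theorem leaves_map (f : α → β) (t : Ternary α) : (t.map f).leaves = t.leaves.map f := by
  induction t with
  | leaf a => rfl
  | node σ t₁ t₂ t₃ h₁ h₂ h₃ => simp [leaves, map, h₁, h₂, h₃]

theorem nodes_map (f : α → β) (t : Ternary α) : (t.map f).nodes = t.nodes := by
  induction t with
  | leaf a => rfl
  | node σ t₁ t₂ t₃ h₁ h₂ h₃ => simp [nodes, map, h₁, h₂, h₃]

theorem map_map_eq {f : α → β} {g : β → α} (h : ∀ a, g (f a) = a) (t : Ternary α) :
    (t.map f).map g = t := by
  induction t with
  | leaf a => simp [map, h]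
  | node σ t₁ t₂ t₃ h₁ h₂ h₃ => simp [map, h₁, h₂, h₃]

/-- Relabelling along an equivalence. -/
def mapEquiv (e : α ≃ β) : Ternary α ≃ Ternary β where
  toFun := map e
  invFun := map e.symm
  left_inv := map_map_eq (by simp)
  right_inv := map_map_eq (by simp)

/-- The shape fixes the number of leaves of every subtree, so the list of labels can be cut in only
one way. This injects labelled trees into shapes times lists. -/
theorem ext_of_shape {s t : Ternary α} (h : s.map (fun _ => ()) = t.map (fun _ => ()))
    (hl : s.leaves = t.leaves) : s = t := by
  induction s generalizing t with
  | leaf a =>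
    cases t with
    | leaf b => simpa [leaves] using hl
    | node => simp [map] at h
  | node σ s₁ s₂ s₃ h₁ h₂ h₃ =>
    cases t with
    | leaf b => simp [map] at h
    | node τ t₁ t₂ t₃ =>
      simp only [map, node.injEq] at h
      obtain ⟨rfl, e₁, e₂, e₃⟩ := h
      have l : ∀ {s t : Ternary α}, s.map (fun _ => ()) = t.map (fun _ => ()) →
          s.leaves.length = t.leaves.length := fun {s t} h => by
        rw [length_leaves, length_leaves, ← nodes_map (fun _ => ()) s, h, nodes_map]
      obtain ⟨a₁, a⟩ := List.append_inj hl (l e₁)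
      obtain ⟨a₂, a₃⟩ := List.append_inj a (l e₂)
      rw [h₁ e₁ a₁, h₂ e₂ a₂, h₃ e₃ a₃]

/-- A tree is a leaf or a signed triple of trees. -/
def equivSum (α : Type) : Ternary α ≃ α ⊕ (ℤˣ × Ternary α × Ternary α × Ternary α) where
  toFun
    | leaf a => Sum.inl a
    | node σ t₁ t₂ t₃ => Sum.inr (σ, t₁, t₂, t₃)
  invFun
    | Sum.inl a => leaf a
    | Sum.inr (σ, t₁, t₂, t₃) => node σ t₁ t₂ t₃
  left_inv t := by cases t <;> rfl
  right_inv x := by rcases x with a | ⟨σ, t₁, t₂, t₃⟩ <;> rfl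

theorem hasSum_of_leaf_of_node {E : Type*} [AddCommMonoid E] [TopologicalSpace E] [ContinuousAdd E]
    {f : Ternary α → E} {A B : E} (h1 : HasSum (fun a => f (leaf a)) A)
    (h2 : HasSum (fun q : ℤˣ × Ternary α × Ternary α × Ternary α =>
      f (node q.1 q.2.1 q.2.2.1 q.2.2.2)) B) : HasSum f (A + B) := by
  rw [← (equivSum α).symm.hasSum_iff]
  exact HasSum.sum (f := f ∘ (equivSum α).symm) h1 h2

theorem tsum_eq_leaf_add_node (f : Ternary α → ℝ≥0∞) :
    ∑' t, f t = ∑' a, f (leaf a) + ∑' σ, ∑' t₁, ∑' t₂, ∑' t₃, f (node σ t₁ t₂ t₃) := by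
  rw [(hasSum_of_leaf_of_node (f := f) ENNReal.summable.hasSum ENNReal.summable.hasSum).tsum_eq]
  simp only [ENNReal.tsum_prod']

/-- The sum of the weights of all trees is bounded by twice the sum of the weights of the
leaves, if the latter is small. -/
theorem tsum_weight_le {c : ℝ≥0∞} {x : α → ℝ≥0∞} (h : 16 * c * (∑' a, x a) ^ 2 ≤ 1) :
    ∑' t : Ternary α, c ^ t.nodes * (t.leaves.map x).prod ≤ 2 * ∑' a, x a := by
  set y := ∑' a, x a
  set g : Ternary α → ℝ≥0∞ := fun t => c ^ t.nodes * (t.leaves.map x).prod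
  -- For the sum `S` over trees of depth below `d`, cutting at the root gives `y + 2 c S³` as a
  -- bound at the next depth, the `2` counting the signs of the root. The bound `2y` reproduces
  -- itself because `16 c y² ≤ 1`.
  have key : ∀ d : ℕ, ∑' t : Ternary α, (if t.depth < d then g t else 0) ≤ 2 * y := by
    intro d
    induction d with
    | zero => simp
    | succ d ih =>
      rw [tsum_eq_leaf_add_node]
      set S := ∑' t : Ternary α, (if t.depth < d then g t else 0)
      have h1 : ∀ σ : ℤˣ, ∀ t₁ t₂ t₃ : Ternary α,
          (if (node σ t₁ t₂ t₃).depth < d + 1 then g (node σ t₁ t₂ t₃) else 0) ≤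
          c * ((if t₁.depth < d then g t₁ else 0) * ((if t₂.depth < d then g t₂ else 0) *
            (if t₃.depth < d then g t₃ else 0))) := by
        intro σ t₁ t₂ t₃
        split_ifs with h0 h1 h2 h3 h3 h2 h3 h3 <;>
          first | (simp only [depth] at h0; exfalso; omega) | skip
        · refine le_of_eq ?_
          simp only [g, nodes, leaves, List.map_append, List.prod_append, pow_add, pow_one]
          ring
        all_goals simp
      have h2 : ∑' a, (if (leaf a : Ternary α).depth < d + 1 then g (leaf a) else 0) = y :=
        tsum_congr fun a => by simp [depth, g, nodes, leaves]
      rw [h2]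
      calc _ ≤ y + ∑' σ : ℤˣ, ∑' t₁ : Ternary α, ∑' t₂ : Ternary α, ∑' t₃ : Ternary α,
          c * ((if t₁.depth < d then g t₁ else 0) * ((if t₂.depth < d then g t₂ else 0) *
            (if t₃.depth < d then g t₃ else 0))) :=
            add_le_add le_rfl (ENNReal.tsum_le_tsum fun σ => ENNReal.tsum_le_tsum fun t₁ =>
              ENNReal.tsum_le_tsum fun t₂ => ENNReal.tsum_le_tsum fun t₃ => h1 σ t₁ t₂ t₃)
        _ = y + 2 * c * S ^ 3 := by
            simp_rw [ENNReal.tsum_mul_left, ENNReal.tsum_mul_right]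
            rw [tsum_fintype]
            simp only [Finset.sum_const, Finset.card_univ, Fintype.card_units_int, nsmul_eq_mul]
            push_cast
            ring
        _ ≤ y + 2 * c * (2 * y) ^ 3 := by gcongr
        _ = y + (16 * c * y ^ 2) * y := by ring
        _ ≤ y + 1 * y := by gcongr
        _ = 2 * y := by ring
  rw [ENNReal.tsum_eq_iSup_sum]
  refine iSup_le fun s => ?_
  refine le_trans ?_ (key (s.sup depth + 1))
  refine le_trans (Finset.sum_le_sum fun t ht => ?_) (ENNReal.sum_le_tsum s)
  rw [if_pos (Nat.lt_succ_of_le (Finset.le_sup ht))]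

end Ternary

/-! ### Counting monomials -/

/-- The multi-index of a list of modes. -/
def lidx (J : List Mode) : MIdx := (J.map fun s => Finsupp.single s 1).sum

theorem lidx_nil : lidx [] = 0 := rfl

theorem lidx_cons (s : Mode) (J : List Mode) : lidx (s :: J) = Finsupp.single s 1 + lidx J := by
  simp [lidx]

theorem lidx_map (f : Mode → Mode) (J : List Mode) : lidx (J.map f) = (lidx J).mapDomain f := by
  induction J with
  | nil => simp [lidx]
  | cons s J ih => simp [lidx_cons, ih, Finsupp.mapDomain_add, Finsupp.mapDomain_single]

theorem degree_lidx (J : List Mode) : (lidx J).degree = J.length := by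
  induction J with
  | nil => simp [lidx]
  | cons s J ih => simp [lidx_cons, ih, add_comm]

theorem momentum_add (γ γ' : MIdx) : momentum (γ + γ') = momentum γ + momentum γ' := by
  unfold momentum
  exact Finsupp.sum_add_index' (by simp) fun s a b => by push_cast; ring

theorem momentum_single (s : Mode) : momentum (Finsupp.single s 1) = mo s := by
  simp [momentum, mo]

theorem momentum_zero : momentum 0 = 0 := by simp [momentum]

theorem momentum_lidx (J : List Mode) : momentum (lidx J) = (J.map mo).sum := by
  induction J with
  | nil => simp [lidx, momentum_zero]
  | cons s J ih => simp [lidx_cons, ih, momentum_add, momentum_single]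

theorem prod_lidx {M : Type*} [CommMonoid M] (x : Mode → M) (J : List Mode) :
    ((lidx J).prod fun s k => x s ^ k) = (J.map x).prod := by
  induction J with
  | nil => simp [lidx]
  | cons s J ih =>
    rw [lidx_cons, Finsupp.prod_add_index' (by simp) fun s a b => pow_add _ _ _, ih]
    simp

/-- The value of the monomials at a point with coordinates in `[0, ∞]`. -/
def emonom (x : Mode → ℝ≥0∞) (γ : MIdx) : ℝ≥0∞ := γ.prod fun s k => x s ^ k

theorem emonom_lidx (x : Mode → ℝ≥0∞) (J : List Mode) : emonom x (lidx J) = (J.map x).prod :=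
  prod_lidx x J

open Classical in
/-- Grouping the terms of a sum by the values of a map. -/
theorem tsum_fiber {Q B : Type*} (π : Q → B) (G : B → Q → ℝ≥0∞) :
    ∑' q, G (π q) q = ∑' b, ∑' q, if π q = b then G b q else 0 := by
  rw [ENNReal.tsum_comm]
  refine tsum_congr fun q => ?_
  rw [tsum_eq_single (π q) fun b hb => if_neg fun h => hb h.symm, if_pos rfl]

open Classical in
/-- The number of lists of modes with a given multi-index. -/
def ord (γ : MIdx) : ℝ≥0∞ := ∑' J : List Mode, if lidx J = γ then 1 else 0

open Classical in
/-- If the elements of `Q` are determined by a shape and by a list of modes, of length given by the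
shape, then the weighted number of elements of multi-index `γ` is at most the number of lists
of multi-index `γ` times the weighted number of shapes of that length. -/
theorem tsum_shape_list_le {Q S : Type*} (π : Q → List Mode) (sh : Q → S) (len : S → ℕ)
    (hlen : ∀ q, len (sh q) = (π q).length) (hinj : Function.Injective fun q => (sh q, π q))
    (W : S → ℝ≥0∞) (F : List Mode → ℝ≥0∞) :
    ∑' q, F (π q) * W (sh q) ≤ ∑' J, F J * ∑' s, if len s = J.length then W s else 0 := by
  set g : S × List Mode → ℝ≥0∞ := fun x => if len x.1 = x.2.length then F x.2 * W x.1 else 0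
  calc ∑' q, F (π q) * W (sh q) = ∑' q, g (sh q, π q) := tsum_congr fun q => by simp [g, hlen]
    _ ≤ ∑' x, g x := ENNReal.tsum_comp_le_tsum_of_injective hinj g
    _ = _ := by
        rw [ENNReal.tsum_prod', ENNReal.tsum_comm]
        refine tsum_congr fun J => ?_
        rw [← ENNReal.tsum_mul_left]
        exact tsum_congr fun s => by simp [g]

theorem tsum_list_eq (F : List Mode → ℝ≥0∞) :
    ∑' J, F J = ∑' n, ∑' f : Fin n → Mode, F (List.ofFn f) := by
  rw [← List.equivSigmaTuple.symm.tsum_eq, ENNReal.tsum_sigma']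
  rfl

theorem sum_map_ofFn {n : ℕ} {M : Type*} [AddCommMonoid M] (g : Mode → M) (f : Fin n → Mode) :
    ((List.ofFn f).map g).sum = ∑ i, g (f i) := by
  rw [List.map_ofFn, List.sum_ofFn]; rfl

theorem prod_map_ofFn {n : ℕ} {M : Type*} [CommMonoid M] (g : Mode → M) (f : Fin n → Mode) :
    ((List.ofFn f).map g).prod = ∏ i, g (f i) := by
  rw [List.map_ofFn, List.prod_ofFn]; rfl

/-- Sums over lists of given momentum, with a coefficient depending on the length. -/
theorem tsum_list_momSum (b : ℕ → ℝ≥0∞) (x : Mode → ℝ≥0∞) (k : ℤ) :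
    ∑' J : List Mode, (if (J.map mo).sum = k then b J.length * (J.map x).prod else 0) =
      ∑' n, b n * momSum (fun _ : Fin n => x) k := by
  rw [tsum_list_eq]
  refine tsum_congr fun n => ?_
  unfold momSum
  rw [← ENNReal.tsum_mul_left]
  refine tsum_congr fun f => ?_
  rw [sum_map_ofFn, prod_map_ofFn, List.length_ofFn, mul_ite, mul_zero]

theorem tsum_ord_mul (F : MIdx → ℝ≥0∞) : ∑' γ, ord γ * F γ = ∑' J : List Mode, F (lidx J) := by
  classical
  rw [tsum_fiber lidx fun γ _ => F γ]
  refine tsum_congr fun γ => ?_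
  rw [ord, ← ENNReal.tsum_mul_right]
  exact tsum_congr fun J => by simp

theorem tsum_ord_momSum (b : ℕ → ℝ≥0∞) (x : Mode → ℝ≥0∞) (k : ℤ) :
    ∑' γ : MIdx, ord γ * (if momentum γ = k then b γ.degree * emonom x γ else 0) =
      ∑' n, b n * momSum (fun _ : Fin n => x) k := by
  rw [tsum_ord_mul, ← tsum_list_momSum]
  exact tsum_congr fun J => by rw [momentum_lidx, degree_lidx, emonom_lidx]

theorem lidx_ofFn {n : ℕ} (f : Fin n → Mode) :
    lidx (List.ofFn f) = ∑ i, Finsupp.single (f i) 1 := sum_map_ofFn _ f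

theorem ord_eq (γ : MIdx) : ord γ =
    ∑' f : Fin γ.degree → Mode, if lidx (List.ofFn f) = γ then 1 else 0 := by
  classical
  unfold ord
  rw [tsum_list_eq, tsum_eq_single γ.degree]
  · intro n hn
    rw [ENNReal.tsum_eq_zero]
    intro f
    rw [if_neg]
    rintro rfl
    rw [degree_lidx, List.length_ofFn] at hn
    exact hn rfl

theorem ord_eq' {γ : MIdx} {n : ℕ} (h : γ.degree = n) : ord γ =
    ∑' f : Fin n → Mode, if lidx (List.ofFn f) = γ then 1 else 0 := by
  subst h; exact ord_eq γ

/-- Both sides count the lists of multi-index `γ + e_s` with one marked entry equal to `s`: choose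
the list and then the mark, or insert `s` at one of `degree + 1` places of a list of multi-index
`γ`. The exponent produced by a derivative is thereby traded for a factor depending only on the
degree. -/
theorem ord_succ (γ : MIdx) (s : Mode) :
    ((γ s + 1 : ℕ) : ℝ≥0∞) * ord (γ + Finsupp.single s 1) = ((γ.degree + 1 : ℕ) : ℝ≥0∞) * ord γ := by
  classical
  set n := γ.degree with hn
  have hdeg : (γ + Finsupp.single s 1).degree = n + 1 := by
    rw [map_add, Finsupp.degree_single]
  rw [ord_eq' hdeg, ord_eq' hn.symm, ← ENNReal.tsum_mul_left]
  calc _ = ∑' f : Fin (n + 1) → Mode, ∑ i, if f i = s ∧ lidx (List.ofFn f) =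
        γ + Finsupp.single s 1 then (1 : ℝ≥0∞) else 0 := by
        refine tsum_congr fun f => ?_
        by_cases h : lidx (List.ofFn f) = γ + Finsupp.single s 1
        · have h2 : γ s + 1 = ∑ i, if f i = s then 1 else 0 := by
            have := DFunLike.congr_fun h s
            rw [lidx_ofFn, Finsupp.finsetSum_apply] at this
            simp only [Finsupp.coe_add, Pi.add_apply, Finsupp.single_eq_same] at this
            rw [← this]
            exact Finset.sum_congr rfl fun i _ => by rw [Finsupp.single_apply]
          rw [h2]
          simp only [h, and_true, if_true]
          push_cast
          rw [mul_one]
        · simp only [h, and_false, if_false, Finset.sum_const_zero, mul_zero]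
    _ = ∑ i : Fin (n + 1), ∑' f : Fin (n + 1) → Mode, if f i = s ∧ lidx (List.ofFn f) =
        γ + Finsupp.single s 1 then (1 : ℝ≥0∞) else 0 :=
        Summable.tsum_finsetSum fun _ _ => ENNReal.summable
    _ = ∑ i : Fin (n + 1), ∑' f : Fin n → Mode, if lidx (List.ofFn f) = γ then (1 : ℝ≥0∞) else 0 := by
        refine Finset.sum_congr rfl fun i _ => ?_
        -- Removing the marked entry at place `i`.
        rw [← (Fin.insertNthEquiv (fun _ => Mode) i).tsum_eq, ENNReal.tsum_prod',
          tsum_eq_single s]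
        · refine tsum_congr fun f => ?_
          refine if_congr ?_ rfl rfl
          simp only [Fin.insertNthEquiv, Equiv.coe_fn_mk, Fin.insertNth_apply_same, true_and,
            lidx_ofFn, Fin.sum_univ_succAbove _ i, Fin.insertNth_apply_succAbove]
          rw [add_comm, add_left_inj]
        · intro t ht
          rw [ENNReal.tsum_eq_zero]
          intro f
          rw [if_neg]
          simp [ht]
    _ = _ := by simp

theorem ord_add_single_le (γ : MIdx) (s : Mode) :
    ord (γ + Finsupp.single s 1) ≤ ((γ.degree + 1 : ℕ) : ℝ≥0∞) * ord γ := by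
  rw [← ord_succ γ s]
  exact le_mul_of_one_le_left' (by exact_mod_cast Nat.le_add_left 1 _)

end DNLW
end


noncomputable section

namespace DNLW

/-! ### Absolutely convergent sums -/

section sums

variable {ι T B : Type*} {E : Type*} [NormedAddCommGroup E]

theorem summable_of_tsum_enorm [CompleteSpace E] {f : ι → E} (h : ∑' i, ‖f i‖ₑ ≠ ⊤) : Summable f := by
  refine Summable.of_nnnorm ?_
  exact ENNReal.tsum_coe_ne_top_iff_summable.1 h

theorem enorm_tsum_le (f : ι → E) : ‖∑' i, f i‖ₑ ≤ ∑' i, ‖f i‖ₑ := by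
  by_cases h : ∑' i, ‖f i‖ₑ = ⊤
  · rw [h]; exact le_top
  · have hs : Summable fun i => ‖f i‖₊ := ENNReal.tsum_coe_ne_top_iff_summable.1 h
    have := nnnorm_tsum_le hs
    calc ‖∑' i, f i‖ₑ = ((‖∑' i, f i‖₊ : NNReal) : ℝ≥0∞) := rfl
      _ ≤ ((∑' i, ‖f i‖₊ : NNReal) : ℝ≥0∞) := by exact_mod_cast this
      _ = _ := ENNReal.coe_tsum hs

theorem tsum_enorm_mul_ne_top {f h : ι → ℂ} {C : ℝ} (hh : ∀ i, ‖h i‖ ≤ C)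
    (hf : ∑' i, ‖f i‖ₑ ≠ ⊤) : ∑' i, ‖h i * f i‖ₑ ≠ ⊤ := by
  refine ne_top_of_le_ne_top (ENNReal.mul_ne_top (ENNReal.ofReal_ne_top (r := C)) hf) ?_
  rw [← ENNReal.tsum_mul_left]
  refine ENNReal.tsum_le_tsum fun i => ?_
  rw [enorm_mul]
  gcongr
  rw [← ofReal_norm]
  exact ENNReal.ofReal_le_ofReal (hh i)

theorem tsum_prod_of_enorm [CompleteSpace E] {f : ι × T → E} (h : ∑' x, ‖f x‖ₑ ≠ ⊤) :
    ∑' x, f x = ∑' i, ∑' t, f (i, t) := by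
  refine Summable.tsum_prod' (summable_of_tsum_enorm h) fun i => summable_of_tsum_enorm ?_
  rw [ENNReal.tsum_prod'] at h
  exact ENNReal.ne_top_of_tsum_ne_top h i

theorem tsum_comm_of_enorm [CompleteSpace E] {f : ι → T → E} (h : ∑' i, ∑' t, ‖f i t‖ₑ ≠ ⊤) :
    ∑' i, ∑' t, f i t = ∑' t, ∑' i, f i t := by
  have h' : ∑' x : ι × T, ‖(Function.uncurry f) x‖ₑ ≠ ⊤ := by rwa [ENNReal.tsum_prod']
  exact (summable_of_tsum_enorm h').tsum_comm.symm

open Classical in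
theorem tsum_fiber_of_enorm [CompleteSpace E] (π : T → B) (G : B → T → E)
    (h : ∑' q, ‖G (π q) q‖ₑ ≠ ⊤) :
    ∑' q, G (π q) q = ∑' b, ∑' q, if π q = b then G b q else 0 := by
  rw [tsum_comm_of_enorm]
  · refine tsum_congr fun q => ?_
    rw [tsum_eq_single (π q) fun b hb => if_neg fun h => hb h.symm, if_pos rfl]
  · rw [tsum_fiber π fun b q => ‖G b q‖ₑ] at h
    convert h using 6 with b q
    split_ifs <;> simp

theorem tsum_pi_succ {n : ℕ} (f : (Fin (n + 1) → T) → ℝ≥0∞) :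
    ∑' J, f J = ∑' s, ∑' J : Fin n → T, f (Matrix.vecCons s J) := by
  rw [← (Fin.consEquiv fun _ => T).tsum_eq, ENNReal.tsum_prod']
  rfl

theorem tsum_pi_succ_of_enorm [CompleteSpace E] {n : ℕ} {f : (Fin (n + 1) → T) → E}
    (h : ∑' J, ‖f J‖ₑ ≠ ⊤) :
    ∑' J, f J = ∑' s, ∑' J : Fin n → T, f (Matrix.vecCons s J) := by
  rw [← (Fin.consEquiv fun _ => T).tsum_eq] at h ⊢
  rw [tsum_prod_of_enorm h]
  rfl

theorem tsum_pi_prod {n : ℕ} (f : Fin n → T → ℝ≥0∞) :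
    ∑' J : Fin n → T, ∏ i, f i (J i) = ∏ i, ∑' t, f i t := by
  induction n with
  | zero => simp
  | succ n ih =>
    rw [tsum_pi_succ, Fin.prod_univ_succ, ← ih, ← ENNReal.tsum_mul_right]
    refine tsum_congr fun s => ?_
    rw [← ENNReal.tsum_mul_left]
    exact tsum_congr fun J => by simp [Fin.prod_univ_succ]

theorem tsum_pi_prod_ne_top {n : ℕ} {f : Fin n → T → ℂ} (h : ∀ i, ∑' t, ‖f i t‖ₑ ≠ ⊤) :
    ∑' J : Fin n → T, ‖∏ i, f i (J i)‖ₑ ≠ ⊤ := by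
  have e : ∀ J : Fin n → T, ‖∏ i, f i (J i)‖ₑ = ∏ i, ‖f i (J i)‖ₑ := fun J => by
    simp only [enorm_eq_nnnorm, nnnorm_prod, ENNReal.ofNNReal_finsetProd]
  simp_rw [e, tsum_pi_prod fun i t => ‖f i t‖ₑ]
  exact ENNReal.prod_ne_top fun i _ => h i

theorem tsum_pi_prod_complex {n : ℕ} {f : Fin n → T → ℂ} (h : ∀ i, ∑' t, ‖f i t‖ₑ ≠ ⊤) :
    ∑' J : Fin n → T, ∏ i, f i (J i) = ∏ i, ∑' t, f i t := by
  induction n with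
  | zero => simp
  | succ n ih =>
    rw [tsum_pi_succ_of_enorm (tsum_pi_prod_ne_top h), Fin.prod_univ_succ, ← ih fun i => h i.succ,
      ← tsum_mul_right]
    refine tsum_congr fun s => ?_
    rw [← tsum_mul_left]
    exact tsum_congr fun J => by simp [Fin.prod_univ_succ]

open Classical in
/-- Substitution of absolutely convergent series into a multilinear sum. -/
theorem tsum_comp_pi {n : ℕ} (π : T → B) (h : (Fin n → B) → ℂ) {C : ℝ} (hh : ∀ J, ‖h J‖ ≤ C)
    {f : Fin n → T → ℂ} (hf : ∀ i, ∑' t, ‖f i t‖ₑ ≠ ⊤) :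
    ∑' q : Fin n → T, h (fun i => π (q i)) * ∏ i, f i (q i) =
      ∑' J : Fin n → B, h J * ∏ i, ∑' t, if π t = J i then f i t else 0 := by
  have h1 := tsum_enorm_mul_ne_top (h := fun q : Fin n → T => h (fun i => π (q i)))
    (fun q => hh _) (tsum_pi_prod_ne_top hf)
  rw [tsum_fiber_of_enorm (fun (q : Fin n → T) i => π (q i)) (fun J q => h J * ∏ i, f i (q i)) h1]
  refine tsum_congr fun J => ?_
  rw [← tsum_pi_prod_complex, ← tsum_mul_left]
  · refine tsum_congr fun q => ?_
    by_cases hq : (fun i => π (q i)) = J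
    · rw [if_pos hq]
      congr 1
      refine Finset.prod_congr rfl fun i _ => ?_
      rw [if_pos (congrFun hq i)]
    · rw [if_neg hq]
      obtain ⟨i, hi⟩ := Function.ne_iff.1 hq
      rw [Finset.prod_eq_zero (Finset.mem_univ i) (if_neg hi), mul_zero]
  · intro i
    refine ne_top_of_le_ne_top (hf i) (ENNReal.tsum_le_tsum fun t => ?_)
    split_ifs <;> simp

end sums

/-! ### The phase space -/

section phase

variable {a p : ℝ}

instance : CompleteSpace (Ell a p) := by
  have hiso : Isometry (Ell.toLp a p) := AddMonoidHomClass.isometry_of_norm _ fun _ => rfl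
  have hsurj : Function.Surjective (Ell.toLp a p) := by
    intro y
    have hw : ∀ j, (Real.sqrt (weight a p j) : ℂ) ≠ 0 := fun j =>
      Complex.ofReal_ne_zero.2 (Real.sqrt_pos.2 (weight_pos a p j)).ne'
    have hy : rescale a p (fun j => (Real.sqrt (weight a p j) : ℂ)⁻¹ * y j) = y := by
      funext j
      simp only [rescale, LinearMap.coe_mk, AddHom.coe_mk]
      rw [mul_inv_cancel_left₀ (hw j)]
    refine ⟨⟨fun j => (Real.sqrt (weight a p j) : ℂ)⁻¹ * y j, ?_⟩, Subtype.ext hy⟩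
    change Summable _
    rw [← memlp_rescale_iff, hy]
    exact y.2
  have := (IsometryEquiv.mk (Equiv.ofBijective _ ⟨hiso.injective, hsurj⟩) hiso).completeSpace_iff
  exact this.2 inferInstance

theorem coord_add (v w : Phase a p) (s : Mode) : coord (v + w) s = coord v s + coord w s := by
  unfold coord
  split_ifs <;> rfl

theorem coord_smul (c : ℂ) (w : Phase a p) (s : Mode) : coord (c • w) s = c * coord w s := by
  unfold coord
  split_ifs <;> rfl

theorem coord_neg (w : Phase a p) (s : Mode) : coord (-w) s = -coord w s := by
  rw [← neg_one_smul ℂ, coord_smul, neg_one_mul]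

theorem coord_sub (v w : Phase a p) (s : Mode) : coord (v - w) s = coord v s - coord w s := by
  rw [sub_eq_add_neg, coord_add, coord_neg, sub_eq_add_neg]

/-- The coordinates as linear maps. -/
def coordLM (a p : ℝ) (s : Mode) : Phase a p →ₗ[ℂ] ℂ where
  toFun w := coord w s
  map_add' v w := coord_add v w s
  map_smul' c w := coord_smul c w s

open Classical in
/-- The point of the phase space with given coordinates, or zero if these are not those of a
point. -/
def ofCoord (a p : ℝ) (x : Mode → ℂ) : Phase a p :=
  if h : enorm2 a p (fun l => ‖x (l, 1)‖ₑ) < ⊤ ∧ enorm2 a p (fun l => ‖x (l, -1)‖ₑ) < ⊤ then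
    (Ell.mk _ h.1, Ell.mk _ h.2) else 0

theorem coord_ofCoord {x : Mode → ℂ} (h : ∀ σ : ℤˣ, enorm2 a p (fun l => ‖x (l, σ)‖ₑ) < ⊤)
    (s : Mode) : coord (ofCoord a p x) s = x s := by
  rw [ofCoord, dif_pos ⟨h 1, h (-1)⟩]
  obtain ⟨j, σ⟩ := s
  rcases Int.units_eq_one_or σ with rfl | rfl
  · rw [coord_one]; rfl
  · rw [coord_neg_one]; rfl

theorem enorm2_coord_one (w : Phase a p) : enorm2 a p (fun l => ‖coord w (l, 1)‖ₑ) = ‖w.1‖ₑ := by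
  simp only [coord_one]; exact enorm2_enorm w.1

theorem enorm2_coord_neg_one (w : Phase a p) :
    enorm2 a p (fun l => ‖coord w (l, -1)‖ₑ) = ‖w.2‖ₑ := by
  simp only [coord_neg_one]; exact enorm2_enorm w.2

theorem enorm_fst_add_snd_le (w : Phase a p) : ‖w.1‖ₑ + ‖w.2‖ₑ ≤ 2 * ‖w‖ₑ := by
  rw [two_mul]
  refine add_le_add ?_ ?_
  · simp only [← ofReal_norm]; exact ENNReal.ofReal_le_ofReal (norm_fst_le w)
  · simp only [← ofReal_norm]; exact ENNReal.ofReal_le_ofReal (norm_snd_le w)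

theorem tsum_enorm_coord_ne_top (ha : 0 < a) (hp : 1 / 2 < p) (w : Phase a p) :
    ∑' s, ‖coord w s‖ₑ ≠ ⊤ := by
  refine ne_top_of_le_ne_top ?_ (tsum_ecoord_le ha w)
  exact ENNReal.mul_ne_top (ENNReal.rpow_lt_top_of_nonneg (by norm_num) (japSum_lt_top hp).ne).ne
    (ENNReal.add_ne_top.2 ⟨enorm_ne_top, enorm_ne_top⟩)

end phase

/-! ### The cubic vector field -/

/-- The coefficient of the monomial `u_{J₀} u_{J₁} u_{J₂}` in the component `s` of the field. -/
def fieldCoeff (m : ℝ) (I : Finset ℤ) (s : Mode) (J : Fin 3 → Mode) : ℝ :=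
  4 * ((s.2 : ℤ) : ℝ) * symb m I (Matrix.vecCons (cj s) J)

theorem abs_fieldCoeff_le {m : ℝ} {I : Finset ℤ} {c : ℝ} (hc : ∀ J, |symb m I J| ≤ c) (s : Mode)
    (J : Fin 3 → Mode) : |fieldCoeff m I s J| ≤ 4 * c := by
  rw [fieldCoeff, abs_mul, abs_mul, abs_unit, abs_of_pos (by norm_num : (0 : ℝ) < 4), mul_one]
  exact mul_le_mul_of_nonneg_left (hc _) (by norm_num)

theorem fieldCoeff_eq_zero {m : ℝ} {I : Finset ℤ} {s : Mode} {J : Fin 3 → Mode}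
    (h : ∑ i, mo (J i) ≠ mo s) : fieldCoeff m I s J = 0 := by
  rw [fieldCoeff, symb_eq_zero, mul_zero]
  rw [Fin.sum_univ_succ]
  simp only [Matrix.cons_val_zero, Matrix.cons_val_succ, mo_cj]
  omega

section field

variable {a p : ℝ}

/-- The component `s` of the trilinear map of the field. -/
def triComp (m : ℝ) (I : Finset ℤ) (s : Mode) (M : Fin 3 → Phase a p) : ℂ :=
  ∑' J : Fin 3 → Mode, (fieldCoeff m I s J : ℂ) * ∏ i, coord (M i) (J i)

variable {m : ℝ} {I : Finset ℤ} {c : ℝ}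

theorem tsum_enorm_triComp (ha : 0 < a) (hp : 1 / 2 < p) (hc : ∀ J, |symb m I J| ≤ c) (s : Mode)
    (M : Fin 3 → Phase a p) :
    ∑' J : Fin 3 → Mode, ‖(fieldCoeff m I s J : ℂ) * ∏ i, coord (M i) (J i)‖ₑ ≠ ⊤ :=
  tsum_enorm_mul_ne_top (C := 4 * c) (fun J => by
      rw [Complex.norm_real]; exact abs_fieldCoeff_le hc s J)
    (tsum_pi_prod_ne_top (f := fun i => coord (M i)) fun i => tsum_enorm_coord_ne_top ha hp (M i))

theorem enorm_prod' {n : ℕ} (f : Fin n → ℂ) : ‖∏ i, f i‖ₑ = ∏ i, ‖f i‖ₑ := by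
  simp only [enorm_eq_nnnorm, nnnorm_prod, ENNReal.ofNNReal_finsetProd]

theorem enorm_triComp_le (hc : ∀ J, |symb m I J| ≤ c) (s : Mode) (M : Fin 3 → Phase a p) :
    ‖triComp m I s M‖ₑ ≤ ENNReal.ofReal (4 * c) * momSum (fun i => ecoord (M i)) (mo s) := by
  refine (enorm_tsum_le _).trans ?_
  rw [momSum, ← ENNReal.tsum_mul_left]
  refine ENNReal.tsum_le_tsum fun J => ?_
  split_ifs with h
  · rw [enorm_mul, enorm_prod']
    refine mul_le_mul' ?_ le_rfl
    rw [← ofReal_norm, Complex.norm_real]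
    exact ENNReal.ofReal_le_ofReal (abs_fieldCoeff_le hc s J)
  · rw [fieldCoeff_eq_zero h]; simp

/-- By momentum conservation the component `(l, σ)` is dominated by a `momSum` at `σ l`. The `8` is
`2³`: the folded norm adds `u` and `ū`, whereas the norm of the product space is their maximum. -/
theorem enorm2_triComp_le (ha : 0 < a) (hp : 1 / 2 < p) (hc : ∀ J, |symb m I J| ≤ c) (σ : ℤˣ)
    (M : Fin 3 → Phase a p) : enorm2 a p (fun l => ‖triComp m I (l, σ) M‖ₑ) ≤
      ENNReal.ofReal (4 * c) * (algConst p ^ 2 * (8 * ∏ i, ‖M i‖ₑ)) := by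
  have h1 : enorm2 a p (fun l => ‖triComp m I (l, σ) M‖ₑ) ≤
      ENNReal.ofReal (4 * c) * enorm2 a p (fun l => momSum (fun i => ecoord (M i)) l) := by
    rw [← enorm2_const_mul]
    rcases Int.units_eq_one_or σ with rfl | rfl
    · refine enorm2_mono fun l => (enorm_triComp_le hc _ M).trans (le_of_eq ?_)
      simp [mo]
    · rw [← enorm2_neg]
      refine enorm2_mono fun l => (enorm_triComp_le hc _ M).trans (le_of_eq ?_)
      simp [mo]
  refine h1.trans ?_
  gcongr
  refine (enorm2_momSum_le ha (by linarith) _).trans ?_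
  gcongr
  calc _ ≤ ∏ i, (2 * ‖M i‖ₑ) := Finset.prod_le_prod' fun i _ =>
        (enorm2_fold_ecoord (M i)).trans (enorm_fst_add_snd_le (M i))
    _ = _ := by
        rw [Finset.prod_mul_distrib]
        simp
        norm_num

theorem enorm2_triComp_lt_top (ha : 0 < a) (hp : 1 / 2 < p) (hc : ∀ J, |symb m I J| ≤ c) (σ : ℤˣ)
    (M : Fin 3 → Phase a p) : enorm2 a p (fun l => ‖triComp m I (l, σ) M‖ₑ) < ⊤ := by
  refine (enorm2_triComp_le ha hp hc σ M).trans_lt (ENNReal.mul_lt_top ENNReal.ofReal_lt_top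
    (ENNReal.mul_lt_top (ENNReal.pow_lt_top (algConst_lt_top hp)) (ENNReal.mul_lt_top (by simp) ?_)))
  exact (ENNReal.prod_ne_top fun i _ => enorm_ne_top).lt_top

/-- The monomials as multilinear maps. -/
def monomML (a p : ℝ) {n : ℕ} (J : Fin n → Mode) :
    MultilinearMap ℂ (fun _ : Fin n => Phase a p) ℂ :=
  (MultilinearMap.mkPiAlgebra ℂ (Fin n) ℂ).compLinearMap fun i => coordLM a p (J i)

theorem monomML_apply {n : ℕ} (J : Fin n → Mode) (M : Fin n → Phase a p) :
    monomML a p J M = ∏ i, coord (M i) (J i) := by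
  simp [monomML, coordLM]

theorem coord_ofCoord_triComp (ha : 0 < a) (hp : 1 / 2 < p) (hc : ∀ J, |symb m I J| ≤ c)
    (M : Fin 3 → Phase a p) (s : Mode) :
    coord (ofCoord a p fun s => triComp m I s M) s = triComp m I s M :=
  coord_ofCoord (x := fun s => triComp m I s M)
    (fun σ => enorm2_triComp_lt_top ha hp hc σ M) s

/-- The trilinear map of the field. -/
def triML (m : ℝ) (I : Finset ℤ) (ha : 0 < a) (hp : 1 / 2 < p) (hc : ∀ J, |symb m I J| ≤ c) :
    MultilinearMap ℂ (fun _ : Fin 3 => Phase a p) (Phase a p) where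
  toFun M := ofCoord a p fun s => triComp m I s M
  map_update_add' {_} M i x y := by
    refine Phase.ext fun s => ?_
    rw [coord_add, coord_ofCoord_triComp ha hp hc, coord_ofCoord_triComp ha hp hc,
      coord_ofCoord_triComp ha hp hc]
    unfold triComp
    rw [← Summable.tsum_add (summable_of_tsum_enorm (tsum_enorm_triComp ha hp hc _ _))
      (summable_of_tsum_enorm (tsum_enorm_triComp ha hp hc _ _))]
    refine tsum_congr fun J => ?_
    simp only [← monomML_apply]
    rw [← mul_add]
    congr 1
    convert (monomML a p J).map_update_add M i x y
  map_update_smul' {_} M i r x := by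
    refine Phase.ext fun s => ?_
    rw [coord_smul, coord_ofCoord_triComp ha hp hc, coord_ofCoord_triComp ha hp hc]
    unfold triComp
    rw [← tsum_mul_left]
    refine tsum_congr fun J => ?_
    simp only [← monomML_apply]
    rw [mul_left_comm]
    congr 1
    convert (monomML a p J).map_update_smul M i r x
    rfl

/-- The norm of the trilinear map. -/
def triNorm (p c : ℝ) : ℝ := 32 * c * (algConst p).toReal ^ 2

theorem norm_triML_le (ha : 0 < a) (hp : 1 / 2 < p) (hc : ∀ J, |symb m I J| ≤ c)
    (M : Fin 3 → Phase a p) : ‖triML m I ha hp hc M‖ ≤ triNorm p c * ∏ i, ‖M i‖ := by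
  have hc0 : 0 ≤ c := (abs_nonneg _).trans (hc fun _ => (0, 1))
  have h := coord_ofCoord_triComp ha hp hc M
  have key : ∀ z : Ell a p, ∀ σ : ℤˣ, (∀ l, z l = triComp m I (l, σ) M) →
      ‖z‖ ≤ triNorm p c * ∏ i, ‖M i‖ := by
    intro z σ hz
    have h1 := enorm2_triComp_le ha hp hc σ M
    simp only [← hz] at h1
    rw [enorm2_enorm] at h1
    have h2 := ENNReal.toReal_mono ?_ h1
    · simp only [ENNReal.toReal_mul, ENNReal.toReal_pow, ENNReal.toReal_prod, toReal_enorm,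
        ENNReal.toReal_ofReal (by positivity : 0 ≤ 4 * c)] at h2
      refine h2.trans (le_of_eq ?_)
      simp [triNorm]
      ring
    · exact (ENNReal.mul_lt_top ENNReal.ofReal_lt_top
        (ENNReal.mul_lt_top (ENNReal.pow_lt_top (algConst_lt_top hp)) (ENNReal.mul_lt_top (by simp)
          (ENNReal.prod_ne_top fun i _ => enorm_ne_top).lt_top))).ne
  refine max_le (key _ 1 fun l => ?_) (key _ (-1) fun l => ?_)
  · rw [← coord_one]; exact h (l, 1)
  · rw [← coord_neg_one]; exact h (l, -1)

/-- The continuous trilinear map of the field. -/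
def triCLM (m : ℝ) (I : Finset ℤ) (ha : 0 < a) (hp : 1 / 2 < p) (hc : ∀ J, |symb m I J| ≤ c) :
    ContinuousMultilinearMap ℂ (fun _ : Fin 3 => Phase a p) (Phase a p) :=
  (triML m I ha hp hc).mkContinuous (triNorm p c) (norm_triML_le ha hp hc)

theorem coord_triCLM (ha : 0 < a) (hp : 1 / 2 < p) (hc : ∀ J, |symb m I J| ≤ c)
    (M : Fin 3 → Phase a p) (s : Mode) : coord (triCLM m I ha hp hc M) s = triComp m I s M :=
  coord_ofCoord_triComp ha hp hc M s

end field

end DNLW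
end


noncomputable section

namespace DNLW

/-! ### The implicit midpoint map of a cubic vector field -/

section midpoint

variable {E : Type*} [NormedAddCommGroup E] [NormedSpace ℂ E]
  (T : ContinuousMultilinearMap ℂ (fun _ : Fin 3 => E) E)

/-- The cubic vector field of a trilinear map. -/
def cubic (z : E) : E := T fun _ => z

theorem analyticAt_cubic (z : E) : AnalyticAt ℂ (cubic T) z := by
  have h1 : AnalyticAt ℂ T (fun _ => z) := T.analyticAt
  have h2 : AnalyticAt ℂ (fun z : E => (fun _ : Fin 3 => z)) z := by
    refine AnalyticAt.pi fun i => analyticAt_id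
  exact h1.comp_of_eq h2 rfl

/-- The derivative of the cubic field. -/
theorem fderiv_cubic (z v : E) :
    fderiv ℂ (cubic T) z v = ∑ i, T (Function.update (fun _ => z) i v) := by
  have h1 := T.hasFDerivAt (fun _ => z)
  have h2 : HasFDerivAt (fun z : E => (fun _ : Fin 3 => z))
      (ContinuousLinearMap.pi fun _ => ContinuousLinearMap.id ℂ E) z :=
    (ContinuousLinearMap.pi fun _ : Fin 3 => ContinuousLinearMap.id ℂ E).hasFDerivAt
  have h3 : HasFDerivAt (cubic T) _ z := HasFDerivAt.comp z h1 h2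
  rw [h3.fderiv]
  simp [ContinuousMultilinearMap.linearDeriv_apply]

variable {T}

theorem norm_cubic_sub_le {ρ : ℝ} {x y : E} (hx : ‖x‖ ≤ ρ) (hy : ‖y‖ ≤ ρ) :
    ‖cubic T x - cubic T y‖ ≤ 3 * ‖T‖ * ρ ^ 2 * ‖x - y‖ := by
  have h := T.norm_image_sub_le (fun _ => x) (fun _ => y)
  have e1 : ∀ z : E, ‖fun _ : Fin 3 => z‖ = ‖z‖ := fun z => pi_norm_const z
  have e2 : (fun _ : Fin 3 => x) - (fun _ => y) = fun _ => x - y := rfl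
  rw [e2, e1, e1, e1, Fintype.card_fin] at h
  refine h.trans ?_
  have : max ‖x‖ ‖y‖ ^ (3 - 1) ≤ ρ ^ 2 := by
    have := max_le hx hy
    have h0 : 0 ≤ max ‖x‖ ‖y‖ := le_max_of_le_left (norm_nonneg x)
    exact pow_le_pow_left₀ h0 this 2
  calc _ = 3 * ‖T‖ * max ‖x‖ ‖y‖ ^ (3 - 1) * ‖x - y‖ := by push_cast; ring
    _ ≤ _ := by gcongr

theorem cubic_zero : cubic T 0 = 0 := T.map_coord_zero 0 rfl

variable (T)

/-- The maps `z ↦ z ± X(z) / 2`. -/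
def halfStep (σ : ℤˣ) (z : E) : E := z + (((σ : ℤ) : ℂ) / 2) • cubic T z

variable {T}

theorem norm_half_unit (σ : ℤˣ) : ‖(((σ : ℤ) : ℂ) / 2)‖ = 1 / 2 := by
  rcases Int.units_eq_one_or σ with h | h <;> simp [h]

/-- The origin of the condition `9 ‖T‖ ρ² ≤ 2`: on the ball of radius `ρ` the field has Lipschitz
constant `3 ‖T‖ ρ²`, so half of it has constant at most `1/3`. -/
theorem halfStep_sub {ρ : ℝ} (h : 9 * ‖T‖ * ρ ^ 2 ≤ 2) (σ : ℤˣ) {x y : E} (hx : ‖x‖ ≤ ρ)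
    (hy : ‖y‖ ≤ ρ) : ‖halfStep T σ x - halfStep T σ y - (x - y)‖ ≤ 1 / 3 * ‖x - y‖ := by
  have e : halfStep T σ x - halfStep T σ y - (x - y) =
      (((σ : ℤ) : ℂ) / 2) • (cubic T x - cubic T y) := by
    unfold halfStep
    rw [smul_sub]
    abel
  rw [e, norm_smul, norm_half_unit]
  have := norm_cubic_sub_le (T := T) hx hy
  nlinarith [norm_nonneg (x - y)]

theorem approximatesLinearOn_halfStep {ρ : ℝ} (h : 9 * ‖T‖ * ρ ^ 2 ≤ 2) (σ : ℤˣ) :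
    ApproximatesLinearOn (halfStep T σ) ((ContinuousLinearEquiv.refl ℂ E : E ≃L[ℂ] E) : E →L[ℂ] E)
      (Metric.ball 0 ρ) (1 / 3) := fun x hx y hy => by
  have := halfStep_sub h σ (mem_ball_zero_iff.1 hx).le (mem_ball_zero_iff.1 hy).le
  simpa using this

theorem halfStep_const : Subsingleton E ∨ (1 / 3 : NNReal) <
    ‖((ContinuousLinearEquiv.refl ℂ E).symm : E →L[ℂ] E)‖₊⁻¹ := by
  rcases subsingleton_or_nontrivial E with h | h
  · exact Or.inl h
  · right
    have : ‖((ContinuousLinearEquiv.refl ℂ E).symm : E →L[ℂ] E)‖₊ = 1 := by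
      rw [← NNReal.coe_inj]
      exact ContinuousLinearMap.norm_id
    rw [this, inv_one]
    rw [← NNReal.coe_lt_coe]
    norm_num

theorem halfStep_injOn {ρ : ℝ} (h : 9 * ‖T‖ * ρ ^ 2 ≤ 2) (σ : ℤˣ) {x y : E} (hx : ‖x‖ ≤ ρ)
    (hy : ‖y‖ ≤ ρ) (he : halfStep T σ x = halfStep T σ y) : x = y := by
  have := halfStep_sub h σ hx hy
  rw [he, sub_self, zero_sub, norm_neg] at this
  have h0 := norm_nonneg (x - y)
  exact sub_eq_zero.1 (norm_le_zero_iff.1 (by linarith))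

theorem analyticAt_halfStep (σ : ℤˣ) (z : E) : AnalyticAt ℂ (halfStep T σ) z :=
  analyticAt_id.add ((analyticAt_cubic T z).const_smul (c := (((σ : ℤ) : ℂ) / 2)))

theorem fderiv_halfStep (σ : ℤˣ) (z v : E) :
    fderiv ℂ (halfStep T σ) z v = v + (((σ : ℤ) : ℂ) / 2) • fderiv ℂ (cubic T) z v := by
  have h1 : HasFDerivAt (cubic T) (fderiv ℂ (cubic T) z) z :=
    (analyticAt_cubic T z).differentiableAt.hasFDerivAt
  have h2 : HasFDerivAt (halfStep T σ) _ z :=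
    (hasFDerivAt_id z).add (h1.const_smul (((σ : ℤ) : ℂ) / 2))
  rw [h2.fderiv]
  rfl

variable [CompleteSpace E]

/-- `z ↦ z ± X(z) / 2` as a local diffeomorphism. -/
def halfHomeo {ρ : ℝ} (h : 9 * ‖T‖ * ρ ^ 2 ≤ 2) (σ : ℤˣ) : OpenPartialHomeomorph E E :=
  (approximatesLinearOn_halfStep h σ).toOpenPartialHomeomorph _ _ halfStep_const Metric.isOpen_ball

theorem halfHomeo_source {ρ : ℝ} (h : 9 * ‖T‖ * ρ ^ 2 ≤ 2) (σ : ℤˣ) :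
    (halfHomeo h σ).source = Metric.ball 0 ρ := rfl

/-- The derivative is within `1/3` of the identity, so it is inverted by a Neumann series. -/
theorem exists_fderiv_halfStep_equiv {ρ : ℝ} (h : 9 * ‖T‖ * ρ ^ 2 ≤ 2) (σ : ℤˣ) {z : E}
    (hz : z ∈ Metric.ball (0 : E) ρ) : ∃ i : E ≃L[ℂ] E, fderiv ℂ (halfStep T σ) z = i := by
  have h0 : HasFDerivAt (halfStep T σ) (fderiv ℂ (halfStep T σ) z) z :=
    (analyticAt_halfStep σ z).differentiableAt.hasFDerivAt
  have h1 := (hasFDerivAt_id z).sub h0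
  have hle : ‖ContinuousLinearMap.id ℂ E - fderiv ℂ (halfStep T σ) z‖ ≤ 1 / 3 := by
    refine h1.le_of_lip' (by norm_num) ?_
    filter_upwards [Metric.isOpen_ball.mem_nhds hz] with x hx
    have := halfStep_sub h σ (mem_ball_zero_iff.1 hx).le (mem_ball_zero_iff.1 hz).le
    rw [← norm_neg]
    change ‖-((x - halfStep T σ x) - (z - halfStep T σ z))‖ ≤ _
    convert this using 2
    abel
  set u := Units.oneSub (ContinuousLinearMap.id ℂ E - fderiv ℂ (halfStep T σ) z)
    (hle.trans_lt (by norm_num)) with hu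
  refine ⟨ContinuousLinearEquiv.unitsEquiv ℂ E u, ?_⟩
  ext v
  simp [hu]

theorem analyticAt_halfHomeo_symm {ρ : ℝ} (h : 9 * ‖T‖ * ρ ^ 2 ≤ 2) (σ : ℤˣ) {y : E}
    (hy : y ∈ (halfHomeo h σ).target) : AnalyticAt ℂ (halfHomeo h σ).symm y := by
  obtain ⟨i, hi⟩ := exists_fderiv_halfStep_equiv h σ ((halfHomeo h σ).map_target hy)
  exact (halfHomeo h σ).analyticAt_symm hy (analyticAt_halfStep σ _) hi

/-- The closed ball of radius `ρ/2` has an image covering the one of radius `(1 - 1/3) ρ/2 = ρ/3`.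
The trivial space is treated apart, since there the identity does not have norm one. -/
theorem ball_subset_halfHomeo_target {ρ : ℝ} (hρ : 0 < ρ) (h : 9 * ‖T‖ * ρ ^ 2 ≤ 2) (σ : ℤˣ) :
    Metric.ball 0 (ρ / 3) ⊆ (halfHomeo h σ).target := by
  rcases subsingleton_or_nontrivial E with hE | hE
  · intro y _
    have : halfStep T σ 0 ∈ (halfHomeo h σ).target := (halfHomeo h σ).map_source (by
      rw [halfHomeo_source]; exact Metric.mem_ball_self hρ)
    rwa [Subsingleton.elim (halfStep T σ 0) y] at this
  have h1 := (approximatesLinearOn_halfStep h σ).closedBall_subset_target halfStep_const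
    Metric.isOpen_ball (b := 0) (ε := ρ / 2) (by positivity)
    (Metric.closedBall_subset_ball (by linarith))
  have h2 : halfStep T σ 0 = 0 := by simp [halfStep, cubic_zero]
  have h3 : ‖((ContinuousLinearEquiv.refl ℂ E).symm : E →L[ℂ] E)‖₊ = 1 := by
    rw [← NNReal.coe_inj]
    exact ContinuousLinearMap.norm_id
  rw [h2, h3] at h1
  refine (Metric.ball_subset_closedBall.trans ?_).trans h1
  refine Metric.closedBall_subset_closedBall (le_of_eq ?_)
  push_cast
  ring

/-- The implicit midpoint map `Γ` of a cubic vector field `X`: if `w = z - X(z) / 2`, then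
`Γ(w) = z + X(z) / 2`. -/
theorem exists_midpoint {ρ : ℝ} (hρ : 0 < ρ) (h : 9 * ‖T‖ * ρ ^ 2 ≤ 2) {R : ℝ}
    (hR : R / 2 ≤ ρ / 3) :
    ∃ (Γ : OpenPartialHomeomorph E E) (Z : E → E), Γ.source = Metric.ball 0 (R / 2) ∧
      Γ.target ⊆ Metric.ball 0 R ∧ AnalyticOnNhd ℂ Γ Γ.source ∧
      AnalyticOnNhd ℂ Γ.symm Γ.target ∧
      (∀ w ∈ Γ.source, ‖Z w‖ < ρ ∧ halfStep T (-1) (Z w) = w ∧ halfStep T 1 (Z w) = Γ w) ∧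
      ∀ w ∈ Γ.source, ∀ v, ∃ v₀, v = v₀ - (1 / 2 : ℂ) • fderiv ℂ (cubic T) (Z w) v₀ ∧
        fderiv ℂ Γ w v = v₀ + (1 / 2 : ℂ) • fderiv ℂ (cubic T) (Z w) v₀ := by
  set em := halfHomeo h (-1)
  set ep := halfHomeo h 1
  set Γ := (em.symm.trans ep).restrOpen (Metric.ball 0 (R / 2)) Metric.isOpen_ball
  have hcoe : ∀ w, Γ w = halfStep T 1 (em.symm w) := fun w => rfl
  have hsub : Metric.ball 0 (R / 2) ⊆ em.target :=
    (Metric.ball_subset_ball hR).trans (ball_subset_halfHomeo_target hρ h (-1))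
  have hsrc : Γ.source = Metric.ball 0 (R / 2) := by
    change (em.symm.trans ep).source ∩ Metric.ball 0 (R / 2) = _
    rw [Set.inter_eq_right]
    intro w hw
    rw [OpenPartialHomeomorph.trans_source]
    exact ⟨hsub hw, em.map_target (hsub hw)⟩
  have hZ : ∀ w ∈ Γ.source, ‖em.symm w‖ < ρ ∧ halfStep T (-1) (em.symm w) = w := by
    intro w hw
    rw [hsrc] at hw
    exact ⟨mem_ball_zero_iff.1 (em.map_target (hsub hw)), em.right_inv (hsub hw)⟩
  refine ⟨Γ, em.symm, hsrc, ?_, ?_, ?_, fun w hw => ⟨(hZ w hw).1, (hZ w hw).2, rfl⟩, ?_⟩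
  -- The constant `1/3` gives `‖z‖ ≤ (3/2) ‖w‖` and `‖Γ w‖ ≤ (4/3) ‖z‖`, together exactly `‖Γ w‖ ≤ 2
  -- ‖w‖ < R`.
  · intro y hy
    obtain ⟨w, hw, rfl⟩ : ∃ w ∈ Γ.source, Γ w = y := ⟨Γ.symm y, Γ.map_target hy, Γ.right_inv hy⟩
    obtain ⟨h1, h2⟩ := hZ w hw
    have hw' : ‖w‖ < R / 2 := by rw [hsrc] at hw; exact mem_ball_zero_iff.1 hw
    have h0 : ∀ σ, halfStep T σ 0 = 0 := fun σ => by simp [halfStep, cubic_zero]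
    have h3 := halfStep_sub h (-1) h1.le (y := 0) (by simpa using hρ.le)
    have h4 := halfStep_sub h 1 h1.le (y := 0) (by simpa using hρ.le)
    simp only [h0, sub_zero] at h3 h4
    rw [h2] at h3
    rw [mem_ball_zero_iff, hcoe]
    have h5 := norm_sub_norm_le (em.symm w) w
    rw [norm_sub_rev] at h5
    have h6 := norm_sub_norm_le (halfStep T 1 (em.symm w)) (em.symm w)
    linarith
  · intro w hw
    rw [hsrc] at hw
    exact (analyticAt_halfStep 1 _).comp (analyticAt_halfHomeo_symm h (-1) (hsub hw))
  · intro y hy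
    have h1 : y ∈ (em.symm.trans ep).target := by
      have := Γ.map_target hy
      have h2 : Γ.symm y ∈ (em.symm.trans ep).source := this.1
      have h3 := (em.symm.trans ep).map_source h2
      have h4 : (em.symm.trans ep) (Γ.symm y) = y := Γ.right_inv hy
      rwa [h4] at h3
    rw [OpenPartialHomeomorph.trans_target] at h1
    exact (analyticAt_halfStep (-1) _).comp (analyticAt_halfHomeo_symm h 1 h1.1)
  · intro w hw v
    have hw' := hw
    rw [hsrc] at hw'
    have hd : HasFDerivAt em.symm (fderiv ℂ em.symm w) w :=
      (analyticAt_halfHomeo_symm h (-1) (hsub hw')).differentiableAt.hasFDerivAt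
    have hs : ∀ σ, HasFDerivAt (halfStep T σ) (fderiv ℂ (halfStep T σ) (em.symm w)) (em.symm w) :=
      fun σ => (analyticAt_halfStep σ _).differentiableAt.hasFDerivAt
    have h1 := (hs (-1)).comp w hd
    have h2 := (hs 1).comp w hd
    have h3 : HasFDerivAt (halfStep T (-1) ∘ em.symm) (ContinuousLinearMap.id ℂ E) w := by
      refine (hasFDerivAt_id w).congr_of_eventuallyEq ?_
      filter_upwards [Metric.isOpen_ball.mem_nhds hw'] with x hx
      exact em.right_inv (hsub hx)
    -- The vector `v₀` is the variation of the midpoint `z` when `w` varies by `v`.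
    refine ⟨fderiv ℂ em.symm w v, ?_, ?_⟩
    · have := DFunLike.congr_fun (h3.unique h1) v
      rw [ContinuousLinearMap.comp_apply, fderiv_halfStep] at this
      refine Eq.trans this ?_
      simp [neg_div, sub_eq_add_neg]
    · have : fderiv ℂ Γ w = _ := h2.fderiv
      rw [this, ContinuousLinearMap.comp_apply, fderiv_halfStep]
      simp

end midpoint

end DNLW
end


noncomputable section

namespace DNLW

/-! ### Quartic forms -/

section quartic

variable {a p : ℝ}

/-- The polarized quartic form with coefficients `h`. -/
def quartForm (h : (Fin 4 → Mode) → ℂ) (M : Fin 4 → Phase a p) : ℂ :=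
  ∑' J : Fin 4 → Mode, h J * ∏ i, coord (M i) (J i)

theorem tsum_enorm_quartForm (ha : 0 < a) (hp : 1 / 2 < p) {h : (Fin 4 → Mode) → ℂ} {C : ℝ}
    (hh : ∀ J, ‖h J‖ ≤ C) (M : Fin 4 → Phase a p) :
    ∑' J : Fin 4 → Mode, ‖h J * ∏ i, coord (M i) (J i)‖ₑ ≠ ⊤ :=
  tsum_enorm_mul_ne_top hh
    (tsum_pi_prod_ne_top (f := fun i => coord (M i)) fun i => tsum_enorm_coord_ne_top ha hp (M i))

/-- Permutation of the factors. -/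
def permFun (T : Type*) {n : ℕ} (τ : Equiv.Perm (Fin n)) : (Fin n → T) ≃ (Fin n → T) :=
  Equiv.arrowCongr τ.symm (Equiv.refl T)

theorem permFun_apply {T : Type*} {n : ℕ} (τ : Equiv.Perm (Fin n)) (J : Fin n → T) :
    permFun T τ J = J ∘ τ := rfl

theorem quartForm_perm {h : (Fin 4 → Mode) → ℂ} (hh : ∀ (τ : Equiv.Perm (Fin 4)) J, h (J ∘ τ) = h J)
    (τ : Equiv.Perm (Fin 4)) (M : Fin 4 → Phase a p) : quartForm h (M ∘ τ) = quartForm h M := by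
  unfold quartForm
  rw [← (permFun Mode τ).tsum_eq]
  refine tsum_congr fun J => ?_
  rw [permFun_apply, hh]
  congr 1
  exact Equiv.prod_comp τ fun i => coord (M i) (J i)

/-- Conjugation of modes as an equivalence. -/
def cjEquiv : Mode ≃ Mode := ⟨cj, cj, cj_cj, cj_cj⟩

theorem tsum_mode_of_enorm {F : Mode → ℂ} (h : ∑' s, ‖F s‖ₑ ≠ ⊤) :
    ∑' s, F s = ∑' j, (F (j, 1) + F (j, -1)) := by
  rw [tsum_prod_of_enorm h]
  refine tsum_congr fun j => ?_
  rw [tsum_fintype]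
  simp

theorem tsum_mul_cj_ne_top (ha : 0 < a) (hp : 1 / 2 < p) (v w : Phase a p) :
    ∑' s, ‖coord v s * coord w (cj s)‖ₑ ≠ ⊤ := by
  refine ne_top_of_le_ne_top (ENNReal.mul_ne_top (tsum_enorm_coord_ne_top ha hp v)
    (tsum_enorm_coord_ne_top ha hp w)) ?_
  rw [← ENNReal.tsum_mul_right]
  refine ENNReal.tsum_le_tsum fun s => ?_
  rw [enorm_mul]
  gcongr
  exact ENNReal.le_tsum (cj s)

/-! ### The symplectic form -/

theorem symplecticForm_eq (ha : 0 < a) (hp : 1 / 2 < p) (v w : Phase a p) : symplecticForm v w =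
    Complex.I * ∑' s : Mode, ((s.2 : ℤ) : ℂ) * (coord v s * coord w (cj s)) := by
  rw [symplecticForm, tsum_mode_of_enorm]
  · congr 1
    refine tsum_congr fun j => ?_
    simp only [cj, neg_neg, coord_one, coord_neg_one, Units.val_one, Units.val_neg, Int.cast_one,
      Int.cast_neg]
    ring
  · refine tsum_enorm_mul_ne_top (C := 1) (fun s => ?_) (tsum_mul_cj_ne_top ha hp v w)
    rcases Int.units_eq_one_or s.2 with h | h <;> simp [h]

theorem summable_symplectic (ha : 0 < a) (hp : 1 / 2 < p) (v w : Phase a p) :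
    Summable fun s : Mode => ((s.2 : ℤ) : ℂ) * (coord v s * coord w (cj s)) := by
  refine summable_of_tsum_enorm (tsum_enorm_mul_ne_top (C := 1) (fun s => ?_)
    (tsum_mul_cj_ne_top ha hp v w))
  rcases Int.units_eq_one_or s.2 with h | h <;> simp [h]

theorem symplecticForm_swap (v w : Phase a p) : symplecticForm v w = -symplecticForm w v := by
  unfold symplecticForm
  rw [← mul_neg, ← tsum_neg]
  congr 1
  exact tsum_congr fun j => by ring

theorem symplecticForm_add_left (ha : 0 < a) (hp : 1 / 2 < p) (v v' w : Phase a p) :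
    symplecticForm (v + v') w = symplecticForm v w + symplecticForm v' w := by
  simp only [symplecticForm_eq ha hp]
  rw [← mul_add, ← Summable.tsum_add (summable_symplectic ha hp v w)
    (summable_symplectic ha hp v' w)]
  congr 1
  exact tsum_congr fun s => by rw [coord_add]; ring

theorem symplecticForm_smul_left (ha : 0 < a) (hp : 1 / 2 < p) (c : ℂ) (v w : Phase a p) :
    symplecticForm (c • v) w = c * symplecticForm v w := by
  simp only [symplecticForm_eq ha hp]
  rw [mul_left_comm c]
  congr 1
  rw [← tsum_mul_left]
  exact tsum_congr fun s => by rw [coord_smul]; ring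

/-- The Cayley transform of a symplectically skew map is symplectic. -/
theorem symplecticForm_cayley (ha : 0 < a) (hp : 1 / 2 < p) {S : Phase a p → Phase a p}
    (hS : ∀ v w, symplecticForm (S v) w = symplecticForm (S w) v) (c : ℂ) (v w : Phase a p) :
    symplecticForm (v + c • S v) (w + c • S w) = symplecticForm (v - c • S v) (w - c • S w) := by
  -- Skewness cancels the terms linear in `d`, so the value is even in `d`.
  have key : ∀ d : ℂ, symplecticForm (v + d • S v) (w + d • S w) =
      symplecticForm v w + d ^ 2 * symplecticForm (S v) (S w) := by
    intro d
    rw [symplecticForm_add_left ha hp, symplecticForm_smul_left ha hp, symplecticForm_swap v,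
      symplecticForm_add_left ha hp, symplecticForm_smul_left ha hp, symplecticForm_swap (S v),
      symplecticForm_add_left ha hp, symplecticForm_smul_left ha hp, symplecticForm_swap w v,
      symplecticForm_swap w (S v), hS v w, symplecticForm_swap (S w) (S v)]
    ring
  have h2 := key (-c)
  simp only [neg_smul, ← sub_eq_add_neg] at h2
  rw [key c, h2]
  ring

variable {m : ℝ} {I : Finset ℤ} {c : ℝ}

/-- Contracting the field with the symplectic form gives a multiple of the polarized quartic form:
the field is Hamiltonian, with Hamiltonian `i ∑ symb(J) u_J`. The symmetry of that form is what
makes the derivative of the field skew. -/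
theorem symplecticForm_triCLM (ha : 0 < a) (hp : 1 / 2 < p) (hc : ∀ J, |symb m I J| ≤ c)
    (M : Fin 3 → Phase a p) (w : Phase a p) : symplecticForm (triCLM m I ha hp hc M) w =
      4 * Complex.I * quartForm (fun J => (symb m I J : ℂ)) (Matrix.vecCons w M) := by
  rw [symplecticForm_eq ha hp, quartForm, tsum_pi_succ_of_enorm (tsum_enorm_quartForm ha hp
    (fun J => by rw [Complex.norm_real]; exact hc J) _), mul_comm 4, mul_assoc]
  congr 1
  rw [← tsum_mul_left, ← cjEquiv.tsum_eq]
  refine tsum_congr fun s => ?_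
  rw [coord_triCLM, triComp, ← tsum_mul_right, ← tsum_mul_left, ← tsum_mul_left]
  refine tsum_congr fun J => ?_
  simp only [fieldCoeff, cjEquiv, Equiv.coe_fn_mk, cj_cj, Fin.prod_univ_succ (n := 3),
    Matrix.cons_val_zero, Matrix.cons_val_succ]
  have : ((((cj s).2 : ℤ) : ℂ)) * (((cj s).2 : ℤ) : ℂ) = 1 := by
    rcases Int.units_eq_one_or (cj s).2 with h | h <;> simp [h]
  push_cast
  linear_combination (4 * (symb m I (Matrix.vecCons s J) : ℂ) * (∏ i, coord (M i) (J i)) * coord w s) * this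

/-- The derivative puts `v` in one of the three slots. After contraction with `w`, the quartic form
has arguments `w`, `v`, `z`, `z`, and a transposition exchanges the first two. -/
theorem symplecticForm_fderiv_cubic (ha : 0 < a) (hp : 1 / 2 < p) (hc : ∀ J, |symb m I J| ≤ c)
    (z v w : Phase a p) :
    symplecticForm (fderiv ℂ (cubic (triCLM m I ha hp hc)) z v) w =
      symplecticForm (fderiv ℂ (cubic (triCLM m I ha hp hc)) z w) v := by
  have hsum : ∀ (f : Fin 3 → Phase a p) (y : Phase a p),
      symplecticForm (∑ i, f i) y = ∑ i, symplecticForm (f i) y := fun f y => by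
    simp only [Fin.sum_univ_three, symplecticForm_add_left ha hp]
  rw [fderiv_cubic, fderiv_cubic, hsum, hsum]
  refine Finset.sum_congr rfl fun i _ => ?_
  rw [symplecticForm_triCLM, symplecticForm_triCLM]
  congr 1
  rw [← quartForm_perm (fun τ J => by rw [symb_perm]) (Equiv.swap 0 i.succ)]
  congr 1
  funext k
  simp only [Function.comp]
  refine Fin.cases ?_ (fun j => ?_) k
  · rw [Equiv.swap_apply_left]
    simp
  · by_cases hj : j = i
    · subst hj
      rw [Equiv.swap_apply_right]
      simp
    · rw [Equiv.swap_apply_of_ne_of_ne (Fin.succ_ne_zero j)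
        fun h => hj (Fin.succ_injective _ h)]
      simp [Function.update_of_ne hj]

/-! ### The quadratic Hamiltonian -/

/-- The frequency is absorbed by one weight, and the inner product of the weighted space by
Cauchy–Schwarz. -/
theorem tsum_freq_ne_top {m : ℝ} (hm : 0 < m) (ha : 0 < a) (hp : 0 < p) {f g : ℤ → ℝ≥0∞}
    (hf : enorm2 a p f ≠ ⊤) (hg : enorm2 a p g ≠ ⊤) :
    ∑' j, ‖freq m j‖ₑ * (f j * g j) ≠ ⊤ := by
  refine ne_top_of_le_ne_top (ENNReal.mul_ne_top
    (ENNReal.ofReal_ne_top (r := 1 / (2 * a) + Real.sqrt m)) (ENNReal.mul_ne_top hf hg)) ?_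
  refine le_trans ?_ (mul_le_mul' le_rfl (enorm2_inner f g))
  rw [← ENNReal.tsum_mul_left]
  refine ENNReal.tsum_le_tsum fun j => ?_
  have h : ‖freq m j‖ₑ ≤ ENNReal.ofReal (1 / (2 * a) + Real.sqrt m) * eweight a p j := by
    rw [Real.enorm_eq_ofReal (freq_nonneg m j), eweight, ← ENNReal.ofReal_mul (by positivity)]
    exact ENNReal.ofReal_le_ofReal (freq_le_weight hm ha hp j)
  calc _ ≤ ENNReal.ofReal (1 / (2 * a) + Real.sqrt m) * eweight a p j * (f j * g j) := by gcongr
    _ = _ := by ring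

theorem summable_quadHam {m : ℝ} (hm : 0 < m) (ha : 0 < a) (hp : 0 < p) (x y : Ell a p) :
    Summable fun j => (freq m j : ℂ) * x j * y j := by
  refine summable_of_tsum_enorm ?_
  have := tsum_freq_ne_top hm ha hp (f := fun j => ‖x j‖ₑ) (g := fun j => ‖y j‖ₑ)
    (by rw [enorm2_enorm]; exact enorm_ne_top) (by rw [enorm2_enorm]; exact enorm_ne_top)
  convert this using 3 with j
  rw [mul_assoc, enorm_mul, enorm_mul]
  congr 1
  rw [← ofReal_norm, ← ofReal_norm, Complex.norm_real]

/-! ### Quartic forms of sets of quadruples and the homological equation. -/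

open Classical in
/-- The indicator function of a set of quadruples. -/
def ind (P : (Fin 4 → Mode) → Prop) (J : Fin 4 → Mode) : ℂ := if P J then 1 else 0

theorem norm_ind_le (P : (Fin 4 → Mode) → Prop) (J : Fin 4 → Mode) : ‖ind P J‖ ≤ 1 := by
  unfold ind; split_ifs <;> simp

/-- The quartic form supported on a set of quadruples. -/
def quart (P : (Fin 4 → Mode) → Prop) (w : Phase a p) : ℂ := quartForm (ind P) fun _ => w

theorem summable_quart (ha : 0 < a) (hp : 1 / 2 < p) (P : (Fin 4 → Mode) → Prop) (w : Phase a p) :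
    Summable fun J : Fin 4 → Mode => ind P J * ∏ i, coord w (J i) :=
  summable_of_tsum_enorm (tsum_enorm_quartForm ha hp (norm_ind_le P) fun _ => w)

theorem divisor_mul_symb (hcd : ∀ J, NonRes I J → divisor m J ≠ 0)
    (J : Fin 4 → Mode) : ((divisor m J * symb m I J : ℝ) : ℂ) = ind (NonRes I) J := by
  unfold symb ind
  split_ifs with h
  · rw [mul_inv_cancel₀ (hcd J h)]; simp
  · simp

/-- The homological equation. -/
theorem quadHam_midpoint (hm : 0 < m) (ha : 0 < a) (hp : 1 / 2 < p) (hc : ∀ J, |symb m I J| ≤ c)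
    (hcd : ∀ J, NonRes I J → divisor m J ≠ 0) (z : Phase a p) :
    quadHam m (halfStep (triCLM m I ha hp hc) 1 z) -
      quadHam m (halfStep (triCLM m I ha hp hc) (-1) z) = -quart (NonRes I) z := by
  have hp0 : 0 < p := by linarith
  set X := cubic (triCLM m I ha hp hc) z with hX
  have hXs : ∀ s, coord X s = triComp m I s fun _ => z := coord_triCLM ha hp hc fun _ => z
  -- the weighted sum over quadruples is absolutely convergent
  set F : (Fin 4 → Mode) → ℂ := fun J =>
    ((((J 0).2 : ℤ) : ℂ) * (freq m (J 0).1 : ℂ)) * ((symb m I J : ℂ) * ∏ i, coord z (J i)) with hF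
  have hcons : ∀ (s : Mode) (J : Fin 3 → Mode), F (Matrix.vecCons (cj s) J) =
      -((freq m s.1 : ℂ) * coord z (cj s)) * (((fieldCoeff m I s J : ℂ) / 4) * ∏ i, coord z (J i)) := by
    intro s J
    simp only [hF, fieldCoeff, Fin.prod_univ_succ (n := 3), Matrix.cons_val_zero,
      Matrix.cons_val_succ]
    simp only [cj, Units.val_neg, Int.cast_neg]
    push_cast
    ring
  -- The frequency is unbounded, so the `ℓ¹` bound of the coordinates is not enough. Pair the first
  -- coordinate with the sequence of the other three, which lies in the same weighted space by the
  -- algebra property, and let the weight absorb the frequency.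
  have hFs : ∑' J, ‖F J‖ₑ ≠ ⊤ := by
    rw [tsum_pi_succ, ← cjEquiv.tsum_eq]
    set g : ℤ → ℝ≥0∞ := fun l => momSum (fun _ : Fin 3 => ecoord z) l
    have hg : enorm2 a p g ≠ ⊤ := by
      refine ne_top_of_le_ne_top ?_ (enorm2_momSum_le ha hp0 _)
      refine ENNReal.mul_ne_top (ENNReal.pow_ne_top (algConst_lt_top hp).ne)
        (ENNReal.prod_ne_top fun i _ => ne_top_of_le_ne_top ?_ (enorm2_fold_ecoord z))
      exact ENNReal.add_ne_top.2 ⟨enorm_ne_top, enorm_ne_top⟩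
    have hg' : enorm2 a p (fun l => g (-l)) ≠ ⊤ := by rwa [enorm2_neg]
    have hb : ∀ s : Mode, ∑' J : Fin 3 → Mode, ‖F (Matrix.vecCons (cj s) J)‖ₑ ≤
        ENNReal.ofReal c * (‖freq m s.1‖ₑ * (‖coord z (cj s)‖ₑ * g (mo s))) := by
      intro s
      have h1 : ∀ J : Fin 3 → Mode, ‖F (Matrix.vecCons (cj s) J)‖ₑ ≤ ENNReal.ofReal c *
          (‖freq m s.1‖ₑ * ‖coord z (cj s)‖ₑ) *
          (if ∑ i, mo (J i) = mo s then ∏ i, ecoord z (J i) else 0) := by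
        intro J
        rw [hcons, enorm_mul, enorm_neg, enorm_mul, enorm_mul, enorm_prod']
        have e1 : ‖(freq m s.1 : ℂ)‖ₑ = ‖freq m s.1‖ₑ := by
          rw [← ofReal_norm, ← ofReal_norm, Complex.norm_real]
        have e2 : ‖((fieldCoeff m I s J : ℂ) / 4)‖ₑ ≤ ENNReal.ofReal c := by
          rw [← ofReal_norm, norm_div, Complex.norm_real]
          refine ENNReal.ofReal_le_ofReal ?_
          have := abs_fieldCoeff_le hc s J
          rw [Real.norm_eq_abs]
          simp
          linarith
        rw [e1]
        split_ifs with h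
        · calc _ ≤ ‖freq m s.1‖ₑ * ‖coord z (cj s)‖ₑ * (ENNReal.ofReal c * ∏ i, ‖coord z (J i)‖ₑ) := by
                gcongr
            _ = _ := by simp only [ecoord]; ring
        · rw [fieldCoeff_eq_zero h]; simp
      refine (ENNReal.tsum_le_tsum h1).trans (le_of_eq ?_)
      rw [ENNReal.tsum_mul_left]
      simp only [g, momSum]
      ring
    refine ne_top_of_le_ne_top ?_ (ENNReal.tsum_le_tsum hb)
    rw [ENNReal.tsum_mul_left]
    refine ENNReal.mul_ne_top ENNReal.ofReal_ne_top ?_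
    rw [tsum_mode, ENNReal.tsum_add]
    have k1 := tsum_freq_ne_top hm ha hp0 (f := fun j => ‖z.2 j‖ₑ) (g := g)
      (by rw [enorm2_enorm]; exact enorm_ne_top) hg
    have k2 := tsum_freq_ne_top hm ha hp0 (f := fun j => ‖z.1 j‖ₑ) (g := fun l => g (-l))
      (by rw [enorm2_enorm]; exact enorm_ne_top) hg'
    refine ENNReal.add_ne_top.2 ⟨?_, ?_⟩
    · simpa [mo, cj, coord_neg_one] using k1
    · simpa [mo, cj, coord_one] using k2
  -- symmetrization
  have hsym : ∀ i : Fin 4, ∑' J : Fin 4 → Mode, (((((J i).2 : ℤ) : ℝ) * freq m (J i).1 : ℝ) : ℂ) *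
      ((symb m I J : ℂ) * ∏ k, coord z (J k)) = ∑' J, F J := by
    intro i
    rw [← (permFun Mode (Equiv.swap 0 i)).tsum_eq]
    refine tsum_congr fun J => ?_
    have e := Equiv.prod_comp (Equiv.swap 0 i) fun k => coord z (J k)
    simp only [permFun_apply, symb_perm, Function.comp, Equiv.swap_apply_right, hF]
    rw [e]
    push_cast
    rfl
  have hsummable : ∀ i : Fin 4, Summable fun J : Fin 4 → Mode =>
      (((((J i).2 : ℤ) : ℝ) * freq m (J i).1 : ℝ) : ℂ) *
      ((symb m I J : ℂ) * ∏ k, coord z (J k)) := by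
    intro i
    rw [← (permFun Mode (Equiv.swap 0 i)).summable_iff]
    refine (summable_of_tsum_enorm hFs).congr fun J => ?_
    have e := Equiv.prod_comp (Equiv.swap 0 i) fun k => coord z (J k)
    simp only [permFun_apply, symb_perm, Function.comp, Equiv.swap_apply_right, hF]
    rw [e]
    push_cast
    rfl
  have h4 : quart (NonRes I) z = 4 * ∑' J, F J := by
    have : quart (NonRes I) z = ∑' J : Fin 4 → Mode, ∑ i : Fin 4,
        (((((J i).2 : ℤ) : ℝ) * freq m (J i).1 : ℝ) : ℂ) *
        ((symb m I J : ℂ) * ∏ k, coord z (J k)) := by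
      refine tsum_congr fun J => ?_
      rw [← divisor_mul_symb hcd, ← Finset.sum_mul, divisor]
      push_cast
      ring
    rw [this, Summable.tsum_finsetSum fun i _ => hsummable i]
    simp only [hsym]
    simp
  -- the increment of the quadratic form
  have h1 : ∀ σ : ℤˣ, ∀ s, coord (halfStep (triCLM m I ha hp hc) σ z) s =
      coord z s + ((σ : ℤ) : ℂ) / 2 * coord X s := fun σ s => by
    rw [halfStep, coord_add, coord_smul]
  -- At the symmetric points `z ± X/2` the terms quadratic in `X` agree and drop out, so the
  -- increment is exactly bilinear in `z` and `X`.
  have h2 : quadHam m (halfStep (triCLM m I ha hp hc) 1 z) -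
      quadHam m (halfStep (triCLM m I ha hp hc) (-1) z) =
      ∑' j, (freq m j : ℂ) * (coord X (j, 1) * coord z (j, -1) + coord X (j, -1) * coord z (j, 1)) := by
    unfold quadHam
    rw [← Summable.tsum_sub (summable_quadHam hm ha hp0 _ _) (summable_quadHam hm ha hp0 _ _)]
    refine tsum_congr fun j => ?_
    simp only [← coord_one, ← coord_neg_one, h1]
    push_cast
    ring
  have h3 : ∀ s : Mode, ∑' J : Fin 3 → Mode, F (Matrix.vecCons (cj s) J) =
      -((freq m s.1 : ℂ) * coord z (cj s)) * (coord X s / 4) := by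
    intro s
    simp_rw [hcons]
    rw [tsum_mul_left, hXs, triComp, ← tsum_div_const]
    congr 1
    exact tsum_congr fun J => by ring
  rw [h2, h4, tsum_pi_succ_of_enorm hFs, ← cjEquiv.tsum_eq]
  simp only [cjEquiv, Equiv.coe_fn_mk, h3]
  rw [tsum_mode_of_enorm, ← tsum_mul_left, ← tsum_neg]
  · refine tsum_congr fun j => ?_
    simp only [cj, neg_neg]
    ring
  · simp_rw [← h3]
    refine ne_top_of_le_ne_top hFs ?_
    rw [tsum_pi_succ, ← cjEquiv.tsum_eq fun s => ∑' J : Fin 3 → Mode, ‖F (Matrix.vecCons s J)‖ₑ]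
    exact ENNReal.tsum_le_tsum fun s => enorm_tsum_le _

end quartic

end DNLW
end


noncomputable section

namespace DNLW

/-! ### The resonant part of the quartic form -/

section resonant

variable {a p : ℝ}

/-- The quadruples of zero momentum. -/
def ZeroMom (J : Fin 4 → Mode) : Prop := ∑ i, mo (J i) = 0

theorem quarticOn_eq (S : Set ℤ) (w : Phase a p) :
    quarticOn S w = quart (fun J => (∀ i, (J i).1 ∈ S) ∧ ZeroMom J) w := by
  refine tsum_congr fun J => ?_
  unfold ind
  by_cases h : (∀ i, (J i).1 ∈ S) ∧ ZeroMom J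
  · exact (if_pos h).trans (by rw [if_pos h, one_mul])
  · exact (if_neg h).trans (by rw [if_neg h, zero_mul])

theorem quart_eq_of_injective {P : Type*} (φ : P → Fin 4 → Mode) (hφ : Function.Injective φ)
    {Q : (Fin 4 → Mode) → Prop} (hQ : ∀ J, Q J → ∃ x, φ x = J) (w : Phase a p) :
    quart Q w = ∑' x, ind Q (φ x) * ∏ i, coord w (φ x i) := by
  refine (hφ.tsum_eq (f := fun J => ind Q J * ∏ i, coord w (J i)) fun J hJ => ?_).symm
  by_contra hc
  refine hJ ?_
  have : ¬ Q J := fun h => hc (hQ J h)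
  simp [ind, this]

/-- Some mode of the quadruple is in `I`. -/
def Meets (I : Finset ℤ) (J : Fin 4 → Mode) : Prop := ∃ i, (J i).1 ∈ I

open Classical in
theorem quart_matching (I : Finset ℤ) (w : Phase a p) {Q : (Fin 4 → Mode) → Prop}
    (φ : Mode × Mode → Fin 4 → Mode) (hφ : Function.Injective φ)
    (hQ : ∀ J, Q J → ∃ x, φ x = J) (hI : ∀ x, Q (φ x) ↔ x.1.1 ∈ I ∨ x.2.1 ∈ I)
    (hU : ∀ x, ∏ i, coord w (φ x i) =
      (coord w x.1 * coord w (cj x.1)) * (coord w x.2 * coord w (cj x.2))) :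
    quart Q w = ∑' x : Mode × Mode, if x.1.1 ∈ I ∨ x.2.1 ∈ I then
      (coord w x.1 * coord w (cj x.1)) * (coord w x.2 * coord w (cj x.2)) else 0 := by
  rw [quart_eq_of_injective φ hφ hQ]
  refine tsum_congr fun x => ?_
  rw [hU, ind, if_congr (hI x) rfl rfl]
  split_ifs <;> simp

open Classical in
theorem quart_double_matching (I : Finset ℤ) (w : Phase a p) {Q : (Fin 4 → Mode) → Prop}
    (φ : Mode → Fin 4 → Mode) (hφ : Function.Injective φ)
    (hQ : ∀ J, Q J → ∃ x, φ x = J) (hI : ∀ x, Q (φ x) ↔ x.1 ∈ I)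
    (hU : ∀ x, ∏ i, coord w (φ x i) = (coord w x * coord w (cj x)) ^ 2) :
    quart Q w = ∑' x : Mode, if x.1 ∈ I then (coord w x * coord w (cj x)) ^ 2 else 0 := by
  rw [quart_eq_of_injective φ hφ hQ]
  refine tsum_congr fun x => ?_
  rw [hU, ind, if_congr (hI x) rfl rfl]
  split_ifs <;> simp

theorem coord_mul_cj (w : Phase a p) (s : Mode) : coord w s * coord w (cj s) = w.1 s.1 * w.2 s.1 := by
  obtain ⟨j, σ⟩ := s
  rcases Int.units_eq_one_or σ with rfl | rfl
  · simp [cj, coord_one, coord_neg_one]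
  · simp [cj, coord_one, coord_neg_one, mul_comm]

theorem tsum_mode_fst (f : ℤ → ℂ) (hf : Summable fun s : Mode => f s.1) :
    ∑' s : Mode, f s.1 = 2 * ∑' j, f j := by
  rw [hf.tsum_prod' fun j => (hasSum_fintype _).summable, ← tsum_mul_left]
  refine tsum_congr fun j => ?_
  rw [tsum_fintype]
  simp

theorem tsum_mode_mode_fst (f : ℤ × ℤ → ℂ)
    (hf : Summable fun x : Mode × Mode => f (x.1.1, x.2.1)) :
    ∑' x : Mode × Mode, f (x.1.1, x.2.1) = 4 * ∑' q, f q := by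
  rw [← (Equiv.prodProdProdComm ℤ ℤ ℤˣ ℤˣ).tsum_eq]
  rw [← (Equiv.prodProdProdComm ℤ ℤ ℤˣ ℤˣ).summable_iff] at hf
  have hf' : Summable fun c : (ℤ × ℤ) × ℤˣ × ℤˣ => f c.1 := hf
  change ∑' c : (ℤ × ℤ) × ℤˣ × ℤˣ, f c.1 = _
  rw [hf'.tsum_prod' fun j => (hasSum_fintype _).summable, ← tsum_mul_left]
  refine tsum_congr fun j => ?_
  rw [tsum_fintype]
  simp [Fintype.card_prod]

/-- Inclusion-exclusion over three classes with empty triple intersection, so only the three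
pairwise corrections occur. -/
theorem inclusion_exclusion {Z M M' P B₁ B₂ B₃ : (Fin 4 → Mode) → Prop} (J : Fin 4 → Mode)
    (hP : P J ↔ B₁ J ∨ B₂ J ∨ B₃ J) (hB : ¬ (B₁ J ∧ B₂ J ∧ B₃ J)) (hZ : P J → Z J)
    (hM : M' J ↔ ¬ M J) :
    ind Z J - ind (fun J => Z J ∧ M J ∧ ¬ P J) J = ind (fun J => M' J ∧ Z J) J +
      (ind (fun J => M J ∧ B₁ J) J + ind (fun J => M J ∧ B₂ J) J + ind (fun J => M J ∧ B₃ J) J) -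
      (ind (fun J => (M J ∧ B₁ J) ∧ (M J ∧ B₂ J)) J + ind (fun J => (M J ∧ B₁ J) ∧ (M J ∧ B₃ J)) J +
        ind (fun J => (M J ∧ B₂ J) ∧ (M J ∧ B₃ J)) J) := by
  rw [hP] at hZ
  simp only [ind, hP, hM]
  by_cases hz : Z J <;> by_cases hm : M J <;> by_cases h1 : B₁ J <;> by_cases h2 : B₂ J <;>
    by_cases h3 : B₃ J <;> simp_all

/-- What survives are the quadruples avoiding `I` and the paired ones meeting `I`. Each of the three
pairings has four choices of signs, giving `12 ∑ U_i U_j`; each of the three overlaps has two,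
giving `6 ∑ U_j²`. Together these are the coefficients `12 (2 - δ_{ij}) / 2`. -/
theorem Gbar_add_Ghat (ha : 0 < a) (hp : 1 / 2 < p) (I : Finset ℤ) (w : Phase a p) :
    Gbar I w + Ghat I w = quart ZeroMom w - quart (NonRes I) w := by
  classical
  set U : ℤ → ℂ := fun j => w.1 j * w.2 j with hU
  have hUs : ∀ s : Mode, coord w s * coord w (cj s) = U s.1 := coord_mul_cj w
  have hUsum : ∑' s : Mode, ‖U s.1‖ₑ ≠ ⊤ := by
    simp_rw [← hUs]; exact tsum_mul_cj_ne_top ha hp w w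
  -- the six classes of paired quadruples
  set A : Fin 3 → (Fin 4 → Mode) → Prop := ![fun J => Meets I J ∧ J 1 = cj (J 0) ∧ J 3 = cj (J 2),
    fun J => Meets I J ∧ J 2 = cj (J 0) ∧ J 3 = cj (J 1),
    fun J => Meets I J ∧ J 3 = cj (J 0) ∧ J 2 = cj (J 1)] with hA
  set D : Fin 3 → (Fin 4 → Mode) → Prop := ![fun J => A 0 J ∧ A 1 J, fun J => A 0 J ∧ A 2 J,
    fun J => A 1 J ∧ A 2 J] with hD
  set SA : ℂ := ∑' x : Mode × Mode, if x.1.1 ∈ I ∨ x.2.1 ∈ I then U x.1.1 * U x.2.1 else 0 with hSA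
  set SD : ℂ := ∑' x : Mode, if x.1 ∈ I then U x.1 ^ 2 else 0 with hSD
  have meets4 : ∀ J, Meets I J ↔ (J 0).1 ∈ I ∨ (J 1).1 ∈ I ∨ (J 2).1 ∈ I ∨ (J 3).1 ∈ I := fun J => by
    unfold Meets; rw [Fin.exists_fin_succ, Fin.exists_fin_succ, Fin.exists_fin_two]; rfl
  have cj1 : ∀ s : Mode, (cj s).1 = s.1 := fun s => rfl
  have hAq : ∀ k, quart (A k) w = SA := by
    intro k
    simp only [hSA, ← hUs]
    fin_cases k
    · refine quart_matching I w (fun x => ![x.1, cj x.1, x.2, cj x.2]) ?_ ?_ ?_ ?_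
      · intro x y h
        exact Prod.ext (congrFun h 0) (congrFun h 2)
      · rintro J ⟨-, h1, h2⟩
        exact ⟨(J 0, J 2), by funext i; fin_cases i <;> simp [h1, h2]⟩
      · intro x
        change (Meets I _ ∧ _ ∧ _) ↔ _
        rw [meets4]
        simp [cj1]
        try tauto
      · intro x
        simp [Fin.prod_univ_four]; ring
    · refine quart_matching I w (fun x => ![x.1, x.2, cj x.1, cj x.2]) ?_ ?_ ?_ ?_
      · intro x y h
        exact Prod.ext (congrFun h 0) (congrFun h 1)
      · rintro J ⟨-, h1, h2⟩
        exact ⟨(J 0, J 1), by funext i; fin_cases i <;> simp [h1, h2]⟩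
      · intro x
        change (Meets I _ ∧ _ ∧ _) ↔ _
        rw [meets4]
        simp [cj1]
        try tauto
      · intro x
        simp [Fin.prod_univ_four]; ring
    · refine quart_matching I w (fun x => ![x.1, x.2, cj x.2, cj x.1]) ?_ ?_ ?_ ?_
      · intro x y h
        exact Prod.ext (congrFun h 0) (congrFun h 1)
      · rintro J ⟨-, h1, h2⟩
        exact ⟨(J 0, J 1), by funext i; fin_cases i <;> simp [h1, h2]⟩
      · intro x
        change (Meets I _ ∧ _ ∧ _) ↔ _
        rw [meets4]
        simp [cj1]
        try tauto
      · intro x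
        simp [Fin.prod_univ_four]; ring
  have hDq : ∀ k, quart (D k) w = SD := by
    intro k
    simp only [hSD, ← hUs]
    fin_cases k
    · refine quart_double_matching I w (fun x => ![x, cj x, cj x, x]) ?_ ?_ ?_ ?_
      · intro x y h
        exact congrFun h 0
      · rintro J ⟨⟨-, h1, h2⟩, -, h3, h4⟩
        exact ⟨J 0, by funext i; fin_cases i <;> simp [h1, h3, h4, cj_cj]⟩
      · intro x
        change ((Meets I _ ∧ _ ∧ _) ∧ (Meets I _ ∧ _ ∧ _)) ↔ _
        rw [meets4]
        simp [cj1, cj_cj]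
      · intro x
        simp [Fin.prod_univ_four]; ring
    · refine quart_double_matching I w (fun x => ![x, cj x, x, cj x]) ?_ ?_ ?_ ?_
      · intro x y h
        exact congrFun h 0
      · rintro J ⟨⟨-, h1, h2⟩, -, h3, h4⟩
        exact ⟨J 0, by funext i; fin_cases i <;> simp [h1, h3, h4, cj_cj]⟩
      · intro x
        change ((Meets I _ ∧ _ ∧ _) ∧ (Meets I _ ∧ _ ∧ _)) ↔ _
        rw [meets4]
        simp [cj1, cj_cj]
      · intro x
        simp [Fin.prod_univ_four]; ring
    · refine quart_double_matching I w (fun x => ![x, x, cj x, cj x]) ?_ ?_ ?_ ?_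
      · intro x y h
        exact congrFun h 0
      · rintro J ⟨⟨-, h1, h2⟩, -, h3, h4⟩
        refine ⟨J 0, ?_⟩
        have h5 : J 1 = J 0 := cj_injective (by rw [← h2, h3])
        funext i; fin_cases i <;> simp [h1, h3, h5]
      · intro x
        change ((Meets I _ ∧ _ ∧ _) ∧ (Meets I _ ∧ _ ∧ _)) ↔ _
        rw [meets4]
        simp [cj1]
      · intro x
        simp [Fin.prod_univ_four]; ring
  -- inclusion-exclusion
  have hind : ∀ J, ind ZeroMom J - ind (NonRes I) J =
      ind (fun J => (∀ i, (J i).1 ∈ ((I : Set ℤ)ᶜ)) ∧ ZeroMom J) J +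
      (ind (A 0) J + ind (A 1) J + ind (A 2) J) - (ind (D 0) J + ind (D 1) J + ind (D 2) J) := by
    intro J
    have hp : Paired J → ZeroMom J := by
      intro h
      rw [paired_iff] at h
      unfold ZeroMom
      rw [Fin.sum_univ_four]
      rcases h with h | h | h <;> rw [h.1, h.2, mo_cj, mo_cj] <;> ring
    have hM : (∀ i, (J i).1 ∈ ((I : Set ℤ)ᶜ)) ↔ ¬ Meets I J := by simp [Meets]
    have e1 : NonRes I J ↔ ZeroMom J ∧ Meets I J ∧ ¬ Paired J := Iff.rfl
    have hn : ¬ ((J 1 = cj (J 0) ∧ J 3 = cj (J 2)) ∧ (J 2 = cj (J 0) ∧ J 3 = cj (J 1)) ∧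
        (J 3 = cj (J 0) ∧ J 2 = cj (J 1))) := by
      -- All three pairings at once would make the first mode its own conjugate, against its sign.
      rintro ⟨⟨h1, h2⟩, ⟨h3, h4⟩, ⟨h5, -⟩⟩
      have h6 := congrArg Prod.snd (h5.symm.trans h4)
      rw [h1] at h6
      have h7 : -(J 0).2 = - -(J 0).2 := h6
      rcases Int.units_eq_one_or (J 0).2 with h | h <;> rw [h] at h7 <;> revert h7 <;> decide
    have hpi := paired_iff J
    exact inclusion_exclusion (Z := ZeroMom) (M := Meets I) (P := Paired)
      (M' := fun J => ∀ i, (J i).1 ∈ ((I : Set ℤ)ᶜ)) (B₁ := fun J => J 1 = cj (J 0) ∧ J 3 = cj (J 2))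
      (B₂ := fun J => J 2 = cj (J 0) ∧ J 3 = cj (J 1))
      (B₃ := fun J => J 3 = cj (J 0) ∧ J 2 = cj (J 1)) J hpi hn hp hM
  have hs := summable_quart (a := a) ha hp
  have hmain : quart ZeroMom w - quart (NonRes I) w = Ghat I w + (SA + SA + SA) - (SD + SD + SD) := by
    rw [Ghat, quarticOn_eq]
    nth_rewrite 1 [← hAq 0]
    nth_rewrite 1 [← hAq 1]
    nth_rewrite 1 [← hAq 2]
    nth_rewrite 1 [← hDq 0]
    nth_rewrite 1 [← hDq 1]
    nth_rewrite 1 [← hDq 2]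
    simp only [quart, quartForm]
    rw [← (hs _ w).tsum_sub (hs _ w), ← (hs _ w).tsum_add (hs _ w),
      ← ((hs _ w).add (hs _ w)).tsum_add (hs _ w), ← (hs _ w).tsum_add (hs _ w),
      ← ((hs _ w).add (hs _ w)).tsum_add (hs _ w),
      ← (hs _ w).tsum_add (((hs _ w).add (hs _ w)).add (hs _ w)),
      ← ((hs _ w).add (((hs _ w).add (hs _ w)).add (hs _ w))).tsum_sub
        (((hs _ w).add (hs _ w)).add (hs _ w))]
    refine tsum_congr fun J => ?_
    linear_combination (∏ i, coord w (J i)) * hind J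
  -- the two sums in terms of the actions
  have hSAs : Summable fun x : Mode × Mode =>
      if x.1.1 ∈ I ∨ x.2.1 ∈ I then U x.1.1 * U x.2.1 else 0 := by
    refine summable_of_tsum_enorm ?_
    refine ne_top_of_le_ne_top (ENNReal.mul_ne_top hUsum hUsum) ?_
    rw [ENNReal.tsum_prod', ← ENNReal.tsum_mul_right]
    refine ENNReal.tsum_le_tsum fun s => ?_
    rw [← ENNReal.tsum_mul_left]
    refine ENNReal.tsum_le_tsum fun t => ?_
    split_ifs
    · rw [enorm_mul]
    · simp
  have h1 := tsum_mode_mode_fst (fun q => if q.1 ∈ I ∨ q.2 ∈ I then U q.1 * U q.2 else 0) hSAs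
  have hSDs : Summable fun x : Mode => if x.1 ∈ I then U x.1 ^ 2 else 0 := by
    refine summable_of_tsum_enorm ?_
    refine ne_top_of_le_ne_top (ENNReal.mul_ne_top hUsum hUsum) ?_
    rw [← ENNReal.tsum_mul_right]
    refine ENNReal.tsum_le_tsum fun s => ?_
    split_ifs
    · rw [pow_two, enorm_mul]
      gcongr
      exact ENNReal.le_tsum (f := fun s : Mode => ‖U s.1‖ₑ) s
    · simp
  have h2 := tsum_mode_fst (f := fun j => if j ∈ I then U j ^ 2 else 0) hSDs
  have hsA : Summable fun q : ℤ × ℤ => if q.1 ∈ I ∨ q.2 ∈ I then U q.1 * U q.2 else 0 :=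
    (hSAs.comp_injective (i := fun q : ℤ × ℤ => ((q.1, 1), (q.2, 1)) )
      fun q q' h => by simpa [Prod.ext_iff] using h)
  have hsD : Summable fun j : ℤ => if j ∈ I then U j ^ 2 else 0 :=
    hSDs.comp_injective (i := fun j : ℤ => (j, 1)) fun q q' h => by simpa using h
  have hdiag : Function.Injective fun j : ℤ => (j, j) := fun j j' h => by simpa using h
  have hsD' : HasSum (fun q : ℤ × ℤ => if q.1 ∈ I ∨ q.2 ∈ I then
      (if q.1 = q.2 then (1 : ℂ) else 0) * (U q.1 * U q.2) else 0)
      (∑' j, if j ∈ I then U j ^ 2 else 0) := by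
    rw [← hdiag.hasSum_iff]
    · convert hsD.hasSum using 2 with j
      simp [pow_two]
    · rintro ⟨i, j⟩ hij
      have : i ≠ j := by rintro rfl; exact hij ⟨i, rfl⟩
      simp [this]
  have hG : Gbar I w = 12 * (∑' q : ℤ × ℤ, if q.1 ∈ I ∨ q.2 ∈ I then U q.1 * U q.2 else 0) -
      6 * ∑' j, if j ∈ I then U j ^ 2 else 0 := by
    rw [← hsD'.tsum_eq, ← tsum_mul_left, ← tsum_mul_left, ← (hsA.mul_left 12).tsum_sub
      (hsD'.summable.mul_left 6), Gbar, ← tsum_mul_left]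
    refine tsum_congr fun q => ?_
    simp only [hU]
    split_ifs <;> ring
  rw [hmain, hG, hSA, hSD, h1, h2]
  ring

theorem hamiltonian_eq (m : ℝ) (w : Phase a p) :
    hamiltonian m w = quadHam m w + quart ZeroMom w := by
  rw [hamiltonian, quarticOn_eq]
  simp

end resonant

end DNLW
end


noncomputable section

namespace DNLW

/-! ### Tree expansion of the midpoint -/

namespace Ternary

/-- The mode at the root: the momentum of the root is the total momentum of the leaves. -/
def root : Ternary Mode → Mode
  | leaf s => s
  | node σ t₁ t₂ t₃ => ((σ : ℤ) * (mo t₁.root + mo t₂.root + mo t₃.root), σ)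

theorem mo_root_node (σ : ℤˣ) (t₁ t₂ t₃ : Ternary Mode) :
    mo (node σ t₁ t₂ t₃).root = mo t₁.root + mo t₂.root + mo t₃.root := mo_mk _ _

theorem mo_root (t : Ternary Mode) : mo t.root = (t.leaves.map mo).sum := by
  induction t with
  | leaf s => simp [root, leaves]
  | node σ t₁ t₂ t₃ h₁ h₂ h₃ => rw [mo_root_node, h₁, h₂, h₃]; simp [leaves, add_assoc]

/-- The coefficient of a tree. -/
def coef (m : ℝ) (I : Finset ℤ) : Ternary Mode → ℝ
  | leaf _ => 1
  | node σ t₁ t₂ t₃ => 1 / 2 * fieldCoeff m I (node σ t₁ t₂ t₃).root ![t₁.root, t₂.root, t₃.root] *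
      (t₁.coef m I * (t₂.coef m I * t₃.coef m I))

variable {m : ℝ} {I : Finset ℤ} {c : ℝ}

theorem abs_coef_le (hc : ∀ J, |symb m I J| ≤ c) (t : Ternary Mode) :
    |t.coef m I| ≤ (2 * c) ^ t.nodes := by
  have hc0 : 0 ≤ c := (abs_nonneg _).trans (hc fun _ => (0, 1))
  induction t with
  | leaf s => simp [coef, nodes]
  | node σ t₁ t₂ t₃ h₁ h₂ h₃ =>
    rw [coef, abs_mul, abs_mul, abs_mul, abs_mul, nodes, pow_succ, pow_add, pow_add]
    have h := abs_fieldCoeff_le hc (node σ t₁ t₂ t₃).root ![t₁.root, t₂.root, t₃.root]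
    have h' : |(1 / 2 : ℝ)| * |fieldCoeff m I (node σ t₁ t₂ t₃).root ![t₁.root, t₂.root, t₃.root]| ≤
        2 * c := by
      rw [abs_of_pos (by norm_num : (0 : ℝ) < 1 / 2)]; linarith
    calc _ ≤ (2 * c) * ((2 * c) ^ t₁.nodes * ((2 * c) ^ t₂.nodes * (2 * c) ^ t₃.nodes)) := by gcongr
      _ = _ := by ring

/-- The indicator function of the trees without nodes. -/
def isLeaf {α : Type} : Ternary α → ℝ
  | leaf _ => 1
  | node _ _ _ _ => 0

end Ternary

open Ternary

section expansion

variable {a p : ℝ} {m : ℝ} {I : Finset ℤ} {c : ℝ}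

/-- The term of the expansion associated to a tree. -/
def treeTerm (m : ℝ) (I : Finset ℤ) (w : Phase a p) (t : Ternary Mode) : ℂ :=
  (t.coef m I : ℂ) * (t.leaves.map (coord w)).prod

open Classical in
/-- The sum of the terms of the trees with a given root. -/
def treeSum (m : ℝ) (I : Finset ℤ) (w : Phase a p) (s : Mode) : ℂ :=
  ∑' t : Ternary Mode, if t.root = s then treeTerm m I w t else 0

theorem enorm_list_prod (L : List Mode) (w : Phase a p) :
    ‖(L.map (coord w)).prod‖ₑ = (L.map (ecoord w)).prod := by
  induction L with
  | nil => simp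
  | cons s L ih => simp only [List.map_cons, List.prod_cons, enorm_mul, ih]; rfl

theorem enorm_treeTerm_le (hc : ∀ J, |symb m I J| ≤ c) (w : Phase a p) (t : Ternary Mode) :
    ‖treeTerm m I w t‖ₑ ≤ ENNReal.ofReal (2 * c) ^ t.nodes * (t.leaves.map (ecoord w)).prod := by
  have hc0 : 0 ≤ c := (abs_nonneg _).trans (hc fun _ => (0, 1))
  rw [treeTerm, enorm_mul, enorm_list_prod, ← ofReal_norm, Complex.norm_real]
  gcongr
  rw [← ENNReal.ofReal_pow (by positivity)]
  exact ENNReal.ofReal_le_ofReal (abs_coef_le hc t)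

/-- The smallness condition for the convergence of the sums over trees. -/
structure SmallPoint (c : ℝ) (w : Phase a p) : Prop where
  alg : 16 * (ENNReal.ofReal (2 * c) * algConst p ^ 2) * (enorm2 a p (fold (ecoord w))) ^ 2 ≤ 1
  l1 : 16 * ENNReal.ofReal (2 * c) * (∑' s, ecoord w s) ^ 2 ≤ 1

theorem tsum_enorm_treeTerm (ha : 0 < a) (hp : 1 / 2 < p) (hc : ∀ J, |symb m I J| ≤ c)
    {w : Phase a p} (hw : SmallPoint c w) : ∑' t, ‖treeTerm m I w t‖ₑ ≠ ⊤ := by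
  refine ne_top_of_le_ne_top ?_ ((ENNReal.tsum_le_tsum fun t => enorm_treeTerm_le hc w t).trans
    (tsum_weight_le hw.l1))
  exact ENNReal.mul_ne_top (by simp) (tsum_enorm_coord_ne_top ha hp w)

theorem enorm2_tsum_momSum_le (ha : 0 < a) (hp : 0 < p) (x : Mode → ℝ≥0∞) {b : ℕ → ℝ≥0∞}
    (hb : b 0 = 0) : enorm2 a p (fun k => ∑' n, b n * momSum (fun _ : Fin n => x) k) ≤
      ∑' n, b n * (algConst p ^ (n - 1) * enorm2 a p (fold x) ^ n) := by
  refine (enorm2_tsum_le _).trans (ENNReal.tsum_le_tsum fun n => ?_)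
  cases n with
  | zero => simp [hb, enorm2]
  | succ n =>
    rw [enorm2_const_mul]
    gcongr
    refine (enorm2_momSum_le ha hp _).trans (le_of_eq ?_)
    simp

/-- Trees with a given root are injected into shapes times lists of leaves of that momentum, so the
sum is dominated by a series of `momSum`s whose coefficients count shapes. Taking norms gives a sum
over unlabelled trees with leaf weight `y` and node weight `C * algConst p ^ 2`, since a tree with
`n` nodes has `2n + 1` leaves and needs `2n` convolutions. -/
theorem enorm2_treeSum_le (ha : 0 < a) (hp : 1 / 2 < p) (hc : ∀ J, |symb m I J| ≤ c)
    {w : Phase a p} (hw : SmallPoint c w) (σ : ℤˣ) :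
    enorm2 a p (fun l => ‖treeSum m I w (l, σ)‖ₑ) ≤ 2 * enorm2 a p (fold (ecoord w)) := by
  classical
  set C := ENNReal.ofReal (2 * c)
  set x := ecoord w
  set y := enorm2 a p (fold x)
  set b : ℕ → ℝ≥0∞ := fun n => ∑' t : Ternary Unit, if 2 * t.nodes + 1 = n then C ^ t.nodes else 0
  have hb : b 0 = 0 := by simp [b]
  have h1 : ∀ s : Mode, ‖treeSum m I w s‖ₑ ≤ ∑' n, b n * momSum (fun _ : Fin n => x) (mo s) := by
    intro s
    rw [← tsum_list_momSum]
    refine (enorm_tsum_le _).trans ?_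
    calc _ ≤ ∑' t : Ternary Mode, (fun L : List Mode => if (L.map mo).sum = mo s then (L.map x).prod
            else 0) t.leaves * C ^ (t.map fun _ => ()).nodes := by
          refine ENNReal.tsum_le_tsum fun t => ?_
          by_cases h : t.root = s
          · rw [if_pos h, ← h, nodes_map]
            simp only [mo_root, if_true]
            rw [mul_comm]
            exact enorm_treeTerm_le hc w t
          · rw [if_neg h]; simp
      _ ≤ ∑' L : List Mode, (if (L.map mo).sum = mo s then (L.map x).prod else 0) * b L.length := by
          refine (tsum_shape_list_le (Q := Ternary Mode) leaves (fun t => t.map fun _ => ())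
            (fun t => 2 * t.nodes + 1) (fun t => ?_) (fun t t' h => ?_) (fun t => C ^ t.nodes) _)
          · rw [nodes_map, length_leaves]
          · simp only [Prod.mk.injEq] at h
            exact ext_of_shape h.1 h.2
      _ = _ := by
          refine tsum_congr fun L => ?_
          rw [ite_mul, zero_mul, mul_comm]
  have h2 : enorm2 a p (fun l => ‖treeSum m I w (l, σ)‖ₑ) ≤
      enorm2 a p (fun k => ∑' n, b n * momSum (fun _ : Fin n => x) k) := by
    rcases Int.units_eq_one_or σ with rfl | rfl
    · refine enorm2_mono fun l => (h1 _).trans (le_of_eq ?_)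
      simp [mo]
    · rw [← enorm2_neg]
      refine enorm2_mono fun l => (h1 _).trans (le_of_eq ?_)
      simp [mo]
  refine h2.trans ((enorm2_tsum_momSum_le ha (by linarith) x hb).trans ?_)
  have h3 : ∑' n, b n * (algConst p ^ (n - 1) * y ^ n) =
      ∑' t : Ternary Unit, (C * algConst p ^ 2) ^ t.nodes * (t.leaves.map fun _ => y).prod := by
    simp only [b, ← ENNReal.tsum_mul_right]
    rw [ENNReal.tsum_comm]
    refine tsum_congr fun t => ?_
    rw [tsum_eq_single (2 * t.nodes + 1) fun n hn => by rw [if_neg (Ne.symm hn), zero_mul],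
      if_pos rfl, List.map_const', List.prod_replicate, length_leaves]
    rw [mul_pow, ← pow_mul, Nat.add_sub_cancel]
    ring
  rw [h3]
  refine (tsum_weight_le ?_).trans ?_
  · rw [tsum_fintype, Fintype.sum_unique]; exact hw.alg
  · rw [tsum_fintype]; simp

theorem tsum_comp_root {n : ℕ} (h : (Fin n → Mode) → ℂ) {C : ℝ} (hh : ∀ J, ‖h J‖ ≤ C)
    {f : Fin n → Ternary Mode → ℂ} (hf : ∀ i, ∑' t, ‖f i t‖ₑ ≠ ⊤) :
    ∑' q : Fin n → Ternary Mode, h (fun i => (q i).root) * ∏ i, f i (q i) =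
      ∑' J : Fin n → Mode, h J * ∏ i, ∑' t, if t.root = J i then f i t else 0 := by
  rw [tsum_comp_pi root h hh hf]
  refine tsum_congr fun J => ?_
  congr 1
  refine Finset.prod_congr rfl fun i _ => tsum_congr fun t => ?_
  split_ifs <;> rfl

/-- Cutting a tree at its root: a leaf contributes the coordinate of `w`, and the triples of trees
hanging from a root node, grouped by their root modes, reproduce the trilinear field. This is the
fixed point equation `z = w + X(z)/2`. -/
theorem treeSum_eq (ha : 0 < a) (hp : 1 / 2 < p) (hc : ∀ J, |symb m I J| ≤ c)
    {w : Phase a p} (hw : SmallPoint c w) (s : Mode) :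
    treeSum m I w s = coord w s + 1 / 2 * ∑' J : Fin 3 → Mode, (fieldCoeff m I s J : ℂ) *
      ∏ i, treeSum m I w (J i) := by
  classical
  have hsum := tsum_enorm_treeTerm ha hp hc hw
  have hcomp := tsum_comp_root (C := 4 * c) (fun J : Fin 3 → Mode => (fieldCoeff m I s J : ℂ))
    (fun J => by rw [Complex.norm_real]; exact abs_fieldCoeff_le hc s J)
    (f := fun _ => treeTerm m I w) (fun _ => hsum)
  have hne : ∑' q : Fin 3 → Ternary Mode, ‖(fieldCoeff m I s (fun i => (q i).root) : ℂ) *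
      ∏ i, treeTerm m I w (q i)‖ₑ ≠ ⊤ :=
    tsum_enorm_mul_ne_top (C := 4 * c) (fun J => by
      rw [Complex.norm_real]; exact abs_fieldCoeff_le hc s _) (tsum_pi_prod_ne_top fun _ => hsum)
  have hs2 := (summable_of_tsum_enorm hne).hasSum
  rw [hcomp] at hs2
  change HasSum _ (∑' J : Fin 3 → Mode, (fieldCoeff m I s J : ℂ) * ∏ i, treeSum m I w (J i)) at hs2
  set Y := ∑' J : Fin 3 → Mode, (fieldCoeff m I s J : ℂ) * ∏ i, treeSum m I w (J i)
  -- triples of trees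
  set E : Ternary Mode × Ternary Mode × Ternary Mode ≃ (Fin 3 → Ternary Mode) :=
    ⟨fun q => ![q.1, q.2.1, q.2.2], fun q => (q 0, q 1, q 2), fun q => rfl, fun q => by
      funext i; fin_cases i <;> rfl⟩
  rw [← E.hasSum_iff] at hs2
  -- Only nodes with the sign of `s` can have root `s`, so the sign of the node is not free.
  have hinj : Function.Injective fun q : Ternary Mode × Ternary Mode × Ternary Mode =>
      (s.2, q) := fun q q' h => (Prod.mk.inj h).2
  have hnode : HasSum (fun q : ℤˣ × Ternary Mode × Ternary Mode × Ternary Mode =>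
      if (node q.1 q.2.1 q.2.2.1 q.2.2.2).root = s then
        treeTerm m I w (node q.1 q.2.1 q.2.2.1 q.2.2.2) else 0) (1 / 2 * Y) := by
    rw [← hinj.hasSum_iff]
    · have hs3 : HasSum (fun q => 1 / 2 * ((fieldCoeff m I s (fun i => (E q i).root) : ℂ) *
          ∏ i, treeTerm m I w (E q i))) (1 / 2 * Y) := hs2.mul_left (1 / 2)
      convert hs3 using 1
      funext q
      obtain ⟨t₁, t₂, t₃⟩ := q
      change (if (node s.2 t₁ t₂ t₃).root = s then treeTerm m I w (node s.2 t₁ t₂ t₃) else 0) =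
        1 / 2 * ((fieldCoeff m I s (fun i => (![t₁, t₂, t₃] i).root) : ℂ) *
          ∏ i, treeTerm m I w (![t₁, t₂, t₃] i))
      have hq : (fun i => (![t₁, t₂, t₃] i).root) = ![t₁.root, t₂.root, t₃.root] := by
        funext i; fin_cases i <;> rfl
      rw [hq]
      split_ifs with h
      · simp only [treeTerm, coef, leaves, List.map_append, List.prod_append, Fin.prod_univ_three,
          Matrix.cons_val_zero, Matrix.cons_val_one, Matrix.cons_val, h]
        push_cast
        ring
      -- If the root is not `s` although its sign is right, then the momenta differ and the
      -- coefficient vanishes; the two sides agree term by term.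
      · rw [fieldCoeff_eq_zero]
        · simp
        · intro h0
          refine h (mode_ext ?_ rfl)
          rw [mo_root_node, ← h0, Fin.sum_univ_three]
          rfl
    · rintro ⟨σ, q⟩ hσ
      rw [if_neg]
      intro h
      exact hσ ⟨q, by rw [← h]; rfl⟩
  have hleaf : HasSum (fun s' : Mode => if (leaf s' : Ternary Mode).root = s then
      treeTerm m I w (leaf s') else 0) (coord w s) := by
    have := hasSum_ite_eq (b := s) (coord w s)
    convert this using 2 with s'
    by_cases h : s' = s
    · subst h; simp [root, treeTerm, coef, leaves]
    · simp [root, h]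
  exact (hasSum_of_leaf_of_node (f := fun t : Ternary Mode => if t.root = s then treeTerm m I w t
    else 0) hleaf hnode).tsum_eq

theorem norm_le_of_enorm2 {z : Phase a p} {r : ℝ} (hr : 0 ≤ r)
    (h : ∀ σ : ℤˣ, enorm2 a p (fun l => ‖coord z (l, σ)‖ₑ) ≤ ENNReal.ofReal r) : ‖z‖ ≤ r := by
  have h1 := h 1
  have h2 := h (-1)
  rw [enorm2_coord_one, ← ofReal_norm, ENNReal.ofReal_le_ofReal_iff hr] at h1
  rw [enorm2_coord_neg_one, ← ofReal_norm, ENNReal.ofReal_le_ofReal_iff hr] at h2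
  exact max_le h1 h2

theorem enorm2_fold_ecoord_le (w : Phase a p) :
    enorm2 a p (fold (ecoord w)) ≤ ENNReal.ofReal (2 * ‖w‖) := by
  refine (enorm2_fold_ecoord w).trans ((enorm_fst_add_snd_le w).trans (le_of_eq ?_))
  rw [ENNReal.ofReal_mul (by norm_num), ofReal_norm]
  simp

/-- The solution of the midpoint equation is the sum over trees. -/
theorem coord_eq_treeSum (ha : 0 < a) (hp : 1 / 2 < p) (hc : ∀ J, |symb m I J| ≤ c)
    {ρ : ℝ} (h : 9 * ‖triCLM (a := a) m I ha hp hc‖ * ρ ^ 2 ≤ 2) {z w : Phase a p} (hz : ‖z‖ < ρ)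
    (he : halfStep (triCLM m I ha hp hc) (-1) z = w) (hw : SmallPoint c w) (hwρ : 4 * ‖w‖ ≤ ρ)
    (s : Mode) : coord z s = treeSum m I w s := by
  have h1 : ∀ σ : ℤˣ, enorm2 a p (fun l => ‖treeSum m I w (l, σ)‖ₑ) ≤ ENNReal.ofReal (4 * ‖w‖) := by
    intro σ
    refine (enorm2_treeSum_le ha hp hc hw σ).trans ?_
    calc _ ≤ 2 * ENNReal.ofReal (2 * ‖w‖) := by gcongr; exact enorm2_fold_ecoord_le w
      _ = _ := by
        rw [← ENNReal.ofReal_ofNat, ← ENNReal.ofReal_mul (by norm_num)]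
        congr 1
        ring
  -- The tree sums are the coordinates of a point of the ball of radius `ρ` solving the same
  -- equation as `z`; injectivity of `z - X(z)/2` there identifies the two.
  set z' := ofCoord a p (treeSum m I w)
  have hz' : ∀ s, coord z' s = treeSum m I w s :=
    coord_ofCoord fun σ => (h1 σ).trans_lt ENNReal.ofReal_lt_top
  have hn : ‖z'‖ ≤ ρ := by
    refine (norm_le_of_enorm2 (by positivity) fun σ => ?_).trans hwρ
    simp only [hz']
    exact h1 σ
  have he' : halfStep (triCLM m I ha hp hc) (-1) z' = w := by
    refine Phase.ext fun s => ?_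
    rw [halfStep, coord_add, coord_smul, cubic, coord_triCLM, triComp, hz', treeSum_eq ha hp hc hw]
    simp only [hz']
    push_cast
    ring
  rw [halfStep_injOn h (-1) hz.le hn (he.trans he'.symm), hz']

end expansion

end DNLW
end


noncomputable section

namespace DNLW

open Ternary

/-! ### The remainder -/

section remainder

/-- The modes at the roots of four trees. -/
def roots (q : Fin 4 → Ternary Mode) (i : Fin 4) : Mode := (q i).root

/-- The list of the labels of the leaves of four trees. -/
def quadLeaves {α : Type} (q : Fin 4 → Ternary α) : List α := (List.ofFn fun i => (q i).leaves).flatten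

/-- The number of nodes of four trees. -/
def quadNodes {α : Type} (q : Fin 4 → Ternary α) : ℕ := ∑ i, (q i).nodes

theorem prod_quadLeaves {α M : Type} [CommMonoid M] (f : α → M) (q : Fin 4 → Ternary α) :
    ((quadLeaves q).map f).prod = ∏ i, ((q i).leaves.map f).prod := by
  rw [quadLeaves, List.map_flatten, List.prod_flatten, List.map_ofFn, List.map_ofFn, List.prod_ofFn]
  rfl

theorem sum_quadLeaves {α M : Type} [AddCommMonoid M] (f : α → M) (q : Fin 4 → Ternary α) :
    ((quadLeaves q).map f).sum = ∑ i, ((q i).leaves.map f).sum := by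
  rw [quadLeaves, List.map_flatten, List.sum_flatten, List.map_ofFn, List.map_ofFn, List.sum_ofFn]
  rfl

theorem length_quadLeaves {α : Type} (q : Fin 4 → Ternary α) :
    (quadLeaves q).length = 2 * quadNodes q + 4 := by
  rw [quadLeaves, List.length_flatten, List.map_ofFn, List.sum_ofFn, quadNodes]
  simp only [Function.comp, length_leaves]
  rw [Finset.sum_add_distrib, ← Finset.mul_sum]
  simp

theorem isLeaf_mem {α : Type} (t : Ternary α) : 0 ≤ t.isLeaf ∧ t.isLeaf ≤ 1 := by
  cases t <;> simp [isLeaf]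

/-- The combinatorial factor of four trees in the remainder. -/
def quadFactor (I : Finset ℤ) (q : Fin 4 → Ternary Mode) : ℂ :=
  ind ZeroMom (roots q) * (((∏ i, (2 - (q i).isLeaf) - ∏ i, (q i).isLeaf : ℝ)) : ℂ) -
    ind (NonRes I) (roots q) * ((1 - ∏ i, (q i).isLeaf : ℝ) : ℂ)

theorem norm_quadFactor_le (I : Finset ℤ) (q : Fin 4 → Ternary Mode) : ‖quadFactor I q‖ ≤ 17 := by
  have h0 : 0 ≤ ∏ i, (q i).isLeaf := Finset.prod_nonneg fun i _ => (isLeaf_mem _).1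
  have h1 : ∏ i, (q i).isLeaf ≤ 1 :=
    Finset.prod_le_one (fun i _ => (isLeaf_mem _).1) fun i _ => (isLeaf_mem _).2
  have h2 : ∏ i, (2 - (q i).isLeaf) ≤ ∏ i : Fin 4, (2 : ℝ) :=
    Finset.prod_le_prod (fun i _ => by linarith [(isLeaf_mem (q i)).2]) fun i _ => by
      linarith [(isLeaf_mem (q i)).1]
  have h3 : 1 ≤ ∏ i, (2 - (q i).isLeaf) := by
    calc (1 : ℝ) = ∏ i : Fin 4, 1 := by simp
      _ ≤ _ := Finset.prod_le_prod (fun i _ => by norm_num) fun i _ => by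
        linarith [(isLeaf_mem (q i)).2]
  have h4 : ∏ i : Fin 4, (2 : ℝ) = 16 := by norm_num [Fin.prod_univ_four]
  rw [h4] at h2
  unfold quadFactor
  refine (norm_sub_le _ _).trans ?_
  rw [norm_mul, norm_mul, Complex.norm_real, Complex.norm_real, Real.norm_of_nonneg (by linarith),
    Real.norm_of_nonneg (by linarith)]
  have := norm_ind_le ZeroMom (roots q)
  have := norm_ind_le (NonRes I) (roots q)
  nlinarith [norm_nonneg (ind ZeroMom (roots q)), norm_nonneg (ind (NonRes I) (roots q))]

/-- The coefficient of four trees in the remainder. -/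
def quadCoef (m : ℝ) (I : Finset ℤ) (q : Fin 4 → Ternary Mode) : ℂ :=
  quadFactor I q * ((∏ i, (q i).coef m I : ℝ) : ℂ)

open Classical in
/-- The formal power series of the remainder. -/
def remainder (m : ℝ) (I : Finset ℤ) : Series := fun γ =>
  ∑' q : Fin 4 → Ternary Mode, if lidx (quadLeaves q) = γ then quadCoef m I q else 0

open Classical in
theorem coeff_remainder (m : ℝ) (I : Finset ℤ) (γ : MIdx) :
    MvPowerSeries.coeff γ (remainder m I) =
      ∑' q : Fin 4 → Ternary Mode, if lidx (quadLeaves q) = γ then quadCoef m I q else 0 := rfl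

variable {a p : ℝ} {m : ℝ} {I : Finset ℤ} {c : ℝ}

theorem momentum_quadLeaves (q : Fin 4 → Ternary Mode) :
    momentum (lidx (quadLeaves q)) = ∑ i, mo (roots q i) := by
  rw [momentum_lidx, sum_quadLeaves]
  exact Finset.sum_congr rfl fun i _ => (mo_root _).symm

/-- If all four trees are leaves, then both brackets are `1 - 1`: the quartic terms cancel. -/
theorem quadFactor_ne_zero {q : Fin 4 → Ternary Mode} (h : quadFactor I q ≠ 0) :
    ZeroMom (roots q) ∧ 0 < quadNodes q := by
  have hN : NonRes I (roots q) → ZeroMom (roots q) := fun h => h.1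
  constructor
  · by_contra hz
    have hn : ¬ NonRes I (roots q) := fun h => hz (hN h)
    exact h (by simp [quadFactor, ind, hz, hn])
  · by_contra hz
    have hz' : ∀ i, (q i).nodes = 0 := by
      have : quadNodes q = 0 := by omega
      simpa [quadNodes] using this
    have h1 : ∀ i, (q i).isLeaf = 1 := by
      intro i
      have := hz' i
      cases hq : q i with
      | leaf s => rfl
      | node => rw [hq] at this; simp [nodes] at this
    refine h ?_
    simp only [quadFactor, h1]
    norm_num

/-- Four trees with `n ≥ 1` nodes in total have `2n + 4` leaves, and the momentum of the monomial is
that of the four roots. -/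
theorem coeff_remainder_ne_zero {γ : MIdx} (h : MvPowerSeries.coeff γ (remainder m I) ≠ 0) :
    6 ≤ γ.degree ∧ Even γ.degree ∧ momentum γ = 0 := by
  classical
  rw [coeff_remainder] at h
  obtain ⟨q, hq⟩ : ∃ q : Fin 4 → Ternary Mode,
      (if lidx (quadLeaves q) = γ then quadCoef m I q else 0) ≠ 0 := by
    by_contra hc
    push Not at hc
    exact h (by simp [hc])
  have hγ : lidx (quadLeaves q) = γ := by
    by_contra hc
    exact hq (if_neg hc)
  rw [if_pos hγ] at hq
  obtain ⟨h1, h2⟩ := quadFactor_ne_zero (left_ne_zero_of_mul hq)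
  rw [← hγ, degree_lidx, length_quadLeaves, momentum_quadLeaves]
  refine ⟨by omega, ⟨quadNodes q + 2, by ring⟩, h1⟩

theorem quadCoef_mul_prod (w : Phase a p) (q : Fin 4 → Ternary Mode) :
    quadCoef m I q * ((quadLeaves q).map (coord w)).prod =
      quadFactor I q * ∏ i, treeTerm m I w (q i) := by
  rw [prod_quadLeaves, quadCoef, mul_assoc]
  congr 1
  push_cast
  rw [← Finset.prod_mul_distrib]
  rfl

theorem monom_lidx (w : Phase a p) (J : List Mode) : monom w (lidx J) = (J.map (coord w)).prod :=
  prod_lidx (coord w) J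

theorem tsum_enorm_quad (ha : 0 < a) (hp : 1 / 2 < p) (hc : ∀ J, |symb m I J| ≤ c)
    {w : Phase a p} (hw : SmallPoint c w) :
    ∑' q, ‖quadCoef m I q * monom w (lidx (quadLeaves q))‖ₑ ≠ ⊤ := by
  simp_rw [monom_lidx, quadCoef_mul_prod]
  exact tsum_enorm_mul_ne_top (norm_quadFactor_le I)
    (tsum_pi_prod_ne_top fun _ => tsum_enorm_treeTerm ha hp hc hw)

theorem summable_remainder (ha : 0 < a) (hp : 1 / 2 < p) (hc : ∀ J, |symb m I J| ≤ c)
    {w : Phase a p} (hw : SmallPoint c w) :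
    Summable fun γ : MIdx => MvPowerSeries.coeff γ (remainder m I) * monom w γ := by
  classical
  have h := tsum_enorm_quad ha hp hc hw
  rw [tsum_fiber (fun q => lidx (quadLeaves q)) fun γ q => ‖quadCoef m I q * monom w γ‖ₑ] at h
  refine summable_of_tsum_enorm (ne_top_of_le_ne_top h (ENNReal.tsum_le_tsum fun γ => ?_))
  rw [coeff_remainder, ← tsum_mul_right]
  refine (enorm_tsum_le _).trans (ENNReal.tsum_le_tsum fun q => ?_)
  split_ifs <;> simp

theorem tsum_remainder (ha : 0 < a) (hp : 1 / 2 < p) (hc : ∀ J, |symb m I J| ≤ c)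
    {w : Phase a p} (hw : SmallPoint c w) :
    ∑' γ : MIdx, MvPowerSeries.coeff γ (remainder m I) * monom w γ =
      ∑' q, quadFactor I q * ∏ i, treeTerm m I w (q i) := by
  classical
  have h := tsum_fiber_of_enorm (fun q => lidx (quadLeaves q))
    (fun γ q => quadCoef m I q * monom w γ) (tsum_enorm_quad ha hp hc hw)
  simp only [monom_lidx, quadCoef_mul_prod] at h
  rw [h]
  refine tsum_congr fun γ => ?_
  rw [coeff_remainder, ← tsum_mul_right]
  exact tsum_congr fun q => by split_ifs <;> simp

theorem tsum_leaf_root (w : Phase a p) (s : Mode) :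
    ∑' t : Ternary Mode, (if t.root = s then (t.isLeaf : ℂ) * treeTerm m I w t else 0) =
      coord w s := by
  rw [tsum_eq_single (leaf s)]
  · simp [root, isLeaf, treeTerm, coef, leaves]
  · intro t ht
    cases t with
    | leaf s' =>
      rw [if_neg]
      rintro rfl
      exact ht rfl
    | node => simp [isLeaf]

theorem norm_isLeaf_le (t : Ternary Mode) : ‖(t.isLeaf : ℂ)‖ ≤ 1 := by
  rw [Complex.norm_real, Real.norm_of_nonneg (isLeaf_mem t).1]
  exact (isLeaf_mem t).2

theorem norm_two_sub_isLeaf_le (t : Ternary Mode) : ‖((2 - t.isLeaf : ℝ) : ℂ)‖ ≤ 2 := by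
  have h := isLeaf_mem t
  rw [Complex.norm_real, Real.norm_of_nonneg (by linarith)]
  linarith

/-- Weighting trees by `isLeaf` turns the expansion of `z` into that of `w`, and the weight `2 -
isLeaf` turns it into that of `2z - w`. The four quartic forms are thus sums over the same
quadruples of trees, and their factors add up to `quadFactor`. -/
theorem tsum_quadFactor (ha : 0 < a) (hp : 1 / 2 < p) (hc : ∀ J, |symb m I J| ≤ c)
    {w z y : Phase a p} (hw : SmallPoint c w) (hz : ∀ s, coord z s = treeSum m I w s)
    (hy : y = (2 : ℂ) • z - w) :
    ∑' q, quadFactor I q * ∏ i, treeTerm m I w (q i) =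
      quart ZeroMom y - quart ZeroMom w - quart (NonRes I) z + quart (NonRes I) w := by
  have hT := tsum_enorm_treeTerm ha hp hc hw
  have hL : ∑' t : Ternary Mode, ‖(t.isLeaf : ℂ) * treeTerm m I w t‖ₑ ≠ ⊤ :=
    tsum_enorm_mul_ne_top norm_isLeaf_le hT
  have hD : ∑' t : Ternary Mode, ‖((2 - t.isLeaf : ℝ) : ℂ) * treeTerm m I w t‖ₑ ≠ ⊤ :=
    tsum_enorm_mul_ne_top norm_two_sub_isLeaf_le hT
  have key : ∀ (P : (Fin 4 → Mode) → Prop) (f : Ternary Mode → ℂ) (x : Phase a p)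
      (_ : ∑' t, ‖f t‖ₑ ≠ ⊤) (_ : ∀ s, ∑' t, (if t.root = s then f t else 0) = coord x s),
      HasSum (fun q : Fin 4 → Ternary Mode => ind P (roots q) * ∏ i, f (q i)) (quart P x) := by
    intro P f x hf hx
    have h1 := tsum_comp_root (C := 1) (ind P) (norm_ind_le P) (f := fun _ : Fin 4 => f) fun _ => hf
    simp only [hx] at h1
    have h2 : ∑' q : Fin 4 → Ternary Mode, ‖ind P (roots q) * ∏ i, f (q i)‖ₑ ≠ ⊤ :=
      tsum_enorm_mul_ne_top (fun q => norm_ind_le P _) (tsum_pi_prod_ne_top fun _ => hf)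
    have h3 := (summable_of_tsum_enorm h2).hasSum
    change ∑' q : Fin 4 → Ternary Mode, ind P (roots q) * ∏ i, f (q i) = quart P x at h1
    rwa [h1] at h3
  have k1 := key ZeroMom _ y hD (fun s => by
    have e : ∀ t : Ternary Mode, (if t.root = s then ((2 - t.isLeaf : ℝ) : ℂ) * treeTerm m I w t else 0) =
        2 * (if t.root = s then treeTerm m I w t else 0) -
          (if t.root = s then (t.isLeaf : ℂ) * treeTerm m I w t else 0) := fun t => by
      split_ifs
      · push_cast; ring
      · ring
    simp_rw [e]
    rw [Summable.tsum_sub, tsum_mul_left, tsum_leaf_root, hy, coord_sub, coord_smul, hz]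
    · rfl
    · refine Summable.mul_left _ (summable_of_tsum_enorm (ne_top_of_le_ne_top hT
        (ENNReal.tsum_le_tsum fun t => ?_)))
      split_ifs <;> simp
    · refine summable_of_tsum_enorm (ne_top_of_le_ne_top hL (ENNReal.tsum_le_tsum fun t => ?_))
      split_ifs <;> simp)
  have k2 := key ZeroMom _ w hL (tsum_leaf_root w)
  have k3 := key (NonRes I) _ z hT fun s => (hz s).symm
  have k4 := key (NonRes I) _ w hL (tsum_leaf_root w)
  rw [← (((k1.sub k2).sub k3).add k4).tsum_eq]
  refine tsum_congr fun q => ?_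
  simp only [quadFactor, Finset.prod_mul_distrib]
  push_cast
  ring

/-- The image point is `2z - w`. The quadratic part changes by exactly `-G_nr(z)`, and `G - G_nr` at
`w` is `Ḡ + Ĝ`; the other quartic terms are the remainder. -/
theorem hamiltonian_halfStep (hm : 0 < m) (ha : 0 < a) (hp : 1 / 2 < p)
    (hc : ∀ J, |symb m I J| ≤ c) (hcd : ∀ J, NonRes I J → divisor m J ≠ 0) {w z : Phase a p}
    (hw : SmallPoint c w) (hzw : halfStep (triCLM m I ha hp hc) (-1) z = w)
    (hz : ∀ s, coord z s = treeSum m I w s) :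
    hamiltonian m (halfStep (triCLM m I ha hp hc) 1 z) = quadHam m w + Gbar I w + Ghat I w +
      ∑' γ : MIdx, MvPowerSeries.coeff γ (remainder m I) * monom w γ := by
  have h1 := quadHam_midpoint hm ha hp hc hcd z
  have h2 := Gbar_add_Ghat ha hp I w
  have hy : halfStep (triCLM m I ha hp hc) 1 z = (2 : ℂ) • z - w := by
    rw [← hzw, halfStep, halfStep, two_smul]
    push_cast
    module
  rw [tsum_remainder ha hp hc hw, tsum_quadFactor ha hp hc hw hz hy, hamiltonian_eq]
  rw [hzw] at h1
  linear_combination h1 - h2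

end remainder

/-! ### Reality -/

section reality

variable {a p : ℝ} {m : ℝ} {I : Finset ℤ} {c : ℝ}

theorem isRealPoint_iff (w : Phase a p) :
    IsRealPoint w ↔ ∀ s, coord w (cj s) = starRingEnd ℂ (coord w s) := by
  constructor
  · rintro h ⟨j, σ⟩
    rcases Int.units_eq_one_or σ with rfl | rfl
    · change coord w (j, -1) = _
      rw [coord_one, coord_neg_one, h]
    · change coord w (j, - -1) = _
      rw [neg_neg, coord_one, coord_neg_one, h, Complex.conj_conj]
  · intro h j
    have := h (j, 1)
    rwa [coord_one, show cj (j, 1) = (j, -1) from rfl, coord_neg_one] at this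

/-- Conjugating every mode changes the sign of the divisor and the outer sign of the component; the
two changes cancel, so the field commutes with complex conjugation. -/
theorem fieldCoeff_cj (s : Mode) (J : Fin 3 → Mode) :
    fieldCoeff m I (cj s) (cj ∘ J) = fieldCoeff m I s J := by
  have h : Matrix.vecCons (cj (cj s)) (cj ∘ J) = cj ∘ Matrix.vecCons (cj s) J := by
    funext i
    refine Fin.cases ?_ (fun j => ?_) i <;> simp
  rw [fieldCoeff, fieldCoeff, h, symb_cj]
  simp [cj]

theorem triComp_conj {z z' : Phase a p} (h : ∀ s, coord z' (cj s) = starRingEnd ℂ (coord z s))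
    (s : Mode) : triComp m I (cj s) (fun _ => z') =
      starRingEnd ℂ (triComp m I s fun _ => z) := by
  unfold triComp
  rw [Complex.conj_tsum, ← (Equiv.arrowCongr (Equiv.refl (Fin 3)) cjEquiv).tsum_eq]
  refine tsum_congr fun J => ?_
  have e : (Equiv.arrowCongr (Equiv.refl (Fin 3)) cjEquiv) J = cj ∘ J := rfl
  rw [e, fieldCoeff_cj, map_mul, map_prod, Complex.conj_ofReal]
  simp only [Function.comp, h]

theorem exists_conj (z : Phase a p) :
    ∃ z' : Phase a p, ‖z'‖ = ‖z‖ ∧ ∀ s, coord z' (cj s) = starRingEnd ℂ (coord z s) := by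
  have hn : ∀ x : Ell a p, enorm2 a p (fun l => ‖starRingEnd ℂ (x l)‖ₑ) = ‖x‖ₑ := fun x => by
    rw [← enorm2_enorm]
    congr 1
    funext l
    rw [← ofReal_norm, RCLike.norm_conj, ofReal_norm]
  have hlt : ∀ x : Ell a p, enorm2 a p (fun l => ‖starRingEnd ℂ (x l)‖ₑ) < ⊤ := fun x => by
    rw [hn]; exact enorm_lt_top
  have hnorm : ∀ x : Ell a p, ‖Ell.mk _ (hlt x)‖ = ‖x‖ := fun x => by
    have h1 := enorm2_enorm (Ell.mk _ (hlt x))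
    have h2 := hn x
    have h3 : ‖Ell.mk _ (hlt x)‖ₑ = ‖x‖ₑ := h1.symm.trans h2
    rw [← toReal_enorm, h3, toReal_enorm]
  refine ⟨(Ell.mk _ (hlt z.2), Ell.mk _ (hlt z.1)), ?_, ?_⟩
  · rw [Prod.norm_def, Prod.norm_def, hnorm, hnorm, max_comm]
  · rintro ⟨j, σ⟩
    rcases Int.units_eq_one_or σ with rfl | rfl
    · change coord _ (j, -1) = _
      rw [coord_one, coord_neg_one]; rfl
    · change coord _ (j, - -1) = _
      rw [neg_neg, coord_one, coord_neg_one]; rfl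

/-- If `w` is real, then the conjugate of the midpoint solves the same equation in the same ball, so
by uniqueness the midpoint is real, and with it the image. -/
theorem isRealPoint_halfStep (ha : 0 < a) (hp : 1 / 2 < p) (hc : ∀ J, |symb m I J| ≤ c)
    {ρ : ℝ} (h : 9 * ‖triCLM (a := a) m I ha hp hc‖ * ρ ^ 2 ≤ 2) {z w : Phase a p} (hz : ‖z‖ ≤ ρ)
    (he : halfStep (triCLM m I ha hp hc) (-1) z = w) (hw : IsRealPoint w) :
    IsRealPoint (halfStep (triCLM m I ha hp hc) 1 z) := by
  obtain ⟨z', hn, hz'⟩ := exists_conj z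
  have hstep : ∀ σ s, coord (halfStep (triCLM m I ha hp hc) σ z') (cj s) =
      starRingEnd ℂ (coord (halfStep (triCLM m I ha hp hc) σ z) s) := by
    intro σ s
    simp only [halfStep, coord_add, coord_smul, cubic, coord_triCLM, triComp_conj hz', hz', map_add,
      map_mul]
    rw [map_div₀, map_ofNat, map_intCast]
  rw [isRealPoint_iff] at hw
  have he' : halfStep (triCLM m I ha hp hc) (-1) z' = w := by
    refine Phase.ext fun s => ?_
    rw [← cj_cj s, hstep, he, ← hw]
  have heq : z = z' := halfStep_injOn h (-1) hz (hn ▸ hz) (he.trans he'.symm)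
  rw [isRealPoint_iff]
  intro s
  have := hstep 1 s
  rwa [← heq] at this

end reality

end DNLW
end


noncomputable section

namespace DNLW

open Ternary

/-! ### Majorant norms -/

section majorant

variable {a p : ℝ}

theorem enorm_coeff_hamField (f : Series) (s : Mode) (γ : MIdx) :
    ‖MvPowerSeries.coeff γ (hamField f s)‖ₑ =
      ‖MvPowerSeries.coeff (γ + Finsupp.single (cj s) 1) f‖ₑ * ((γ (cj s) + 1 : ℕ) : ℝ≥0∞) := by
  have h1 : ‖-(((s.2 : ℤ) : ℂ) * Complex.I)‖ₑ = 1 := by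
    rw [enorm_neg, enorm_mul]
    rcases Int.units_eq_one_or s.2 with h | h <;> simp [h, ← ofReal_norm]
  have h2 : ‖((γ (cj s) : ℂ) + 1)‖ₑ = ((γ (cj s) + 1 : ℕ) : ℝ≥0∞) := by
    rw [← Nat.cast_succ, ← ofReal_norm, Complex.norm_natCast, ENNReal.ofReal_natCast]
  change ‖MvPowerSeries.coeff γ (_ • MvPowerSeries.pderiv ℂ (cj s) f)‖ₑ = _
  rw [MvPowerSeries.coeff_smul, enorm_mul, h1, one_mul, MvPowerSeries.coeff_pderiv, enorm_mul, h2]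

/-- By `ord_succ` the exponent created by the derivative becomes the degree, so the majorant depends
on each monomial only through its degree and its number of orderings. Summing over orderings then
gives `momSum`s. -/
theorem tsum_hamField_le {f : Series} {h : ℤ} {B : ℕ → ℝ≥0∞}
    (hB : ∀ γ, ‖MvPowerSeries.coeff γ f‖ₑ ≤ B γ.degree * ord γ)
    (hf : ∀ γ, MvPowerSeries.coeff γ f ≠ 0 → momentum γ = h) (x : Mode → ℝ≥0∞) (s : Mode) :
    ∑' γ : MIdx, ‖MvPowerSeries.coeff γ (hamField f s)‖ₑ * emonom x γ ≤
      ∑' n : ℕ, ((n + 1 : ℕ) : ℝ≥0∞) * B (n + 1) * momSum (fun _ : Fin n => x) (h + mo s) := by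
  rw [← tsum_ord_momSum fun n => ((n + 1 : ℕ) : ℝ≥0∞) * B (n + 1)]
  refine ENNReal.tsum_le_tsum fun γ => ?_
  rw [enorm_coeff_hamField]
  set γ' := γ + Finsupp.single (cj s) 1 with hγ'
  by_cases h0 : MvPowerSeries.coeff γ' f = 0
  · rw [h0]; simp
  have hm : momentum γ = h + mo s := by
    have := hf γ' h0
    rw [hγ', momentum_add, momentum_single, mo_cj] at this
    omega
  have hdeg : γ'.degree = γ.degree + 1 := by rw [hγ', map_add, Finsupp.degree_single]
  rw [if_pos hm]
  calc _ ≤ B γ'.degree * ord γ' * ((γ (cj s) + 1 : ℕ) : ℝ≥0∞) * emonom x γ := by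
        gcongr; exact hB γ'
    _ = B (γ.degree + 1) * (((γ (cj s) + 1 : ℕ) : ℝ≥0∞) * ord γ') * emonom x γ := by
        rw [hdeg]; ring
    _ = B (γ.degree + 1) * (((γ.degree + 1 : ℕ) : ℝ≥0∞) * ord γ) * emonom x γ := by
        rw [hγ', ord_succ]
    _ = _ := by ring

/-- The bound of the coefficients of a series by the number of lists of modes, the degrees being
at least `d`. -/
def OrdBound (f : Series) (d : ℕ) (B Y : ℝ≥0∞) : Prop :=
  ∀ γ, ‖MvPowerSeries.coeff γ f‖ₑ ≤ (if d ≤ γ.degree then B * Y ^ γ.degree else 0) * ord γ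

theorem OrdBound.tsum_hamField_le {f : Series} {h : ℤ} {d : ℕ} {B Y : ℝ≥0∞} (hB : OrdBound f d B Y)
    (hf : ∀ γ, MvPowerSeries.coeff γ f ≠ 0 → momentum γ = h) (x : Mode → ℝ≥0∞) (s : Mode) :
    ∑' γ : MIdx, ‖MvPowerSeries.coeff γ (hamField f s)‖ₑ * emonom x γ ≤
      ∑' n : ℕ, ((n + 1 : ℕ) : ℝ≥0∞) * (if d ≤ n + 1 then B * Y ^ (n + 1) else 0) *
        momSum (fun _ : Fin n => x) (h + mo s) :=
  DNLW.tsum_hamField_le (B := fun n => if d ≤ n then B * Y ^ n else 0) hB hf x s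

/-- The ratio of the geometric series that bounds the norms. -/
def ratio (p : ℝ) (Y : ℝ≥0∞) (r : ℝ) : ℝ≥0∞ := 4 * Y * max (algConst p) 1 * ENNReal.ofReal r

theorem tsum_geometric_tail {Q : ℝ≥0∞} (hQ : Q ≤ 2⁻¹) (k : ℕ) :
    ∑' n : ℕ, (if k ≤ n then Q ^ n else 0) ≤ 2 * Q ^ k := by
  have h1 : ∑' n : ℕ, Q ^ n ≤ 2 := by
    rw [ENNReal.tsum_geometric, ENNReal.inv_le_iff_inv_le]
    have h2 : (1 : ℝ≥0∞) - 2⁻¹ = 2⁻¹ := ENNReal.one_sub_inv_two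
    calc (2 : ℝ≥0∞)⁻¹ = 1 - 2⁻¹ := h2.symm
      _ ≤ 1 - Q := tsub_le_tsub_left hQ 1
  have hinj : Function.Injective fun n : ℕ => n + k := fun n n' h => by simpa using h
  have h3 : ∑' n : ℕ, (if k ≤ n then Q ^ n else 0) = ∑' n : ℕ, Q ^ (n + k) := by
    rw [← hinj.tsum_eq]
    · exact tsum_congr fun n => by simp
    · intro n hn
      by_cases h : k ≤ n
      · exact ⟨n - k, by simp [h]⟩
      · simp [h] at hn
  rw [h3]
  simp_rw [pow_add]
  rw [ENNReal.tsum_mul_right]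
  gcongr

theorem natCast_succ_le_two_pow (n : ℕ) : ((n + 1 : ℕ) : ℝ≥0∞) ≤ 2 ^ n := by
  exact_mod_cast Nat.lt_two_pow_self (n := n)

/-- With `n + 1 ≤ 2^n` and `y ≤ 2r` the term of order `n` is a geometric one; these two factors `2`
are the `4` in `ratio`. -/
theorem tsum_ordBound_le {d : ℕ} {B Y y : ℝ≥0∞} {r : ℝ}
    (hQ : ratio p Y r ≤ 2⁻¹) (hy : y ≤ 2 * ENNReal.ofReal r) :
    ∑' n : ℕ, ((n + 1 : ℕ) : ℝ≥0∞) * (if d + 2 ≤ n + 1 then B * Y ^ (n + 1) else 0) *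
      (algConst p ^ (n - 1) * y ^ n) ≤ 2 * (B * Y) * ratio p Y r ^ (d + 1) := by
  calc _ ≤ ∑' n : ℕ, B * Y * (if d + 1 ≤ n then ratio p Y r ^ n else 0) := by
        refine ENNReal.tsum_le_tsum fun n => ?_
        by_cases h : d + 1 ≤ n
        · rw [if_pos h, if_pos (by omega)]
          have hA : algConst p ^ (n - 1) ≤ max (algConst p) 1 ^ n :=
            (pow_le_pow_left₀ bot_le (le_max_left _ 1) _).trans
              (pow_le_pow_right₀ (le_max_right _ _) (Nat.sub_le n 1))
          calc _ ≤ 2 ^ n * (B * Y ^ (n + 1)) * (max (algConst p) 1 ^ n * (2 * ENNReal.ofReal r) ^ n) := by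
                gcongr
                exact natCast_succ_le_two_pow n
            _ = _ := by
                rw [ratio, show (4 : ℝ≥0∞) = 2 * 2 by norm_num]
                simp only [mul_pow, pow_succ]
                ring
        · rw [if_neg h, if_neg (by omega)]
          simp
    _ ≤ _ := by
        rw [ENNReal.tsum_mul_left]
        calc _ ≤ B * Y * (2 * ratio p Y r ^ (d + 1)) := by gcongr; exact tsum_geometric_tail hQ _
          _ = _ := by ring

theorem enorm2_fold_le_of_mem_bidisc {r : ℝ} {w : Phase a p} (hw : w ∈ bidisc a p r) :
    enorm2 a p (fold (ecoord w)) ≤ 2 * ENNReal.ofReal r := by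
  refine (enorm2_fold_ecoord w).trans ?_
  rw [two_mul]
  have h1 := (mem_ball_zero_iff.1 hw.1).le
  have h2 := (mem_ball_zero_iff.1 hw.2).le
  rw [← ofReal_norm, ← ofReal_norm]
  exact add_le_add (ENNReal.ofReal_le_ofReal h1) (ENNReal.ofReal_le_ofReal h2)

theorem enorm2_ordBound_le (ha : 0 < a) (hp : 1 / 2 < p) {d : ℕ} {B Y : ℝ≥0∞} {r : ℝ}
    (hQ : ratio p Y r ≤ 2⁻¹) {w : Phase a p} (hw : w ∈ bidisc a p r) :
    enorm2 a p (fun k => ∑' n : ℕ, ((n + 1 : ℕ) : ℝ≥0∞) *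
      (if d + 2 ≤ n + 1 then B * Y ^ (n + 1) else 0) * momSum (fun _ : Fin n => ecoord w) k) ≤
      2 * (B * Y) * ratio p Y r ^ (d + 1) :=
  (enorm2_tsum_momSum_le (b := fun n => ((n + 1 : ℕ) : ℝ≥0∞) *
    (if d + 2 ≤ n + 1 then B * Y ^ (n + 1) else 0)) ha (by linarith) _ (by simp)).trans
    (tsum_ordBound_le hQ (enorm2_fold_le_of_mem_bidisc hw))

theorem majorantNorm_eq (r : ℝ) (X : Mode → Series) : majorantNorm a p r X =
    ⨆ w ∈ bidisc a p r, (∑ σ : ℤˣ, enorm2 a p (fun l => ∑' γ : MIdx,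
      ‖MvPowerSeries.coeff γ (X (l, σ))‖ₑ * emonom (ecoord w) γ)) / ENNReal.ofReal r := rfl

/-- Momentum preserving series of degree at least `d + 2` with bounded coefficients. -/
theorem majorantNorm_le (ha : 0 < a) (hp : 1 / 2 < p) {f : Series} {d : ℕ} {B Y : ℝ≥0∞}
    (hB : OrdBound f (d + 2) B Y) (hf : ∀ γ, MvPowerSeries.coeff γ f ≠ 0 → momentum γ = 0) {r : ℝ}
    (hQ : ratio p Y r ≤ 2⁻¹) :
    majorantNorm a p r (hamField f) ≤ 4 * (B * Y) * (4 * Y * max (algConst p) 1) ^ (d + 1) *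
      ENNReal.ofReal r ^ d := by
  rw [majorantNorm_eq]
  refine iSup₂_le fun w hw => ?_
  refine ENNReal.div_le_of_le_mul ?_
  have key : ∀ σ : ℤˣ, enorm2 a p (fun l => ∑' γ : MIdx,
      ‖MvPowerSeries.coeff γ (hamField f (l, σ))‖ₑ * emonom (ecoord w) γ) ≤
      2 * (B * Y) * ratio p Y r ^ (d + 1) := by
    intro σ
    refine le_trans ?_ (enorm2_ordBound_le ha hp hQ hw)
    rcases Int.units_eq_one_or σ with rfl | rfl
    · refine enorm2_mono fun l => (hB.tsum_hamField_le hf _ _).trans (le_of_eq ?_)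
      simp [mo]
    · rw [← enorm2_neg]
      refine enorm2_mono fun l => (hB.tsum_hamField_le hf _ _).trans (le_of_eq ?_)
      simp [mo]
  calc _ ≤ ∑ σ : ℤˣ, 2 * (B * Y) * ratio p Y r ^ (d + 1) := Finset.sum_le_sum fun σ _ => key σ
    _ = 4 * (B * Y) * ratio p Y r ^ (d + 1) := by
        rw [Finset.sum_const, Finset.card_univ, Fintype.card_units_int, nsmul_eq_mul]
        push_cast
        ring
    _ = _ := by
        rw [ratio]
        ring

theorem one_le_weight (ha : 0 < a) (hp : 0 < p) (l : ℤ) : 1 ≤ weight a p l :=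
  one_le_mul_of_one_le_of_one_le (Real.one_le_exp (by positivity))
    (Real.one_le_rpow (le_max_left _ _) (by linarith))

theorem le_enorm2 (ha : 0 < a) (hp : 0 < p) (f : ℤ → ℝ≥0∞) (l : ℤ) : f l ≤ enorm2 a p f := by
  apply le_of_sq_le_sq'
  rw [enorm2_sq]
  refine le_trans ?_ (ENNReal.le_tsum l)
  refine le_mul_of_one_le_right' ?_
  rw [eweight, ← ENNReal.ofReal_one]
  exact ENNReal.ofReal_le_ofReal (one_le_weight ha hp l)

/-- Series of finitely many components. -/
theorem mRegular_of_finite (ha : 0 < a) (hp : 1 / 2 < p) {f : Series} {h : ℤ} {d : ℕ} {B Y : ℝ≥0∞}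
    (hBt : B ≠ ⊤) (hYt : Y ≠ ⊤) (hB : OrdBound f (d + 2) B Y)
    (hf : ∀ γ, MvPowerSeries.coeff γ f ≠ 0 → momentum γ = h) {M : ℕ}
    (hM : ∀ γ, MvPowerSeries.coeff γ f ≠ 0 → ∀ s ∈ γ.support, |s.1| ≤ M) {r : ℝ}
    (hr : 0 < r) (hQ : ratio p Y r ≤ 2⁻¹) : MRegular a p r f := by
  set V : ℝ≥0∞ := 2 * (B * Y) * ratio p Y r ^ (d + 1)
  have hV : V ≠ ⊤ := by
    have : ratio p Y r ≠ ⊤ := ne_top_of_le_ne_top (by simp) hQ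
    exact ENNReal.mul_ne_top (ENNReal.mul_ne_top (by simp) (ENNReal.mul_ne_top hBt hYt))
      (ENNReal.pow_ne_top this)
  -- For non-zero momentum the convolution bound refers to a translated sequence, and translations
  -- change the weight. As only the components with `|l| ≤ M` are non-zero, a uniform bound of each
  -- of them is enough for finiteness.
  set T : ℝ≥0∞ := (∑ l ∈ Finset.Icc (-(M : ℤ)) M, V ^ 2 * eweight a p l) ^ (1 / 2 : ℝ)
  have hT : T ≠ ⊤ := by
    refine (ENNReal.rpow_lt_top_of_nonneg (by norm_num) ?_).ne
    refine (ENNReal.sum_ne_top.2 fun l _ => ENNReal.mul_ne_top (ENNReal.pow_ne_top hV) ?_)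
    exact ENNReal.ofReal_ne_top
  refine lt_of_le_of_lt (b := 2 * T / ENNReal.ofReal r) ?_ ?_
  · rw [majorantNorm_eq]
    refine iSup₂_le fun w hw => ?_
    refine ENNReal.div_le_div_right ?_ _
    have key : ∀ σ : ℤˣ, enorm2 a p (fun l => ∑' γ : MIdx,
        ‖MvPowerSeries.coeff γ (hamField f (l, σ))‖ₑ * emonom (ecoord w) γ) ≤ T := by
      intro σ
      refine ENNReal.rpow_le_rpow ?_ (by norm_num)
      have hz : ∀ l ∉ Finset.Icc (-(M : ℤ)) M, (∑' γ : MIdx,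
          ‖MvPowerSeries.coeff γ (hamField f (l, σ))‖ₑ * emonom (ecoord w) γ) = 0 := by
        intro l hl
        rw [ENNReal.tsum_eq_zero]
        intro γ
        rw [enorm_coeff_hamField]
        by_cases h0 : MvPowerSeries.coeff (γ + Finsupp.single (cj (l, σ)) 1) f = 0
        · rw [h0]; simp
        · exfalso
          have := hM _ h0 (cj (l, σ)) (by simp)
          rw [abs_le] at this
          exact hl (Finset.mem_Icc.2 this)
      rw [tsum_eq_sum fun l hl => by simp only [hz l hl]; simp]
      refine Finset.sum_le_sum fun l _ => ?_
      gcongr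
      exact (hB.tsum_hamField_le hf _ _).trans ((le_enorm2 ha (by linarith) _ _).trans
        (enorm2_ordBound_le ha hp hQ hw))
    calc _ ≤ ∑ σ : ℤˣ, T := Finset.sum_le_sum fun σ _ => key σ
      _ = _ := by
        rw [Finset.sum_const, Finset.card_univ, Fintype.card_units_int, nsmul_eq_mul]
        push_cast
        ring
  · refine ENNReal.div_lt_top (ENNReal.mul_ne_top (by simp) hT) ?_
    simpa using hr

end majorant

/-! ### Counting quadruples of trees -/

section counting

theorem quadLeaves_eq {α : Type} (q : Fin 4 → Ternary α) : quadLeaves q =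
    (q 0).leaves ++ ((q 1).leaves ++ ((q 2).leaves ++ (q 3).leaves)) := by
  simp [quadLeaves, List.ofFn_succ]

theorem quad_ext_of_shape {α : Type} {q q' : Fin 4 → Ternary α}
    (h : ∀ i, (q i).map (fun _ => ()) = (q' i).map (fun _ => ()))
    (hl : quadLeaves q = quadLeaves q') : q = q' := by
  have l : ∀ i, (q i).leaves.length = (q' i).leaves.length := fun i => by
    rw [length_leaves, length_leaves, ← nodes_map (fun _ => ()) (q i), h, nodes_map]
  rw [quadLeaves_eq, quadLeaves_eq] at hl
  obtain ⟨h0, hl⟩ := List.append_inj hl (l 0)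
  obtain ⟨h1, hl⟩ := List.append_inj hl (l 1)
  obtain ⟨h2, h3⟩ := List.append_inj hl (l 2)
  funext i
  refine ext_of_shape (h i) ?_
  fin_cases i
  exacts [h0, h1, h2, h3]

theorem quadNodes_map {α β : Type} (f : α → β) (q : Fin 4 → Ternary α) :
    quadNodes (fun i => (q i).map f) = quadNodes q := by
  simp [quadNodes, nodes_map]

-- The generating function evaluated at one point: give every leaf the weight `x = 1/Y`, where `Y =
-- 4(1 + C)` ensures `16 C x² ≤ 1`. The sum over trees is then at most `2x ≤ 2`, and its fourth
-- power gives the `16`.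
open Classical in
theorem tsum_shapes_le (C : ℝ≥0∞) (hC : C ≠ ⊤) (n : ℕ) :
    ∑' s : Fin 4 → Ternary Unit, (if 2 * quadNodes s + 4 = n then C ^ quadNodes s else 0) ≤
      16 * (4 * (1 + C)) ^ n := by
  set Y := 4 * (1 + C)
  have hY0 : Y ≠ 0 := by simp [Y]
  have hYt : Y ≠ ⊤ := ENNReal.mul_ne_top (by simp) (by simp [hC])
  set x := Y⁻¹
  have hxY : x * Y = 1 := ENNReal.inv_mul_cancel hY0 hYt
  have hx1 : x ≤ 1 := by
    rw [ENNReal.inv_le_one]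
    calc (1 : ℝ≥0∞) ≤ 4 * 1 := by norm_num
      _ ≤ Y := by simp only [Y]; gcongr; exact le_self_add
  have hsmall : 16 * C * (∑' _ : Unit, x) ^ 2 ≤ 1 := by
    rw [tsum_fintype, Fintype.sum_unique]
    calc 16 * C * x ^ 2 ≤ Y ^ 2 * x ^ 2 := by
          gcongr
          calc 16 * C ≤ 16 * (1 + C) ^ 2 := by
                gcongr
                calc C ≤ 1 + C := le_add_self
                  _ = (1 + C) * 1 := by ring
                  _ ≤ (1 + C) ^ 2 := by rw [pow_two]; gcongr; exact le_self_add
            _ = _ := by simp only [Y, mul_pow]; norm_num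
      _ = 1 := by rw [← mul_pow, mul_comm Y, hxY, one_pow]
  have h1 := tsum_weight_le (α := Unit) hsmall
  rw [tsum_fintype (L := SummationFilter.unconditional Unit), Fintype.sum_unique] at h1
  set g : Ternary Unit → ℝ≥0∞ := fun t => C ^ t.nodes * (t.leaves.map fun _ => x).prod
  have hg : ∀ s : Fin 4 → Ternary Unit, ∏ i, g (s i) = C ^ quadNodes s * x ^ (2 * quadNodes s + 4) := by
    intro s
    simp only [g]
    rw [Finset.prod_mul_distrib, Finset.prod_pow_eq_pow_sum, ← prod_quadLeaves, List.map_const',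
      List.prod_replicate, length_quadLeaves]
    rfl
  calc _ ≤ ∑' s : Fin 4 → Ternary Unit, Y ^ n * ∏ i, g (s i) := by
        refine ENNReal.tsum_le_tsum fun s => ?_
        split_ifs with h
        · rw [hg, h, mul_left_comm, ← mul_pow, mul_comm Y, hxY, one_pow, mul_one]
        · exact bot_le
    _ = Y ^ n * (∑' t, g t) ^ 4 := by
        rw [ENNReal.tsum_mul_left, tsum_pi_prod (fun _ => g)]
        simp
    _ ≤ Y ^ n * (2 * 1) ^ 4 := by gcongr; exact h1.trans (by gcongr)
    _ = _ := by norm_num; ring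

open Classical in
/-- The weighted number of quadruples of trees with given leaves. -/
theorem tsum_quad_le (C : ℝ≥0∞) (hC : C ≠ ⊤) (γ : MIdx) :
    ∑' q : Fin 4 → Ternary Mode, (if lidx (quadLeaves q) = γ then C ^ quadNodes q else 0) ≤
      16 * (4 * (1 + C)) ^ γ.degree * ord γ := by
  have h := tsum_shape_list_le (Q := Fin 4 → Ternary Mode) quadLeaves
    (fun q i => (q i).map fun _ => ()) (fun s => 2 * quadNodes s + 4)
    (fun q => by rw [length_quadLeaves, quadNodes_map]) (fun q q' h => by
      simp only [Prod.mk.injEq] at h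
      exact quad_ext_of_shape (congrFun h.1) h.2) (fun s => C ^ quadNodes s)
    (fun L => if lidx L = γ then 1 else 0)
  refine le_trans (le_of_eq ?_) (h.trans ?_)
  · refine tsum_congr fun q => ?_
    rw [quadNodes_map, ite_mul, one_mul, zero_mul]
  · rw [ord, ← ENNReal.tsum_mul_left]
    refine ENNReal.tsum_le_tsum fun L => ?_
    by_cases hL : lidx L = γ
    · rw [if_pos hL, one_mul, mul_one, ← hL, degree_lidx]
      exact tsum_shapes_le C hC _
    · rw [if_neg hL]; simp

theorem ord_ne_top (γ : MIdx) : ord γ ≠ ⊤ := by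
  classical
  induction γ using Finsupp.induction with
  | zero =>
    rw [ord, tsum_eq_single [], if_pos lidx_nil]
    · simp
    · intro L hL
      rw [if_neg]
      intro h
      have := congrArg Finsupp.degree h
      rw [degree_lidx] at this
      exact hL (List.eq_nil_of_length_eq_zero (by simpa using this))
  | single_add s k γ _ _ ih =>
    clear * - ih
    induction k with
    | zero => simpa using ih
    | succ k ihk =>
      have e : Finsupp.single s (k + 1) + γ = Finsupp.single s k + γ + Finsupp.single s 1 := by
        rw [Finsupp.single_add]; abel
      rw [e]
      exact ne_top_of_le_ne_top (ENNReal.mul_ne_top (by simp) ihk) (ord_add_single_le _ s)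

variable {m : ℝ} {I : Finset ℤ} {c : ℝ}

theorem abs_prod_coef_le (hc : ∀ J, |symb m I J| ≤ c) (q : Fin 4 → Ternary Mode) :
    |∏ i, (q i).coef m I| ≤ (2 * c) ^ quadNodes q := by
  rw [Finset.abs_prod, quadNodes, ← Finset.prod_pow_eq_pow_sum]
  exact Finset.prod_le_prod (fun i _ => abs_nonneg _) fun i _ => abs_coef_le hc (q i)

/-- The trees by themselves only need `2c` per node. The slack up to `4c` lets differences of
coefficients, which carry a factor `quadNodes q ≤ 2 ^ quadNodes q`, share the same growth constant.
-/
theorem enorm_quadCoef_le (hc : ∀ J, |symb m I J| ≤ c) (q : Fin 4 → Ternary Mode) :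
    ‖quadCoef m I q‖ₑ ≤ 17 * ENNReal.ofReal (4 * c) ^ quadNodes q := by
  have hc0 : 0 ≤ c := (abs_nonneg _).trans (hc fun _ => (0, 1))
  rw [← ENNReal.ofReal_pow (by positivity), ← ENNReal.ofReal_ofNat,
    ← ENNReal.ofReal_mul (by norm_num), ← ofReal_norm]
  refine ENNReal.ofReal_le_ofReal ?_
  rw [quadCoef, norm_mul, Complex.norm_real]
  refine mul_le_mul (norm_quadFactor_le I q) ?_ (norm_nonneg _) (by norm_num)
  exact (abs_prod_coef_le hc q).trans (pow_le_pow_left₀ (by positivity) (by linarith) _)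

/-- The growth constant of the coefficients of the remainder. -/
def growth (c : ℝ) : ℝ≥0∞ := 4 * (1 + ENNReal.ofReal (4 * c))

theorem growth_ne_top (c : ℝ) : growth c ≠ ⊤ :=
  ENNReal.mul_ne_top (by simp) (ENNReal.add_ne_top.2 ⟨by simp, ENNReal.ofReal_ne_top⟩)

open Classical in
theorem tsum_quad_growth_le (c : ℝ) (V : ℝ≥0∞) (γ : MIdx) :
    ∑' q : Fin 4 → Ternary Mode, (if lidx (quadLeaves q) = γ then
      V * ENNReal.ofReal (4 * c) ^ quadNodes q else 0) ≤ V * 16 * growth c ^ γ.degree * ord γ := by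
  have h := tsum_quad_le (ENNReal.ofReal (4 * c)) ENNReal.ofReal_ne_top γ
  calc _ = V * ∑' q : Fin 4 → Ternary Mode, (if lidx (quadLeaves q) = γ then
        ENNReal.ofReal (4 * c) ^ quadNodes q else 0) := by
        rw [← ENNReal.tsum_mul_left]
        exact tsum_congr fun q => by rw [mul_ite, mul_zero]
    _ ≤ V * (16 * growth c ^ γ.degree * ord γ) := by gcongr; exact h
    _ = _ := by ring

open Classical in
theorem tsum_enorm_quadCoef_le (hc : ∀ J, |symb m I J| ≤ c) (γ : MIdx) :
    ∑' q : Fin 4 → Ternary Mode, ‖if lidx (quadLeaves q) = γ then quadCoef m I q else 0‖ₑ ≤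
      272 * growth c ^ γ.degree * ord γ := by
  refine (ENNReal.tsum_le_tsum fun q => ?_).trans ((tsum_quad_growth_le c 17 γ).trans
    (le_of_eq (by norm_num)))
  split_ifs
  · exact enorm_quadCoef_le hc q
  · simp

theorem ordBound_remainder (hc : ∀ J, |symb m I J| ≤ c) :
    OrdBound (remainder m I) 6 272 (growth c) := by
  classical
  intro γ
  by_cases h0 : MvPowerSeries.coeff γ (remainder m I) = 0
  · rw [h0]; simp
  · rw [if_pos (coeff_remainder_ne_zero h0).1, coeff_remainder]
    exact (enorm_tsum_le _).trans (tsum_enorm_quadCoef_le hc γ)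

end counting

end DNLW
end


noncomputable section

namespace DNLW

open Ternary

/-! ### Displacement of a pair of high modes -/

section displacement

/-- Two high modes `s`, `s'` of nearly opposite momenta, and two such modes `t`, `t'` with the same
signs and the same total momentum. -/
structure HighPair (N : ℝ) (δ : ℤ) (ε : ℤˣ) (s s' t t' : Mode) : Prop where
  pos : 0 < N
  sign : s.2 = t.2
  sign' : s'.2 = t'.2
  mom : mo t = mo s + δ
  mom' : mo t' = mo s' - δ
  high : 2 * N < ((ε : ℤ) : ℝ) * mo s
  high' : 2 * N < -(((ε : ℤ) : ℝ) * mo s')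
  hight : 2 * N < ((ε : ℤ) : ℝ) * mo t
  hight' : 2 * N < -(((ε : ℤ) : ℝ) * mo t')
  near : |(mo s + mo s' : ℝ)| ≤ N / 8

/-- The permutation of the modes that exchanges `s` with `t` and `s'` with `t'`. -/
def displace (s s' t t' : Mode) : Equiv.Perm Mode := (Equiv.swap s' t').trans (Equiv.swap s t)

variable {N : ℝ} {δ : ℤ} {ε : ℤˣ} {s s' t t' : Mode}

theorem abs_unit_mul (ε : ℤˣ) (x : ℝ) : |((ε : ℤ) : ℝ) * x| = |x| := by
  rw [abs_mul, abs_unit, one_mul]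

namespace HighPair

variable (h : HighPair N δ ε s s' t t')

include h

theorem ne : s ≠ s' := by
  rintro rfl
  have := h.high; have := h.high'; have := h.pos
  linarith

theorem ne_left : s ≠ t' := by
  rintro rfl
  have := h.high; have := h.hight'; have := h.pos
  linarith

theorem ne_target : t ≠ t' := by
  rintro rfl
  have := h.hight; have := h.hight'; have := h.pos
  linarith

theorem displace_fst : displace s s' t t' s = t := by
  rw [displace, Equiv.trans_apply, Equiv.swap_apply_of_ne_of_ne h.ne h.ne_left,
    Equiv.swap_apply_left]

theorem displace_snd : displace s s' t t' s' = t' := by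
  rw [displace, Equiv.trans_apply, Equiv.swap_apply_left,
    Equiv.swap_apply_of_ne_of_ne h.ne_left.symm h.ne_target.symm]

theorem displace_low {u : Mode} (hu : |(mo u : ℝ)| ≤ N) : displace s s' t t' u = u := by
  have key : ∀ v : Mode, 2 * N < |(mo v : ℝ)| → u ≠ v := by
    rintro v hv rfl
    have := h.pos
    linarith
  have k1 : ∀ x : ℝ, 2 * N < ((ε : ℤ) : ℝ) * x → 2 * N < |x| := fun x hx => by
    rw [← abs_unit_mul ε]; exact hx.trans_le (le_abs_self _)
  have k2 : ∀ x : ℝ, 2 * N < -(((ε : ℤ) : ℝ) * x) → 2 * N < |x| := fun x hx => by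
    rw [← abs_unit_mul ε]; exact hx.trans_le (neg_le_abs _)
  rw [displace, Equiv.trans_apply,
    Equiv.swap_apply_of_ne_of_ne (key _ (k2 _ h.high')) (key _ (k2 _ h.hight')),
    Equiv.swap_apply_of_ne_of_ne (key _ (k1 _ h.high)) (key _ (k1 _ h.hight))]

end HighPair

/-- The size of the low modes. -/
def lowWeight (s s' : Mode) (u : Mode) : ℝ := if u = s ∨ u = s' then 0 else |(u.1 : ℝ)|

theorem lowWeight_nonneg (s s' u : Mode) : 0 ≤ lowWeight s s' u := by
  unfold lowWeight; split_ifs <;> positivity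

/-- Lists with at most one occurrence of each high mode, all the other modes being low. -/
structure FewHigh (N : ℝ) (s s' : Mode) (L : List Mode) : Prop where
  low : (L.map (lowWeight s s')).sum ≤ N / 8
  fst : L.count s ≤ 1
  snd : L.count s' ≤ 1

theorem lowWeight_sum_nonneg (s s' : Mode) (L : List Mode) : 0 ≤ (L.map (lowWeight s s')).sum :=
  List.sum_nonneg fun x hx => by
    obtain ⟨u, -, rfl⟩ := List.mem_map.1 hx
    exact lowWeight_nonneg s s' u

theorem FewHigh.left {A B : List Mode} (h : FewHigh N s s' (A ++ B)) : FewHigh N s s' A where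
  low := by
    have h1 := h.low
    rw [List.map_append, List.sum_append] at h1
    linarith [lowWeight_sum_nonneg s s' B]
  fst := by have := h.fst; rw [List.count_append] at this; omega
  snd := by have := h.snd; rw [List.count_append] at this; omega

theorem FewHigh.right {A B : List Mode} (h : FewHigh N s s' (A ++ B)) : FewHigh N s s' B where
  low := by
    have h1 := h.low
    rw [List.map_append, List.sum_append] at h1
    linarith [lowWeight_sum_nonneg s s' A]
  fst := by have := h.fst; rw [List.count_append] at this; omega
  snd := by have := h.snd; rw [List.count_append] at this; omega

theorem FewHigh.mem {L : List Mode} (hL : FewHigh N s s' L) {u : Mode} (hu : u ∈ L) :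
    u = s ∨ u = s' ∨ |(mo u : ℝ)| ≤ N / 8 := by
  by_cases h1 : u = s
  · exact Or.inl h1
  by_cases h2 : u = s'
  · exact Or.inr (Or.inl h2)
  refine Or.inr (Or.inr ?_)
  have h3 : lowWeight s s' u ≤ (L.map (lowWeight s s')).sum :=
    List.single_le_sum (fun x hx => by
      obtain ⟨v, -, rfl⟩ := List.mem_map.1 hx
      exact lowWeight_nonneg s s' v) _ (List.mem_map_of_mem hu)
  have h4 : lowWeight s s' u = |(mo u : ℝ)| := by
    rw [lowWeight, if_neg (by tauto), abs_fst_eq]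
  linarith [hL.low]

/-- The number of occurrences of `s` minus that of `s'`. -/
def excess (s s' : Mode) (L : List Mode) : ℤ := (L.count s : ℤ) - L.count s'

theorem excess_append (s s' : Mode) (A B : List Mode) :
    excess s s' (A ++ B) = excess s s' A + excess s s' B := by
  unfold excess
  rw [List.count_append, List.count_append]
  push_cast
  ring

theorem HighPair.sum_map_displace (h : HighPair N δ ε s s' t t') {L : List Mode}
    (hL : FewHigh N s s' L) : ((L.map (displace s s' t t')).map mo).sum =
      (L.map mo).sum + excess s s' L * δ := by
  have key : ∀ L' : List Mode, (∀ u ∈ L', u = s ∨ u = s' ∨ |(mo u : ℝ)| ≤ N / 8) →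
      ((L'.map (displace s s' t t')).map mo).sum = (L'.map mo).sum + excess s s' L' * δ := by
    intro L' hL'
    induction L' with
    | nil => simp [excess]
    | cons u L' ih =>
      have h1 := ih fun v hv => hL' v (List.mem_cons_of_mem _ hv)
      simp only [List.map_cons, List.sum_cons] at h1 ⊢
      rw [h1]
      have h2 : excess s s' (u :: L') = excess s s' L' + ((if u = s then 1 else 0) -
          (if u = s' then 1 else 0)) := by
        simp only [excess, List.count_cons, beq_iff_eq]
        push_cast
        ring
      rw [h2]
      have hne := h.ne
      have hpos := h.pos
      rcases hL' u (by simp) with rfl | rfl | hu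
      · rw [h.displace_fst, h.mom, if_pos rfl, if_neg hne]; ring
      · rw [h.displace_snd, h.mom', if_pos rfl, if_neg hne.symm]; ring
      · have hk1 := h.high
        have hk2 := h.high'
        have hus : u ≠ s := by
          rintro rfl
          rw [← abs_unit_mul ε] at hu
          linarith [le_abs_self (((ε : ℤ) : ℝ) * mo u)]
        have hus' : u ≠ s' := by
          rintro rfl
          rw [← abs_unit_mul ε] at hu
          linarith [neg_le_abs (((ε : ℤ) : ℝ) * mo u)]
        rw [h.displace_low (by linarith), if_neg hus, if_neg hus']; ring
  exact key L fun u hu => hL.mem hu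

/-- Apart from the occurrences of `s` and `s'`, a list contributes at most its low weight to the
momentum. -/
theorem abs_sum_mo_sub_le (hne : s ≠ s') (L : List Mode) :
    |(((L.map mo).sum : ℤ) : ℝ) - L.count s * mo s - L.count s' * mo s'| ≤
      (L.map (lowWeight s s')).sum := by
  induction L with
  | nil => simp
  | cons u L ih =>
    simp only [List.map_cons, List.sum_cons, List.count_cons, beq_iff_eq]
    by_cases h1 : u = s
    · subst h1
      rw [if_pos rfl, if_neg hne, lowWeight, if_pos (Or.inl rfl), zero_add]
      refine le_trans (le_of_eq ?_) ih
      congr 1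
      push_cast
      ring
    by_cases h2 : u = s'
    · subst h2
      rw [if_pos rfl, if_neg h1, lowWeight, if_pos (Or.inr rfl), zero_add]
      refine le_trans (le_of_eq ?_) ih
      congr 1
      push_cast
      ring
    rw [if_neg h1, if_neg h2, lowWeight, if_neg (by tauto), abs_fst_eq]
    refine le_trans (le_of_eq ?_) ((abs_add_le _ _).trans (add_le_add_right ih _))
    congr 1
    push_cast
    ring

/-- The momenta of the sublists are shifted. -/
theorem HighPair.shift (h : HighPair N δ ε s s' t t') {L : List Mode} (hL : FewHigh N s s' L)
    {r r' : Mode} (hsgn : r.2 = r'.2) (hr : mo r = (L.map mo).sum)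
    (hr' : mo r' = ((L.map (displace s s' t t')).map mo).sum) :
    Shift N δ ε (excess s s' L) r r' := by
  rw [h.sum_map_displace hL, ← hr] at hr'
  have hb := (abs_sum_mo_sub_le h.ne L).trans hL.low
  rw [← hr] at hb
  have hpos := h.pos
  have hnear := abs_le.1 h.near
  have hhigh := h.high
  have hhigh' := h.high'
  have hhight := h.hight
  have hhight' := h.hight'
  have hm : (mo t : ℝ) = mo s + δ := by rw [h.mom]; push_cast; ring
  have hm' : (mo t' : ℝ) = mo s' - δ := by rw [h.mom']; push_cast; ring
  have hfst := hL.fst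
  have hsnd := hL.snd
  rw [hm] at hhight
  rw [hm'] at hhight'
  have hmr : (mo r' : ℝ) = mo r + (excess s s' L : ℤ) * δ := by rw [hr']; push_cast; ring
  have hε : ((ε : ℤ) : ℝ) = 1 ∨ ((ε : ℤ) : ℝ) = -1 := by
    rcases Int.units_eq_one_or ε with rfl | rfl <;> simp
  refine ⟨hsgn, hr', fun h0 => ?_, fun h0 => ?_⟩
  · unfold excess at h0
    rw [abs_le] at hb ⊢
    -- Zero excess means that neither high mode occurs or that both do. In the second case their
    -- momenta cancel up to `N/8`, and with the low modes the total stays below `N/4`.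
    have : (L.count s = 0 ∧ L.count s' = 0) ∨ (L.count s = 1 ∧ L.count s' = 1) := by omega
    rcases this with ⟨e1, e2⟩ | ⟨e1, e2⟩ <;> rw [e1, e2] at hb <;> push_cast at hb <;>
      constructor <;> linarith
  · push_cast
    rw [hmr]
    rw [abs_le] at hb
    -- Excess `± 1` means exactly one high mode, of size above `2N`; the low modes change the
    -- momentum by at most `N/8`, so it stays above `N` with the same sign.
    rcases h0 with h0 | h0 <;> rw [h0] <;> unfold excess at h0
    · have e1 : L.count s = 1 := by omega
      have e2 : L.count s' = 0 := by omega
      rw [e1, e2] at hb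
      push_cast at hb ⊢
      rcases hε with hε | hε <;> rw [hε] at hhigh hhight ⊢ <;> constructor <;> linarith
    · have e1 : L.count s = 0 := by omega
      have e2 : L.count s' = 1 := by omega
      rw [e1, e2] at hb
      push_cast at hb ⊢
      rcases hε with hε | hε <;> rw [hε] at hhigh' hhight' ⊢ <;> constructor <;> linarith

/-- The sign of a root survives the displacement: at a node it is part of the tree, and at a leaf
the displaced modes keep their signs. -/
theorem HighPair.shift_root (h : HighPair N δ ε s s' t t') {T : Ternary Mode}
    (hT : FewHigh N s s' T.leaves) :
    Shift N δ ε (excess s s' T.leaves) T.root (T.map (displace s s' t t')).root := by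
  refine h.shift hT ?_ (mo_root T) (by rw [mo_root, leaves_map])
  cases T with
  | leaf u =>
    change u.2 = (displace s s' t t' u).2
    have hpos := h.pos
    rcases hT.mem (u := u) (by simp [leaves]) with rfl | rfl | hu
    · rw [h.displace_fst, h.sign]
    · rw [h.displace_snd, h.sign']
    · rw [h.displace_low (by linarith)]
  | node => rfl

theorem abs_mul_sub_mul_le {x x' y y' X Y e f : ℝ} (hx : |x| ≤ X) (hy : |y'| ≤ Y)
    (h1 : |x - x'| ≤ e * X) (h2 : |y - y'| ≤ f * Y) : |x * y - x' * y'| ≤ (e + f) * (X * Y) := by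
  have hX : 0 ≤ X := (abs_nonneg _).trans hx
  calc |x * y - x' * y'| = |x * (y - y') + (x - x') * y'| := by ring_nf
    _ ≤ |x| * |y - y'| + |x - x'| * |y'| := (abs_add_le _ _).trans (by rw [abs_mul, abs_mul])
    _ ≤ X * (f * Y) + e * X * Y := by
        refine add_le_add (mul_le_mul hx h2 (abs_nonneg _) hX) (mul_le_mul h1 hy (abs_nonneg _) ?_)
        exact (abs_nonneg _).trans h1
    _ = _ := by ring

variable {m : ℝ} {I : Finset ℤ} {c E : ℝ}

theorem abs_mul_le_mul {x y X Y : ℝ} (hx : |x| ≤ X) (hy : |y| ≤ Y) : |x * y| ≤ X * Y := by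
  rw [abs_mul]
  exact mul_le_mul hx hy (abs_nonneg _) ((abs_nonneg _).trans hx)

/-- The coefficient of a tree is nearly invariant under the displacement. -/
theorem HighPair.coef_sub (h : HighPair N δ ε s s' t t') (hc : ∀ J, |symb m I J| ≤ c)
    (hE : ∀ J J', ShiftQuad N δ ε J J' → |symb m I J - symb m I J'| ≤ E * c) {T : Ternary Mode}
    (hT : FewHigh N s s' T.leaves) :
    |T.coef m I - (T.map (displace s s' t t')).coef m I| ≤ T.nodes * E * (2 * c) ^ T.nodes := by
  induction T with
  | leaf u => simp [coef, Ternary.map, nodes]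
  | node σ T₁ T₂ T₃ ih₁ ih₂ ih₃ =>
    have hs := h.shift_root hT
    have hT' : FewHigh N s s' (T₁.leaves ++ (T₂.leaves ++ T₃.leaves)) := hT
    have f₁ := hT'.left
    have f₂ := hT'.right.left
    have f₃ := hT'.right.right
    set ρ := displace s s' t t'
    have hquad : ShiftQuad N δ ε
        (Matrix.vecCons (cj (node σ T₁ T₂ T₃).root) ![T₁.root, T₂.root, T₃.root])
        (Matrix.vecCons (cj ((node σ T₁ T₂ T₃).map ρ).root)
          ![(T₁.map ρ).root, (T₂.map ρ).root, (T₃.map ρ).root]) := by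
      -- The conjugate root undoes the total shift of its three subtrees. As `s` and `s'` occur at
      -- most once each, at most two of the four modes move.
      refine ⟨![-excess s s' (node σ T₁ T₂ T₃).leaves, excess s s' T₁.leaves, excess s s' T₂.leaves,
        excess s s' T₃.leaves], ?_, ?_, ?_⟩
      · intro i
        fin_cases i
        · exact hs.cj
        · exact h.shift_root f₁
        · exact h.shift_root f₂
        · exact h.shift_root f₃
      · simp only [leaves, excess_append]
        simp [Fin.sum_univ_four]
      · have h1 := hT'.fst
        have h2 := hT'.snd
        simp only [List.count_append] at h1 h2
        simp only [leaves, excess_append]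
        simp only [Fin.sum_univ_four, Matrix.cons_val_zero, Matrix.cons_val_one, Matrix.cons_val,
          excess]
        rcases abs_cases ((T₁.leaves.count s : ℤ) - T₁.leaves.count s') with ha | ha <;>
        rcases abs_cases ((T₂.leaves.count s : ℤ) - T₂.leaves.count s') with hb | hb <;>
        rcases abs_cases ((T₃.leaves.count s : ℤ) - T₃.leaves.count s') with hd | hd <;>
        rcases abs_cases (-((T₁.leaves.count s : ℤ) - T₁.leaves.count s' +
          ((T₂.leaves.count s : ℤ) - T₂.leaves.count s' +
          ((T₃.leaves.count s : ℤ) - T₃.leaves.count s')))) with he | he <;>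
        omega
    have hk : ∀ (S : Mode) J, |1 / 2 * fieldCoeff m I S J| ≤ 2 * c := fun S J => by
      rw [abs_mul, abs_of_pos (by norm_num : (0 : ℝ) < 1 / 2)]
      linarith [abs_fieldCoeff_le hc S J]
    have hk' : |1 / 2 * fieldCoeff m I (node σ T₁ T₂ T₃).root ![T₁.root, T₂.root, T₃.root] -
        1 / 2 * fieldCoeff m I ((node σ T₁ T₂ T₃).map ρ).root
          ![(T₁.map ρ).root, (T₂.map ρ).root, (T₃.map ρ).root]| ≤ E * (2 * c) := by
      have e1 : (node σ T₁ T₂ T₃).root.2 = σ := rfl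
      have e2 : ((node σ T₁ T₂ T₃).map ρ).root.2 = σ := rfl
      rw [fieldCoeff, fieldCoeff, e1, e2]
      have := hE _ _ hquad
      calc _ = |((σ : ℤ) : ℝ)| * 2 * |symb m I (Matrix.vecCons (cj (node σ T₁ T₂ T₃).root)
            ![T₁.root, T₂.root, T₃.root]) - symb m I (Matrix.vecCons
            (cj ((node σ T₁ T₂ T₃).map ρ).root) ![(T₁.map ρ).root, (T₂.map ρ).root, (T₃.map ρ).root])| := by
            rw [← abs_two, ← abs_mul, ← abs_mul, abs_two]
            congr 1
            ring
        _ ≤ _ := by rw [abs_unit]; linarith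
    have b : ∀ T : Ternary Mode, |(T.map ρ).coef m I| ≤ (2 * c) ^ T.nodes := fun T => by
      rw [← nodes_map ρ T]; exact abs_coef_le hc _
    -- Telescoping the product: the node itself costs `E` and each subtree costs `E` times its
    -- number of nodes, all relative to the common bound.
    have step := abs_mul_sub_mul_le (hk _ _) (abs_mul_le_mul (b T₁) (abs_mul_le_mul (b T₂) (b T₃))) hk'
      (abs_mul_sub_mul_le (abs_coef_le hc T₁) (abs_mul_le_mul (b T₂) (b T₃)) (ih₁ f₁)
        (abs_mul_sub_mul_le (abs_coef_le hc T₂) (b T₃) (ih₂ f₂) (ih₃ f₃)))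
    refine step.trans (le_of_eq ?_)
    simp only [nodes, pow_add, pow_one]
    push_cast
    ring

theorem isLeaf_map {α β : Type} (f : α → β) (T : Ternary α) : (T.map f).isLeaf = T.isLeaf := by
  cases T <;> rfl

/-- As `s` and `s'` occur exactly once, the four excesses add up to zero and the roots form a
`ShiftQuad`. Momentum, resonance and tree shapes are then preserved exactly. -/
theorem HighPair.quadFactor_eq (h : HighPair N δ ε s s' t t') (hN : (kappa I : ℝ) < N)
    {q : Fin 4 → Ternary Mode} (hq : FewHigh N s s' (quadLeaves q))
    (h1 : (quadLeaves q).count s = 1) (h2 : (quadLeaves q).count s' = 1) :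
    quadFactor I (fun i => (q i).map (displace s s' t t')) = quadFactor I q := by
  rw [quadLeaves_eq] at hq h1 h2
  simp only [List.count_append] at h1 h2
  have hquad : ShiftQuad N δ ε (roots q) (roots fun i => (q i).map (displace s s' t t')) := by
    refine ⟨fun i => excess s s' (q i).leaves, ?_, ?_, ?_⟩
    · intro i
      fin_cases i
      · exact h.shift_root hq.left
      · exact h.shift_root hq.right.left
      · exact h.shift_root hq.right.right.left
      · exact h.shift_root hq.right.right.right
    · simp only [Fin.sum_univ_four, excess]
      omega
    · simp only [Fin.sum_univ_four, excess]
      rcases abs_cases (((q 0).leaves.count s : ℤ) - (q 0).leaves.count s') with ha | ha <;>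
      rcases abs_cases (((q 1).leaves.count s : ℤ) - (q 1).leaves.count s') with hb | hb <;>
      rcases abs_cases (((q 2).leaves.count s : ℤ) - (q 2).leaves.count s') with hd | hd <;>
      rcases abs_cases (((q 3).leaves.count s : ℤ) - (q 3).leaves.count s') with he | he <;>
      omega
  have e1 : ind (NonRes I) (roots fun i => (q i).map (displace s s' t t')) =
      ind (NonRes I) (roots q) := by
    unfold ind
    rw [hquad.nonRes_iff hN]
  have e2 : ind ZeroMom (roots fun i => (q i).map (displace s s' t t')) = ind ZeroMom (roots q) := by
    obtain ⟨d, hd, h0, -⟩ := hquad.out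
    unfold ind ZeroMom
    have : ∑ i, mo (roots (fun i => (q i).map (displace s s' t t')) i) = ∑ i, mo (roots q i) := by
      simp only [(hd _).mom]
      rw [Finset.sum_add_distrib, ← Finset.sum_mul, h0, zero_mul, add_zero]
    rw [this]
  unfold quadFactor
  rw [e1, e2]
  simp only [isLeaf_map]

/-- The combinatorial factor does not change, so only the product of the four tree coefficients
varies, by at most `E` for each node. -/
theorem HighPair.norm_quadCoef_sub_le (h : HighPair N δ ε s s' t t') (hN : (kappa I : ℝ) < N)
    (hc : ∀ J, |symb m I J| ≤ c)
    (hE : ∀ J J', ShiftQuad N δ ε J J' → |symb m I J - symb m I J'| ≤ E * c) (hE0 : 0 ≤ E)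
    {q : Fin 4 → Ternary Mode} (hq : FewHigh N s s' (quadLeaves q))
    (h1 : (quadLeaves q).count s = 1) (h2 : (quadLeaves q).count s' = 1) :
    ‖quadCoef m I q - quadCoef m I fun i => (q i).map (displace s s' t t')‖ ≤
      17 * E * (4 * c) ^ quadNodes q := by
  have hc0 : 0 ≤ c := (abs_nonneg _).trans (hc fun _ => (0, 1))
  rw [quadCoef, quadCoef, h.quadFactor_eq hN hq h1 h2, ← mul_sub, norm_mul, ← Complex.ofReal_sub,
    Complex.norm_real]
  set ρ := displace s s' t t'
  rw [quadLeaves_eq] at hq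
  have b : ∀ T : Ternary Mode, |(T.map ρ).coef m I| ≤ (2 * c) ^ T.nodes := fun T => by
    rw [← nodes_map ρ T]; exact abs_coef_le hc _
  have step := abs_mul_sub_mul_le (abs_coef_le hc (q 0))
    (abs_mul_le_mul (b (q 1)) (abs_mul_le_mul (b (q 2)) (b (q 3)))) (h.coef_sub hc hE hq.left)
    (abs_mul_sub_mul_le (abs_coef_le hc (q 1)) (abs_mul_le_mul (b (q 2)) (b (q 3)))
      (h.coef_sub hc hE hq.right.left) (abs_mul_sub_mul_le (abs_coef_le hc (q 2)) (b (q 3))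
        (h.coef_sub hc hE hq.right.right.left) (h.coef_sub hc hE hq.right.right.right)))
  have h3 : ((quadNodes q : ℕ) : ℝ) ≤ 2 ^ quadNodes q := by
    exact_mod_cast (Nat.lt_two_pow_self (n := quadNodes q)).le
  have h4 : |∏ i, (q i).coef m I - ∏ i, ((q i).map ρ).coef m I| ≤ E * (4 * c) ^ quadNodes q := by
    rw [Fin.prod_univ_four, Fin.prod_univ_four]
    calc _ ≤ _ := by
          refine le_trans (le_of_eq ?_) step
          congr 1
          ring
      _ = quadNodes q * E * (2 * c) ^ quadNodes q := by
          simp only [quadNodes, Fin.sum_univ_four, pow_add]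
          push_cast
          ring
      _ ≤ 2 ^ quadNodes q * E * (2 * c) ^ quadNodes q := by gcongr
      _ = E * (2 * (2 * c)) ^ quadNodes q := by rw [mul_pow 2 (2 * c)]; ring
      _ = _ := by ring_nf
  calc _ ≤ 17 * (E * (4 * c) ^ quadNodes q) :=
        mul_le_mul (norm_quadFactor_le I q) h4 (abs_nonneg _) (by norm_num)
    _ = _ := by ring

end displacement

end DNLW
end


noncomputable section

namespace DNLW

open Ternary

/-! ### Comparison of coefficients of the remainder -/

section comparison

theorem lidx_apply (J : List Mode) (s : Mode) : lidx J s = J.count s := by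
  induction J with
  | nil => simp [lidx_nil]
  | cons u J ih =>
    rw [lidx_cons, Finsupp.add_apply, ih, List.count_cons, Finsupp.single_apply, add_comm]
    simp

/-- The sum of a function of the modes with multiplicities. -/
def wsum (g : Mode → ℝ) (γ : MIdx) : ℝ := γ.sum fun s k => g s * k

theorem wsum_add (g : Mode → ℝ) (γ γ' : MIdx) : wsum g (γ + γ') = wsum g γ + wsum g γ' :=
  Finsupp.sum_add_index' (by simp) fun s a b => by push_cast; ring

theorem wsum_single (g : Mode → ℝ) (s : Mode) : wsum g (Finsupp.single s 1) = g s := by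
  simp [wsum]

theorem wsum_lidx (g : Mode → ℝ) (J : List Mode) : wsum g (lidx J) = (J.map g).sum := by
  induction J with
  | nil => simp [lidx_nil, wsum]
  | cons u J ih => rw [lidx_cons, wsum_add, wsum_single, ih]; simp

theorem wsum_mono {g g' : Mode → ℝ} (h : ∀ s, g s ≤ g' s) (γ : MIdx) : wsum g γ ≤ wsum g' γ :=
  Finset.sum_le_sum fun s _ => mul_le_mul_of_nonneg_right (h s) (Nat.cast_nonneg _)

theorem le_wsum {g : Mode → ℝ} (h : ∀ s, 0 ≤ g s) {γ : MIdx} {s : Mode} (hs : s ∈ γ.support) :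
    g s ≤ wsum g γ := by
  refine le_trans ?_ (Finset.single_le_sum (f := fun s => g s * γ s)
    (fun u _ => mul_nonneg (h u) (Nat.cast_nonneg _)) hs)
  refine le_mul_of_one_le_right (h s) ?_
  exact_mod_cast Nat.one_le_iff_ne_zero.2 (Finsupp.mem_support_iff.1 hs)

/-- The total size of the modes of a monomial. -/
def modeSize (γ : MIdx) : ℝ := wsum (fun s => |(s.1 : ℝ)|) γ

theorem abs_le_modeSize {γ : MIdx} {s : Mode} (hs : s ∈ γ.support) : |(s.1 : ℝ)| ≤ modeSize γ :=
  le_wsum (g := fun s => |(s.1 : ℝ)|) (fun _ => abs_nonneg _) hs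

theorem abs_momentum_le (γ : MIdx) : |(momentum γ : ℝ)| ≤ modeSize γ := by
  have h : (momentum γ : ℝ) = γ.sum fun s k => (k : ℝ) * (mo s : ℝ) := by
    unfold momentum Finsupp.sum mo
    push_cast
    rfl
  rw [h]
  refine (Finset.abs_sum_le_sum_abs _ _).trans (Finset.sum_le_sum fun s _ => ?_)
  change _ ≤ |(s.1 : ℝ)| * (γ s : ℝ)
  rw [abs_mul, Nat.abs_cast, abs_fst_eq, mul_comm]

theorem apply_eq_zero_of_modeSize_lt {γ : MIdx} {s : Mode} (h : modeSize γ < |(s.1 : ℝ)|) :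
    γ s = 0 := by
  by_contra hs
  exact absurd (abs_le_modeSize (Finsupp.mem_support_iff.2 hs)) (not_le.2 h)

variable {m : ℝ} {I : Finset ℤ} {c E N : ℝ} {δ : ℤ} {ε : ℤˣ} {s s' t t' : Mode} {γ₀ : MIdx}

theorem HighPair.lt_abs (h : HighPair N δ ε s s' t t') :
    N / 8 < |(s.1 : ℝ)| ∧ N / 8 < |(s'.1 : ℝ)| := by
  have h1 := h.high
  have h2 := h.high'
  have h3 := h.pos
  rw [abs_fst_eq, abs_fst_eq, ← abs_unit_mul ε, ← abs_unit_mul ε (mo s' : ℝ)]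
  exact ⟨by linarith [le_abs_self (((ε : ℤ) : ℝ) * mo s)],
    by linarith [neg_le_abs (((ε : ℤ) : ℝ) * mo s')]⟩

/-- The modes of `γ₀` have size at most `N/8`, so neither high mode can be among them. -/
theorem HighPair.fewHigh (h : HighPair N δ ε s s' t t') (hγ : modeSize γ₀ ≤ N / 8) {J : List Mode}
    (hJ : lidx J = γ₀ + Finsupp.single s 1 + Finsupp.single s' 1) :
    FewHigh N s s' J ∧ J.count s = 1 ∧ J.count s' = 1 := by
  have hne := h.ne
  have h1 := apply_eq_zero_of_modeSize_lt (hγ.trans_lt h.lt_abs.1)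
  have h2 := apply_eq_zero_of_modeSize_lt (hγ.trans_lt h.lt_abs.2)
  have k1 : J.count s = 1 := by
    rw [← lidx_apply, hJ]
    simp [h1, hne.symm]
  have k2 : J.count s' = 1 := by
    rw [← lidx_apply, hJ]
    simp [h2, hne]
  refine ⟨⟨?_, k1.le, k2.le⟩, k1, k2⟩
  rw [← wsum_lidx, hJ, wsum_add, wsum_add, wsum_single, wsum_single]
  have e1 : lowWeight s s' s = 0 := by simp [lowWeight]
  have e2 : lowWeight s s' s' = 0 := by simp [lowWeight]
  rw [e1, e2, add_zero, add_zero]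
  refine (wsum_mono (fun u => ?_) γ₀).trans hγ
  unfold lowWeight
  split_ifs
  · positivity
  · exact le_rfl

theorem HighPair.mapDomain_displace (h : HighPair N δ ε s s' t t') (hγ : modeSize γ₀ ≤ N / 8) :
    (γ₀ + Finsupp.single s 1 + Finsupp.single s' 1).mapDomain (displace s s' t t') =
      γ₀ + Finsupp.single t 1 + Finsupp.single t' 1 := by
  have hpos := h.pos
  rw [Finsupp.mapDomain_add, Finsupp.mapDomain_add, Finsupp.mapDomain_single,
    Finsupp.mapDomain_single, h.displace_fst, h.displace_snd]
  congr 2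
  rw [Finsupp.mapDomain_congr (g := id), Finsupp.mapDomain_id]
  intro u hu
  have := abs_le_modeSize hu
  rw [abs_fst_eq] at this
  exact h.displace_low (by linarith)

theorem quadLeaves_map {α β : Type} (f : α → β) (q : Fin 4 → Ternary α) :
    quadLeaves (fun i => (q i).map f) = (quadLeaves q).map f := by
  simp [quadLeaves_eq, leaves_map]

/-- Relabelling leaves by the displacement is a bijection of quadruples of trees that carries one
multi-index into the other. The two coefficients are thus compared tree by tree, with the same count
of trees as for a single coefficient. -/
theorem HighPair.enorm_remainder_sub_le (h : HighPair N δ ε s s' t t') (hN : (kappa I : ℝ) < N)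
    (hc : ∀ J, |symb m I J| ≤ c)
    (hE : ∀ J J', ShiftQuad N δ ε J J' → |symb m I J - symb m I J'| ≤ E * c) (hE0 : 0 ≤ E)
    (hγ : modeSize γ₀ ≤ N / 8) :
    ‖MvPowerSeries.coeff (γ₀ + Finsupp.single s 1 + Finsupp.single s' 1) (remainder m I) -
      MvPowerSeries.coeff (γ₀ + Finsupp.single t 1 + Finsupp.single t' 1) (remainder m I)‖ₑ ≤
      ENNReal.ofReal (17 * E) * 16 *
        growth c ^ (γ₀ + Finsupp.single s 1 + Finsupp.single s' 1).degree *
        ord (γ₀ + Finsupp.single s 1 + Finsupp.single s' 1) := by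
  classical
  have hc0 : 0 ≤ c := (abs_nonneg _).trans (hc fun _ => (0, 1))
  set γ := γ₀ + Finsupp.single s 1 + Finsupp.single s' 1 with hγdef
  set ρ := displace s s' t t'
  have hmap := h.mapDomain_displace hγ
  have e : ∀ q : Fin 4 → Ternary Mode,
      (Equiv.arrowCongr (Equiv.refl (Fin 4)) (mapEquiv ρ)) q = fun i => (q i).map ρ := fun q => rfl
  have e2 : ∀ q : Fin 4 → Ternary Mode, (lidx (quadLeaves fun i => (q i).map ρ) =
      γ.mapDomain ρ) ↔ lidx (quadLeaves q) = γ := fun q => by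
    rw [quadLeaves_map, lidx_map]
    exact (Finsupp.mapDomain_injective ρ.injective).eq_iff
  have e3 : MvPowerSeries.coeff (γ.mapDomain ρ) (remainder m I) = ∑' q : Fin 4 → Ternary Mode,
      if lidx (quadLeaves q) = γ then quadCoef m I (fun i => (q i).map ρ) else 0 := by
    rw [coeff_remainder, ← (Equiv.arrowCongr (Equiv.refl (Fin 4)) (mapEquiv ρ)).tsum_eq]
    exact tsum_congr fun q => by rw [e, if_congr (e2 q) rfl rfl]
  rw [← hmap, e3, coeff_remainder]
  have hfin : growth c ^ γ.degree * ord γ ≠ ⊤ :=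
    ENNReal.mul_ne_top (ENNReal.pow_ne_top (growth_ne_top c)) (ord_ne_top γ)
  have hs1 : Summable fun q : Fin 4 → Ternary Mode =>
      if lidx (quadLeaves q) = γ then quadCoef m I q else 0 := by
    refine summable_of_tsum_enorm (ne_top_of_le_ne_top ?_ (tsum_enorm_quadCoef_le hc γ))
    rw [mul_assoc]
    exact ENNReal.mul_ne_top (by simp) hfin
  have hs2 : Summable fun q : Fin 4 → Ternary Mode =>
      if lidx (quadLeaves q) = γ then quadCoef m I (fun i => (q i).map ρ) else 0 := by
    refine summable_of_tsum_enorm (ne_top_of_le_ne_top ?_ ((ENNReal.tsum_le_tsum fun q => ?_).trans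
      (tsum_quad_growth_le c 17 γ)))
    · rw [mul_assoc]
      exact ENNReal.mul_ne_top (by norm_num) hfin
    · split_ifs
      · rw [← quadNodes_map ρ q]
        exact enorm_quadCoef_le hc _
      · simp
  rw [← hs1.tsum_sub hs2]
  refine (enorm_tsum_le _).trans ((ENNReal.tsum_le_tsum fun q => ?_).trans
    (tsum_quad_growth_le c (ENNReal.ofReal (17 * E)) γ))
  split_ifs with hq
  · obtain ⟨h1, h2, h3⟩ := h.fewHigh hγ hq
    have := h.norm_quadCoef_sub_le hN hc hE hE0 h1 h2 h3
    rw [← ofReal_norm, ← ENNReal.ofReal_pow (by positivity), ← ENNReal.ofReal_mul (by positivity)]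
    exact ENNReal.ofReal_le_ofReal this
  · simp

end comparison

/-! ### The Töplitz approximation of the remainder -/

section toplitz

variable {m : ℝ} {I : Finset ℤ} {c N L : ℝ}

/-- A reference mode of large size, with given signs. -/
def refMode (N : ℝ) (ς : SignType) (σ : ℤˣ) : Mode := ((ς : ℤ) * ⌈4 * N⌉, σ)

/-- The mode that has total momentum `h` with the reference mode. -/
def refMode' (N : ℝ) (ς : SignType) (σ σ' : ℤˣ) (h : ℤ) : Mode :=
  ((σ' : ℤ) * (h - mo (refMode N ς σ)), σ')

open Classical in
/-- The coefficients of the Töplitz approximation. -/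
def toplitzCoeff (m : ℝ) (I : Finset ℤ) (L N : ℝ) (σ σ' : ℤˣ) (ς : SignType) (h : ℤ) : Series :=
  fun γ => if IsLow L N 3 γ ∧ momentum γ + h = 0 then
    1 / 2 * MvPowerSeries.coeff (γ + Finsupp.single (refMode N ς σ) 1 +
      Finsupp.single (refMode' N ς σ σ' h) 1) (remainder m I) else 0

open Classical in
theorem coeff_toplitzCoeff (σ σ' : ℤˣ) (ς : SignType) (h : ℤ) (γ : MIdx) :
    MvPowerSeries.coeff γ (toplitzCoeff m I L N σ σ' ς h) =
      if IsLow L N 3 γ ∧ momentum γ + h = 0 then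
        1 / 2 * MvPowerSeries.coeff (γ + Finsupp.single (refMode N ς σ) 1 +
          Finsupp.single (refMode' N ς σ σ' h) 1) (remainder m I) else 0 := rfl

theorem coeff_toplitzCoeff_ne_zero {σ σ' : ℤˣ} {ς : SignType} {h : ℤ} {γ : MIdx}
    (h0 : MvPowerSeries.coeff γ (toplitzCoeff m I L N σ σ' ς h) ≠ 0) :
    IsLow L N 3 γ ∧ momentum γ + h = 0 := by
  classical
  by_contra hc
  exact h0 (by rw [coeff_toplitzCoeff, if_neg hc])

theorem mul_succ_le_four_pow (n : ℕ) : (n + 2) * (n + 1) ≤ 2 * 4 ^ n := by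
  induction n with
  | zero => norm_num
  | succ n ih => rw [pow_succ]; nlinarith

/-- Two more modes multiply the number of orderings by at most `(n + 2)(n + 1) ≤ 2 * 4 ^ n`; hence
the growth constant is multiplied by `4`, and the minimal degree drops from six to four. -/
theorem ordBound_toplitzCoeff (hc : ∀ J, |symb m I J| ≤ c) (σ σ' : ℤˣ) (ς : SignType) (h : ℤ) :
    OrdBound (toplitzCoeff m I L N σ σ' ς h) (2 + 2) (272 * growth c ^ 2 * 2) (4 * growth c) := by
  classical
  intro γ
  rw [coeff_toplitzCoeff]
  split_ifs with h1 h4 h4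
  · set t := refMode N ς σ
    set t' := refMode' N ς σ σ' h
    have hdeg : (γ + Finsupp.single t 1 + Finsupp.single t' 1).degree = γ.degree + 2 := by
      rw [map_add, map_add, Finsupp.degree_single, Finsupp.degree_single]
    have hdeg' : (γ + Finsupp.single t 1).degree = γ.degree + 1 := by
      rw [map_add, Finsupp.degree_single]
    have hb := ordBound_remainder hc (γ + Finsupp.single t 1 + Finsupp.single t' 1)
    rw [hdeg, if_pos (by omega)] at hb
    have ho : ord (γ + Finsupp.single t 1 + Finsupp.single t' 1) ≤ 2 * 4 ^ γ.degree * ord γ := by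
      refine (ord_add_single_le _ t').trans ?_
      rw [hdeg']
      calc _ ≤ ((γ.degree + 1 + 1 : ℕ) : ℝ≥0∞) * (((γ.degree + 1 : ℕ) : ℝ≥0∞) * ord γ) := by
            gcongr; exact ord_add_single_le _ t
        _ = (((γ.degree + 2) * (γ.degree + 1) : ℕ) : ℝ≥0∞) * ord γ := by push_cast; ring
        _ ≤ ((2 * 4 ^ γ.degree : ℕ) : ℝ≥0∞) * ord γ := by
            refine mul_le_mul' ?_ le_rfl
            exact_mod_cast mul_succ_le_four_pow _
        _ = _ := by push_cast; ring
    rw [enorm_mul]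
    have h2 : ‖(1 / 2 : ℂ)‖ₑ ≤ 1 := by
      rw [← ofReal_norm, ENNReal.ofReal_le_one]; norm_num
    calc _ ≤ 1 * (272 * growth c ^ (γ.degree + 2) * (2 * 4 ^ γ.degree * ord γ)) := by
          gcongr
          exact hb.trans (by gcongr)
      _ = _ := by rw [mul_pow 4, pow_add]; ring
  · have : MvPowerSeries.coeff (γ + Finsupp.single (refMode N ς σ) 1 +
        Finsupp.single (refMode' N ς σ σ' h) 1) (remainder m I) = 0 := by
      by_contra h0
      have := (coeff_remainder_ne_zero h0).1
      rw [map_add, map_add, Finsupp.degree_single, Finsupp.degree_single] at this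
      omega
    rw [this]
    simp
  · simp
  · simp

/-- Low monomials involve only sites of size below `3 N^L`, so the field has finitely many
components and the crude criterion `mRegular_of_finite` applies. -/
theorem toplitzCoeff_mem_lowSpace {a p : ℝ} (ha : 0 < a) (hp : 1 / 2 < p)
    (hc : ∀ J, |symb m I J| ≤ c) {r : ℝ} (hr : 0 < r) (hQ : ratio p (4 * growth c) r ≤ 2⁻¹)
    (σ σ' : ℤˣ) (ς : SignType) (h : ℤ) :
    toplitzCoeff m I L N σ σ' ς h ∈ lowSpace a p L r N 3 h := by
  refine ⟨?_, fun γ h0 => coeff_toplitzCoeff_ne_zero h0⟩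
  refine mRegular_of_finite (h := -h) (M := ⌈3 * N ^ L⌉₊) ha hp ?_ ?_ (ordBound_toplitzCoeff hc σ σ' ς h)
    (fun γ h0 => ?_) (fun γ h0 s hs => ?_) hr hQ
  · exact ENNReal.mul_ne_top (ENNReal.mul_ne_top (by simp) (ENNReal.pow_ne_top (growth_ne_top c)))
      (by simp)
  · exact ENNReal.mul_ne_top (by simp) (growth_ne_top c)
  · have := (coeff_toplitzCoeff_ne_zero h0).2
    omega
  · have h1 : modeSize γ < 3 * N ^ L := (coeff_toplitzCoeff_ne_zero h0).1
    have h2 := (abs_le_modeSize hs).trans (h1.le.trans (Nat.le_ceil _))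
    exact_mod_cast h2

theorem coeff_mul_X_mul_X (f : Series) (s s' : Mode) (γ : MIdx) :
    MvPowerSeries.coeff γ (f * MvPowerSeries.X s * MvPowerSeries.X s') =
      if Finsupp.single s 1 + Finsupp.single s' 1 ≤ γ then
        MvPowerSeries.coeff (γ - (Finsupp.single s 1 + Finsupp.single s' 1)) f else 0 := by
  rw [mul_assoc, MvPowerSeries.X, MvPowerSeries.X, MvPowerSeries.monomial_mul_monomial,
    MvPowerSeries.coeff_mul_monomial]
  simp

/-- The Töplitz approximation of the remainder. -/
def toplitzPart (m : ℝ) (I : Finset ℤ) (L N : ℝ) : Series :=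
  bilinearSum 2 N fun s s' => toplitzCoeff m I L N s.2 s'.2 (SignType.sign s.1)
    ((s.2 : ℤ) * s.1 + (s'.2 : ℤ) * s'.1)

open Classical in
theorem coeff_toplitzPart (γ : MIdx) : MvPowerSeries.coeff γ (toplitzPart m I L N) =
    ∑ q ∈ (γ.support ×ˢ γ.support).filter
      (fun q => 2 * N < |(q.1.1 : ℝ)| ∧ 2 * N < |(q.2.1 : ℝ)|),
      if Finsupp.single q.1 1 + Finsupp.single q.2 1 ≤ γ then
        MvPowerSeries.coeff (γ - (Finsupp.single q.1 1 + Finsupp.single q.2 1))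
          (toplitzCoeff m I L N q.1.2 q.2.2 (SignType.sign q.1.1) (mo q.1 + mo q.2)) else 0 :=
  Finset.sum_congr rfl fun _ _ => coeff_mul_X_mul_X _ _ _ _

theorem coeff_toplitzPart_ne_zero {γ : MIdx}
    (h : MvPowerSeries.coeff γ (toplitzPart m I L N) ≠ 0) : IsBilinear L N 2 3 γ := by
  classical
  rw [coeff_toplitzPart] at h
  obtain ⟨⟨s, s'⟩, hq, h0⟩ := Finset.exists_ne_zero_of_sum_ne_zero h
  rw [Finset.mem_filter] at hq
  have hle : Finsupp.single s 1 + Finsupp.single s' 1 ≤ γ := by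
    by_contra hc
    exact h0 (if_neg hc)
  rw [if_pos hle] at h0
  obtain ⟨h1, h2⟩ := coeff_toplitzCoeff_ne_zero h0
  refine ⟨s, s', _, hq.2.1, hq.2.2, h1, ?_, ?_⟩
  · have h3 : momentum (γ - (Finsupp.single s 1 + Finsupp.single s' 1)) + (mo s + mo s') = 0 := h2
    change momentum (γ - (Finsupp.single s 1 + Finsupp.single s' 1)) = -mo s - mo s'
    omega
  · rw [add_assoc, tsub_add_cancel_of_le hle]

theorem momentum_of_isBilinear {θ μ : ℝ} {γ : MIdx} (h : IsBilinear L N θ μ γ) :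
    momentum γ = 0 := by
  obtain ⟨s, s', γ₀, -, -, -, hm, rfl⟩ := h
  change momentum γ₀ = -mo s - mo s' at hm
  rw [momentum_add, momentum_add, momentum_single, momentum_single, hm]
  ring

variable {s s' : Mode} {γ₀ : MIdx}

/-- The bilinear sum runs over ordered pairs, so both `(s, s')` and `(s', s)` contribute, which the
`1/2` in `toplitzCoeff` compensates. No other pair does: all other modes are low, and `(s, s)` or
`(s', s')` would need multiplicity two. -/
theorem coeff_toplitzPart_eq (hN : 0 < N) (hs : 2 * N < |(s.1 : ℝ)|) (hs' : 2 * N < |(s'.1 : ℝ)|)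
    (hne : s ≠ s') (hγ : modeSize γ₀ ≤ N / 8) :
    MvPowerSeries.coeff (γ₀ + Finsupp.single s 1 + Finsupp.single s' 1) (toplitzPart m I L N) =
      MvPowerSeries.coeff γ₀ (toplitzCoeff m I L N s.2 s'.2 (SignType.sign s.1) (mo s + mo s')) +
      MvPowerSeries.coeff γ₀ (toplitzCoeff m I L N s'.2 s.2 (SignType.sign s'.1) (mo s' + mo s)) := by
  classical
  have h1 : γ₀ s = 0 := apply_eq_zero_of_modeSize_lt (by linarith)
  have h2 : γ₀ s' = 0 := apply_eq_zero_of_modeSize_lt (by linarith)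
  set γ := γ₀ + Finsupp.single s 1 + Finsupp.single s' 1 with hγdef
  have g1 : γ s = 1 := by simp [hγdef, h1, hne.symm]
  have g2 : γ s' = 1 := by simp [hγdef, h2, hne]
  have hmem : ∀ u ∈ γ.support, 2 * N < |(u.1 : ℝ)| → u = s ∨ u = s' := by
    intro u hu hlt
    by_contra hc
    push Not at hc
    have h3 : γ₀ u = 0 := apply_eq_zero_of_modeSize_lt (by linarith)
    refine Finsupp.mem_support_iff.1 hu ?_
    simp [hγdef, h3, hc.1.symm, hc.2.symm]
  have hsup : s ∈ γ.support ∧ s' ∈ γ.support := by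
    simp [Finsupp.mem_support_iff, g1, g2]
  rw [coeff_toplitzPart, ← Finset.sum_subset (s₁ := {(s, s'), (s', s)})]
  · rw [Finset.sum_pair (by simp [Prod.ext_iff, hne])]
    have e1 : γ = γ₀ + (Finsupp.single s 1 + Finsupp.single s' 1) := by rw [hγdef, add_assoc]
    have e2 : γ = γ₀ + (Finsupp.single s' 1 + Finsupp.single s 1) := by
      rw [hγdef, add_assoc, add_comm (Finsupp.single s 1)]
    rw [if_pos (by rw [e1]; exact le_add_self), if_pos (by rw [e2]; exact le_add_self)]
    congr 2
    · rw [e1, add_tsub_cancel_right]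
    · rw [e2, add_tsub_cancel_right]
  · intro q hq
    simp only [Finset.mem_insert, Finset.mem_singleton] at hq
    rcases hq with rfl | rfl <;> simp [Finset.mem_filter, hs, hs', g1, g2]
  · rintro ⟨u, v⟩ hq hq'
    simp only [Finset.mem_filter, Finset.mem_product] at hq
    rw [if_neg]
    intro hle
    have k : ∀ x, Finsupp.single u 1 x + Finsupp.single v 1 x ≤ γ x := fun x => hle x
    rcases hmem u hq.1.1 hq.2.1 with hu | hu <;> rcases hmem v hq.1.2 hq.2.2 with hv | hv <;>
      rw [hu, hv] at k hq'
    · have := k s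
      rw [g1, Finsupp.single_eq_same] at this
      omega
    · simp at hq'
    · simp at hq'
    · have := k s'
      rw [g2, Finsupp.single_eq_same] at this
      omega

/-- The high modes of a bilinear monomial and the reference modes. -/
theorem highPair_refMode (hN : 0 < N) (hs : 2 * N < |(s.1 : ℝ)|) (hs' : 2 * N < |(s'.1 : ℝ)|)
    (hnear : |(mo s + mo s' : ℝ)| ≤ N / 8) :
    ∃ (δ : ℤ) (ε : ℤˣ), HighPair N δ ε s s' (refMode N (SignType.sign s.1) s.2)
      (refMode' N (SignType.sign s.1) s.2 s'.2 (mo s + mo s')) := by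
  set t := refMode N (SignType.sign s.1) s.2 with ht
  -- With size at least `4N` for the reference mode, its partner, whose momentum is opposite up to
  -- `N/8`, is still larger than `2N`.
  have hM : 4 * N ≤ (⌈4 * N⌉ : ℝ) := Int.le_ceil _
  have hmt' : mo (refMode' N (SignType.sign s.1) s.2 s'.2 (mo s + mo s')) = mo s + mo s' - mo t :=
    mo_mk _ _
  have hmt : mo t = (s.2 : ℤ) * ((SignType.sign s.1 : ℤ) * ⌈4 * N⌉) := rfl
  rw [abs_fst_eq] at hs'
  have hne : s.1 ≠ 0 := by
    intro h0
    rw [h0] at hs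
    simp at hs
    linarith
  -- The unit `ε` is the sign of the momentum of `s`. The reference mode has the same one, as it
  -- shares the sign `σ` and the sign of the site.
  obtain ⟨ε, hε, hε'⟩ : ∃ ε : ℤˣ, ((ε : ℤ) : ℝ) * mo s = |(s.1 : ℝ)| ∧
      ((ε : ℤ) : ℝ) * mo t = (⌈4 * N⌉ : ℝ) := by
    have hms : mo s = (s.2 : ℤ) * s.1 := rfl
    rw [hmt, hms]
    rcases lt_or_gt_of_ne hne with h0 | h0
    · refine ⟨-s.2, ?_, ?_⟩
      · have h1 : (s.1 : ℝ) < 0 := by exact_mod_cast h0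
        rw [abs_of_neg h1]
        rcases Int.units_eq_one_or s.2 with h | h <;> rw [h] <;> push_cast <;> ring
      · rw [sign_neg h0]
        rcases Int.units_eq_one_or s.2 with h | h <;> rw [h] <;> push_cast <;> simp
    · refine ⟨s.2, ?_, ?_⟩
      · have h1 : 0 < (s.1 : ℝ) := by exact_mod_cast h0
        rw [abs_of_pos h1]
        rcases Int.units_eq_one_or s.2 with h | h <;> rw [h] <;> push_cast <;> ring
      · rw [sign_pos h0]
        rcases Int.units_eq_one_or s.2 with h | h <;> rw [h] <;> push_cast <;> simp
  have hn := hnear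
  rw [← abs_unit_mul ε, mul_add, hε, abs_le] at hn
  have hn2 : ((ε : ℤ) : ℝ) * mo s' < 0 := by linarith
  rw [← abs_unit_mul ε, abs_of_neg hn2] at hs'
  refine ⟨mo t - mo s, ε, hN, rfl, rfl, by ring, by rw [hmt']; ring, by rw [hε]; exact hs, hs',
    by rw [hε']; linarith, ?_, hnear⟩
  rw [hmt']
  push_cast
  rw [mul_sub, mul_add, hε', hε]
  linarith

/-- The constant of the Töplitz approximation. -/
def defect (m c : ℝ) : ℝ := (2 + 4 * m * c ^ 2) / c

/-- The Töplitz coefficient is the mean of two coefficients of the remainder, one for each choice of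
the mode moved to its reference position. Each is within `O(1/N)` of the true coefficient. -/
theorem enorm_remainder_sub_toplitzPart_le (hm : 0 < m) (hc0 : 0 < c)
    (hc : ∀ J, |symb m I J| ≤ c) (hcd : ∀ J, NonRes I J → c⁻¹ ≤ |divisor m J|)
    (hN : (kappa I : ℝ) < N) (hNm : Real.sqrt m ≤ N / 4) (hL : 3 * N ^ L ≤ N / 8) {γ : MIdx}
    (hγ : IsBilinear L N 2 3 γ) :
    ‖MvPowerSeries.coeff γ (remainder m I) - MvPowerSeries.coeff γ (toplitzPart m I L N)‖ₑ ≤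
      ENNReal.ofReal (17 * (defect m c / N)) * 16 * growth c ^ γ.degree * ord γ := by
  classical
  have hN0 : 0 < N := lt_of_le_of_lt (Nat.cast_nonneg _) hN
  have hD : 0 ≤ defect m c / N := by unfold defect; positivity
  obtain ⟨s, s', γ₀, hs, hs', hlow, hmom, rfl⟩ := hγ
  change momentum γ₀ = -mo s - mo s' at hmom
  have hsize : modeSize γ₀ ≤ N / 8 := (show modeSize γ₀ < 3 * N ^ L from hlow).le.trans hL
  have hnear : |(mo s + mo s' : ℝ)| ≤ N / 8 := by
    have h1 := (abs_momentum_le γ₀).trans hsize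
    rw [hmom] at h1
    push_cast at h1
    rw [← abs_neg] at h1
    have e : (mo s + mo s' : ℝ) = -(-(mo s : ℝ) - mo s') := by ring
    rwa [e]
  have hnear' : |(mo s' + mo s : ℝ)| ≤ N / 8 := by rwa [add_comm]
  have hE : ∀ (δ : ℤ) (ε : ℤˣ) J J', ShiftQuad N δ ε J J' →
      |symb m I J - symb m I J'| ≤ defect m c / N * c := fun δ ε J J' h => by
    refine (h.symb_sub hm hN hNm hc0 hcd).trans (le_of_eq ?_)
    unfold defect
    field_simp
  obtain ⟨δ, ε, hp⟩ := highPair_refMode hN0 hs hs' hnear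
  obtain ⟨δ', ε', hp'⟩ := highPair_refMode hN0 hs' hs hnear'
  have b1 := hp.enorm_remainder_sub_le hN hc (hE δ ε) hD hsize
  have b2 := hp'.enorm_remainder_sub_le hN hc (hE δ' ε') hD hsize
  have hcomm : γ₀ + Finsupp.single s' 1 + Finsupp.single s 1 =
      γ₀ + Finsupp.single s 1 + Finsupp.single s' 1 := by abel
  rw [hcomm] at b2
  rw [coeff_toplitzPart_eq hN0 hs hs' hp.ne hsize, coeff_toplitzCoeff, coeff_toplitzCoeff,
    if_pos ⟨hlow, by omega⟩, if_pos ⟨hlow, by omega⟩]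
  set x := MvPowerSeries.coeff (γ₀ + Finsupp.single s 1 + Finsupp.single s' 1) (remainder m I)
  set y := MvPowerSeries.coeff (γ₀ + Finsupp.single (refMode N (SignType.sign s.1) s.2) 1 +
    Finsupp.single (refMode' N (SignType.sign s.1) s.2 s'.2 (mo s + mo s')) 1) (remainder m I)
  set z := MvPowerSeries.coeff (γ₀ + Finsupp.single (refMode N (SignType.sign s'.1) s'.2) 1 +
    Finsupp.single (refMode' N (SignType.sign s'.1) s'.2 s.2 (mo s' + mo s)) 1) (remainder m I)
  have e : x - (1 / 2 * y + 1 / 2 * z) = 2⁻¹ * (x - y) + 2⁻¹ * (x - z) := by ring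
  have e2 : ‖(2⁻¹ : ℂ)‖ₑ = 2⁻¹ := by
    rw [← ofReal_norm, norm_inv, Complex.norm_ofNat, ENNReal.ofReal_inv_of_pos (by norm_num)]
    simp
  rw [e]
  refine (enorm_add_le _ _).trans ?_
  rw [enorm_mul, enorm_mul, e2]
  set W := ENNReal.ofReal (17 * (defect m c / N)) * 16 *
    growth c ^ (γ₀ + Finsupp.single s 1 + Finsupp.single s' 1).degree *
    ord (γ₀ + Finsupp.single s 1 + Finsupp.single s' 1)
  calc _ ≤ 2⁻¹ * W + 2⁻¹ * W := by gcongr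
    _ = W := by rw [← add_mul, ENNReal.inv_two_add_inv_two, one_mul]

end toplitz

end DNLW
end


noncomputable section

namespace DNLW

open Ternary Filter Topology

/-! ### The quasi-Töplitz norm of the remainder -/

section quasiToplitz

variable {a p m c L N : ℝ} {I : Finset ℤ}

/-- The constant in the bounds of the coefficients. -/
def boundConst (m c : ℝ) : ℝ≥0∞ := 272 + ENNReal.ofReal (17 * defect m c) * 16

theorem OrdBound.mono {f : Series} {d : ℕ} {B B' Y : ℝ≥0∞} (h : OrdBound f d B Y) (hB : B ≤ B') :
    OrdBound f d B' Y := fun γ => (h γ).trans (by split_ifs <;> gcongr)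

theorem six_le_degree_of_coeff_toplitzPart (hc : ∀ J, |symb m I J| ≤ c) {γ : MIdx}
    (h : MvPowerSeries.coeff γ (toplitzPart m I L N) ≠ 0) : 6 ≤ γ.degree := by
  classical
  rw [coeff_toplitzPart] at h
  obtain ⟨⟨s, s'⟩, hq, h0⟩ := Finset.exists_ne_zero_of_sum_ne_zero h
  have hle : Finsupp.single s 1 + Finsupp.single s' 1 ≤ γ := by
    by_contra hc
    exact h0 (if_neg hc)
  rw [if_pos hle] at h0
  have h1 := ordBound_toplitzCoeff (L := L) (N := N) hc s.2 s'.2 (SignType.sign s.1) (mo s + mo s')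
    (γ - (Finsupp.single s 1 + Finsupp.single s' 1))
  have h2 : 4 ≤ (γ - (Finsupp.single s 1 + Finsupp.single s' 1)).degree := by
    by_contra hlt
    rw [if_neg hlt, zero_mul, nonpos_iff_eq_zero, enorm_eq_zero] at h1
    exact h0 h1
  have h3 : γ.degree = (γ - (Finsupp.single s 1 + Finsupp.single s' 1)).degree + 2 := by
    conv_lhs => rw [← tsub_add_cancel_of_le hle]
    rw [map_add, map_add, Finsupp.degree_single, Finsupp.degree_single]
  omega

/-- The assumptions on the cut-off. -/
structure LargeCutoff (m : ℝ) (I : Finset ℤ) (L N : ℝ) : Prop where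
  one_le : 1 ≤ N
  kappa : (kappa I : ℝ) < N
  mass : Real.sqrt m ≤ N / 4
  low : 3 * N ^ L ≤ N / 8

theorem defect_nonneg (hm : 0 < m) (hc0 : 0 < c) : 0 ≤ defect m c := by
  unfold defect; positivity

theorem ordBound_toplitzPart (hm : 0 < m) (hc0 : 0 < c)
    (hc : ∀ J, |symb m I J| ≤ c) (hcd : ∀ J, NonRes I J → c⁻¹ ≤ |divisor m J|)
    (hN : LargeCutoff m I L N) : OrdBound (toplitzPart m I L N) 6 (boundConst m c) (growth c) := by
  intro γ
  by_cases h0 : MvPowerSeries.coeff γ (toplitzPart m I L N) = 0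
  · rw [h0]; simp
  have hdeg := six_le_degree_of_coeff_toplitzPart hc h0
  have h1 := enorm_remainder_sub_toplitzPart_le hm hc0 hc hcd hN.kappa hN.mass hN.low
    (coeff_toplitzPart_ne_zero h0)
  have h2 := ordBound_remainder hc γ
  rw [if_pos hdeg] at h2 ⊢
  set x := MvPowerSeries.coeff γ (remainder m I)
  set y := MvPowerSeries.coeff γ (toplitzPart m I L N)
  have h3 : ENNReal.ofReal (17 * (defect m c / N)) ≤ ENNReal.ofReal (17 * defect m c) := by
    refine ENNReal.ofReal_le_ofReal ?_
    have := div_le_self (defect_nonneg hm hc0) hN.one_le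
    linarith
  calc ‖y‖ₑ = ‖x - (x - y)‖ₑ := by rw [sub_sub_cancel]
    _ ≤ ‖x‖ₑ + ‖x - y‖ₑ := enorm_sub_le
    _ ≤ 272 * growth c ^ γ.degree * ord γ +
        ENNReal.ofReal (17 * defect m c) * 16 * growth c ^ γ.degree * ord γ := by
        refine add_le_add h2 (h1.trans ?_)
        gcongr
    _ = _ := by unfold boundConst; ring

open Classical in
theorem coeff_bilinearProj (θ μ : ℝ) (f : Series) (γ : MIdx) :
    MvPowerSeries.coeff γ (bilinearProj L N θ μ f) =
      if IsBilinear L N θ μ γ then MvPowerSeries.coeff γ f else 0 := rfl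

theorem coeff_defect_ne_zero {γ : MIdx} (h : MvPowerSeries.coeff γ ((N : ℂ) •
    (bilinearProj L N 2 3 (remainder m I) - toplitzPart m I L N)) ≠ 0) : IsBilinear L N 2 3 γ := by
  classical
  by_contra hc
  refine h ?_
  have : MvPowerSeries.coeff γ (toplitzPart m I L N) = 0 := by
    by_contra h0
    exact hc (coeff_toplitzPart_ne_zero h0)
  rw [MvPowerSeries.coeff_smul, map_sub, coeff_bilinearProj, if_neg hc, this]
  simp

/-- The factor `N` in the defect is exactly compensated by the `1/N` of the comparison with the
Töplitz part. -/
theorem ordBound_defect (hm : 0 < m) (hc0 : 0 < c)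
    (hc : ∀ J, |symb m I J| ≤ c) (hcd : ∀ J, NonRes I J → c⁻¹ ≤ |divisor m J|)
    (hN : LargeCutoff m I L N) : OrdBound ((N : ℂ) • (bilinearProj L N 2 3 (remainder m I) -
      toplitzPart m I L N)) 6 (boundConst m c) (growth c) := by
  classical
  intro γ
  have hN0 : 0 < N := lt_of_lt_of_le one_pos hN.one_le
  by_cases h0 : MvPowerSeries.coeff γ ((N : ℂ) •
    (bilinearProj L N 2 3 (remainder m I) - toplitzPart m I L N)) = 0
  · rw [h0]; simp
  have hb := coeff_defect_ne_zero h0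
  have h1 := enorm_remainder_sub_toplitzPart_le hm hc0 hc hcd hN.kappa hN.mass hN.low hb
  rw [MvPowerSeries.coeff_smul, map_sub, coeff_bilinearProj, if_pos hb] at h0 ⊢
  have hdeg : 6 ≤ γ.degree := by
    by_cases h2 : MvPowerSeries.coeff γ (toplitzPart m I L N) = 0
    · rw [h2, sub_zero] at h0
      exact (coeff_remainder_ne_zero (right_ne_zero_of_mul h0)).1
    · exact six_le_degree_of_coeff_toplitzPart hc h2
  rw [if_pos hdeg, enorm_mul, ← ofReal_norm (N : ℂ), Complex.norm_real, Real.norm_of_nonneg hN0.le]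
  calc _ ≤ ENNReal.ofReal N * (ENNReal.ofReal (17 * (defect m c / N)) * 16 *
        growth c ^ γ.degree * ord γ) := by gcongr
    _ = ENNReal.ofReal N * ENNReal.ofReal (17 * (defect m c / N)) * 16 *
        growth c ^ γ.degree * ord γ := by ring
    _ = ENNReal.ofReal (17 * defect m c) * 16 * growth c ^ γ.degree * ord γ := by
        rw [← ENNReal.ofReal_mul hN0.le]
        congr 4
        field_simp
    _ ≤ _ := by
        gcongr
        exact le_add_self

/-- The constant in the bound of the norms. -/
def normConst (p m c : ℝ) : ℝ≥0∞ :=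
  4 * (boundConst m c * growth c) * (4 * growth c * max (algConst p) 1) ^ 5

theorem normConst_ne_top (hp : 1 / 2 < p) : normConst p m c ≠ ⊤ := by
  have h := (algConst_lt_top hp).ne
  unfold normConst boundConst
  refine ENNReal.mul_ne_top (ENNReal.mul_ne_top (by simp) (ENNReal.mul_ne_top
    (ENNReal.add_ne_top.2 ⟨by simp, ENNReal.mul_ne_top ENNReal.ofReal_ne_top (by simp)⟩)
    (growth_ne_top c))) (ENNReal.pow_ne_top (ENNReal.mul_ne_top (ENNReal.mul_ne_top (by simp)
    (growth_ne_top c)) ?_))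
  simp [h]

theorem ratio_growth_le {r : ℝ} (hQ : ratio p (4 * growth c) r ≤ 2⁻¹) :
    ratio p (growth c) r ≤ 2⁻¹ := by
  refine le_trans ?_ hQ
  unfold ratio
  gcongr
  exact le_mul_of_one_le_left' (by norm_num)

/-- The remainder, its Töplitz part and the defect obey one coefficient bound from degree six on,
uniformly in `N`, and conserve momentum; `majorantNorm_le` with `d = 4` bounds all three norms by a
multiple of `r^4`. -/
theorem quasiToplitzNorm_remainder_le (ha : 0 < a) (hp : 1 / 2 < p) (hm : 0 < m) (hc0 : 0 < c)
    (hc : ∀ J, |symb m I J| ≤ c) (hcd : ∀ J, NonRes I J → c⁻¹ ≤ |divisor m J|) {r : ℝ} (hr : 0 < r)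
    (hQ : ratio p (4 * growth c) r ≤ 2⁻¹) {N₀ : ℕ}
    (hN₀ : ∀ N : ℝ, (N₀ : ℝ) ≤ N → LargeCutoff m I L N) :
    quasiToplitzNorm a p L r N₀ 2 3 (remainder m I) ≤ normConst p m c * ENNReal.ofReal r ^ 4 := by
  have hQ' := ratio_growth_le hQ
  unfold quasiToplitzNorm
  refine iSup₂_le fun N hN => ?_
  have hL := hN₀ N hN
  have hK : OrdBound (remainder m I) 6 (boundConst m c) (growth c) :=
    (ordBound_remainder hc).mono le_self_add
  have hg := ordBound_toplitzPart hm hc0 hc hcd hL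
  have hd := ordBound_defect hm hc0 hc hcd hL
  have hgm : ∀ γ, MvPowerSeries.coeff γ (toplitzPart m I L N) ≠ 0 → momentum γ = 0 := fun γ h =>
    momentum_of_isBilinear (coeff_toplitzPart_ne_zero h)
  have n1 := majorantNorm_le ha hp hK (fun γ h => (coeff_remainder_ne_zero h).2.2) hQ'
  have n2 := majorantNorm_le ha hp hg hgm hQ'
  have n3 := majorantNorm_le ha hp hd (fun γ h => momentum_of_isBilinear (coeff_defect_ne_zero h)) hQ'
  have hfin : normConst p m c * ENNReal.ofReal r ^ 4 < ⊤ :=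
    (ENNReal.mul_ne_top (normConst_ne_top hp) (by simp)).lt_top
  refine iInf₂_le_of_le (toplitzPart m I L N) ⟨n2.trans_lt hfin, hgm, _, fun σ σ' ς h =>
    toplitzCoeff_mem_lowSpace ha hp hc hr hQ σ σ' ς h, rfl⟩ ?_
  exact max_le n1 (max_le n2 n3)

theorem eventually_largeCutoff (m : ℝ) (I : Finset ℤ) {L : ℝ} (hL : L < 1) :
    ∀ᶠ N : ℝ in atTop, LargeCutoff m I L N := by
  have h1 : Tendsto (fun N : ℝ => N ^ (L - 1)) atTop (𝓝 0) := by
    have := tendsto_rpow_neg_atTop (y := 1 - L) (by linarith)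
    simpa using this
  -- The value `1/24` is what `3 N^L ≤ N/8` requires.
  have h2 : ∀ᶠ N : ℝ in atTop, N ^ (L - 1) < 1 / 24 := h1.eventually_lt_const (by norm_num)
  filter_upwards [h2, eventually_ge_atTop 1, eventually_gt_atTop (kappa I : ℝ),
    eventually_ge_atTop (4 * Real.sqrt m)] with N k1 k2 k3 k4
  refine ⟨k2, k3, by linarith, ?_⟩
  have hN : 0 < N := by linarith
  have e : N ^ L = N ^ (L - 1) * N := by
    rw [Real.rpow_sub_one hN.ne', div_mul_cancel₀ _ hN.ne']
  rw [e]
  nlinarith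

theorem exists_threshold (m : ℝ) (I : Finset ℤ) {L b : ℝ} (hbL : b < L) (hL : L < 1) :
    ∃ N₀ : ℕ, Admissible I L b N₀ ∧ ∀ N : ℝ, (N₀ : ℝ) ≤ N → LargeCutoff m I L N := by
  have hpow : ∀ x : ℝ, x < 1 → Tendsto (fun N : ℝ => N ^ (x - 1)) atTop (𝓝 0) := fun x hx => by
    have := tendsto_rpow_neg_atTop (y := 1 - x) (by linarith)
    simpa using this
  have h1 : Tendsto (fun N : ℝ => 12 * N ^ (L - 1) + 2 * (kappa I : ℝ) * N ^ (b - 1)) atTop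
      (𝓝 (12 * 0 + 2 * (kappa I : ℝ) * 0)) :=
    ((hpow L hL).const_mul _).add ((hpow b (hbL.trans hL)).const_mul _)
  have h2 : ∀ᶠ N : ℝ in atTop, 12 * N ^ (L - 1) + 2 * (kappa I : ℝ) * N ^ (b - 1) < 1 :=
    h1.eventually_lt_const (by norm_num)
  obtain ⟨N₁, hN₁⟩ := eventually_atTop.1 (h2.and (eventually_largeCutoff m I hL))
  have hle : N₁ ≤ ((⌈N₁⌉₊ + 1 : ℕ) : ℝ) := by
    push_cast
    linarith [Nat.le_ceil N₁]
  exact ⟨⌈N₁⌉₊ + 1, ⟨Nat.succ_pos _, (hN₁ _ hle).1⟩, fun N hN => (hN₁ N (hle.trans hN)).2⟩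

end quasiToplitz

/-! ### Smallness conditions -/

section small

variable {a p c : ℝ}

theorem exists_mul_ofReal_le {V : ℝ≥0∞} (hV : V ≠ ⊤) :
    ∃ R₀ : ℝ, 0 < R₀ ∧ ∀ R : ℝ, R ≤ R₀ → V * ENNReal.ofReal R ≤ 2⁻¹ := by
  refine ⟨1 / (2 * (V.toReal + 1)), by positivity, fun R hR => ?_⟩
  rw [← ENNReal.ofReal_toReal hV, ← ENNReal.ofReal_mul ENNReal.toReal_nonneg]
  have h : (2⁻¹ : ℝ≥0∞) = ENNReal.ofReal (1 / 2) := by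
    rw [one_div, ENNReal.ofReal_inv_of_pos (by norm_num)]
    simp
  rw [h]
  refine ENNReal.ofReal_le_ofReal ?_
  have h0 : 0 ≤ V.toReal := ENNReal.toReal_nonneg
  calc V.toReal * R ≤ (V.toReal + 1) * (1 / (2 * (V.toReal + 1))) := by
        rcases le_or_gt R 0 with hR0 | hR0
        · exact (mul_nonpos_of_nonneg_of_nonpos h0 hR0).trans (by positivity)
        · gcongr
          linarith
    _ = _ := by field_simp

theorem sixteen_mul_le {k A y x : ℝ≥0∞} (hy : y ≤ A * (2 * x)) (h : 8 * (1 + k) * A * x ≤ 1) :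
    16 * k * y ^ 2 ≤ 1 := by
  calc 16 * k * y ^ 2 ≤ 16 * (1 + k) ^ 2 * (A * (2 * x)) ^ 2 := by
        gcongr
        calc k ≤ 1 + k := le_add_self
          _ = (1 + k) * 1 := by ring
          _ ≤ (1 + k) ^ 2 := by rw [pow_two]; gcongr; exact le_self_add
    _ = (8 * (1 + k) * A * x) ^ 2 := by ring
    _ ≤ 1 := pow_le_one₀ bot_le h

theorem exists_smallPoint (ha : 0 < a) (hp : 1 / 2 < p) (c : ℝ) :
    ∃ R₀ : ℝ, 0 < R₀ ∧ ∀ w : Phase a p, ‖w‖ ≤ R₀ → SmallPoint c w := by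
  set S := japSum p ^ (1 / 2 : ℝ)
  have hS : S ≠ ⊤ := (ENNReal.rpow_lt_top_of_nonneg (by norm_num) (japSum_lt_top hp).ne).ne
  have hA := (algConst_lt_top hp).ne
  have hk : (1 + ENNReal.ofReal (2 * c)) ≠ ⊤ := ENNReal.add_ne_top.2 ⟨by simp, ENNReal.ofReal_ne_top⟩
  obtain ⟨R₁, h1, k1⟩ := exists_mul_ofReal_le (V := 8 * (1 + ENNReal.ofReal (2 * c)) * algConst p)
    (ENNReal.mul_ne_top (ENNReal.mul_ne_top (by simp) hk) hA)
  obtain ⟨R₂, h2, k2⟩ := exists_mul_ofReal_le (V := 8 * (1 + ENNReal.ofReal (2 * c)) * S)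
    (ENNReal.mul_ne_top (ENNReal.mul_ne_top (by simp) hk) hS)
  have hhalf : (2⁻¹ : ℝ≥0∞) ≤ 1 := by simp
  refine ⟨min R₁ R₂, lt_min h1 h2, fun w hw => ⟨?_, ?_⟩⟩
  · have h := k1 _ (hw.trans (min_le_left _ _))
    have hb := (enorm2_fold_ecoord w).trans (enorm_fst_add_snd_le w)
    rw [ofReal_norm] at h
    have := sixteen_mul_le (y := algConst p * enorm2 a p (fold (ecoord w)))
      (mul_le_mul' le_rfl hb) (h.trans hhalf)
    calc _ = 16 * ENNReal.ofReal (2 * c) * (algConst p * enorm2 a p (fold (ecoord w))) ^ 2 := by ring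
      _ ≤ 1 := this
  · have h := k2 _ (hw.trans (min_le_right _ _))
    rw [ofReal_norm] at h
    exact sixteen_mul_le ((tsum_ecoord_le (p := p) ha w).trans
      (mul_le_mul' le_rfl (enorm_fst_add_snd_le w))) (h.trans hhalf)

theorem bidisc_eq_ball (r : ℝ) : bidisc a p r = Metric.ball 0 r :=
  ball_prod_same 0 0 r

end small

end DNLW
end

/-! ### Assembly of the normal form. -/

theorem proposition6p1 (I : Finset ℤ) (m : ℝ) (hm : 0 < m) :
    -- the threshold depends on `m`, `I`, `L`, `b` only
    ∃ N₀' : ℝ → ℝ → ℕ,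
      (∀ L b : ℝ, 0 < b → b < L → L < 1 → Admissible I L b (N₀' L b)) ∧
      ∀ a p : ℝ, 0 < a → 1 / 2 < p →
        ∃ R₀ : ℝ, 0 < R₀ ∧ ∃ C : ℝ, 0 < C ∧ ∀ R : ℝ, 0 < R → R < R₀ →
          ∃ (Γ : OpenPartialHomeomorph (Phase a p) (Phase a p)) (K : Series),
            -- `Γ` is an analytic change of variables from `B_{R/2} × B_{R/2}` into `B_R × B_R`
            Γ.source = bidisc a p (R / 2) ∧
            Γ.target ⊆ bidisc a p R ∧
            AnalyticOnNhd ℂ Γ Γ.source ∧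
            AnalyticOnNhd ℂ Γ.symm Γ.target ∧
            -- it is real
            (∀ w ∈ Γ.source, IsRealPoint w → IsRealPoint (Γ w)) ∧
            -- it is symplectic
            (∀ w ∈ Γ.source, ∀ v v' : Phase a p,
              symplecticForm (fderiv ℂ Γ w v) (fderiv ℂ Γ w v') = symplecticForm v v') ∧
            -- it takes the Hamiltonian into the normal form
            (∀ w ∈ Γ.source,
              (Summable fun γ : MIdx => MvPowerSeries.coeff γ K * monom w γ) ∧
              hamiltonian m (Γ w) = quadHam m w + Gbar I w + Ghat I w +
                ∑' γ : MIdx, MvPowerSeries.coeff γ K * monom w γ) ∧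
            -- the remainder has even degree at least six and preserves momentum
            (∀ γ : MIdx, MvPowerSeries.coeff γ K ≠ 0 →
              6 ≤ γ.degree ∧ Even γ.degree ∧ momentum γ = 0) ∧
            -- its quasi-Töplitz norm is of order `R ^ 4`
            ∀ L b : ℝ, 0 < b → b < L → L < 1 →
              quasiToplitzNorm a p L (R / 2) (N₀' L b) 2 3 K ≤ ENNReal.ofReal (C * R ^ 4) := by
  classical
  obtain ⟨c, hc0, hc, hcd⟩ := exists_symb_bound I hm
  have hcd0 : ∀ J, NonRes I J → divisor m J ≠ 0 := fun J hJ h0 => by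
    have h1 := hcd J hJ
    rw [h0, abs_zero] at h1
    exact absurd h1 (not_le.2 (inv_pos.2 hc0))
  -- Outside `b < L < 1` the threshold takes the irrelevant value `0`, so that it is a function of
  -- all real `L`, `b`.
  have hthr : ∀ L b : ℝ, ∃ N₀ : ℕ, 0 < b → b < L → L < 1 →
      Admissible I L b N₀ ∧ ∀ N : ℝ, (N₀ : ℝ) ≤ N → LargeCutoff m I L N := fun L b => by
    by_cases h : b < L ∧ L < 1
    · obtain ⟨N₀, h0⟩ := exists_threshold m I h.1 h.2
      exact ⟨N₀, fun _ _ _ => h0⟩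
    · exact ⟨0, fun _ h1 h2 => absurd ⟨h1, h2⟩ h⟩
  choose N₀' hN₀' using hthr
  refine ⟨N₀', fun L b h1 h2 h3 => (hN₀' L b h1 h2 h3).1, fun a p ha hp => ?_⟩
  set T := triCLM (a := a) m I ha hp hc
  -- This choice gives `9 ‖T‖ ρ² = ‖T‖ / (1 + ‖T‖)²`.
  set ρ : ℝ := 1 / (3 * (1 + ‖T‖))
  have hρ : 0 < ρ := by positivity
  have hT : 9 * ‖T‖ * ρ ^ 2 ≤ 2 := by
    have h0 := norm_nonneg T
    have e : 9 * ‖T‖ * ρ ^ 2 = ‖T‖ / (1 + ‖T‖) ^ 2 := by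
      simp only [ρ]; field_simp; ring
    rw [e, div_le_iff₀ (by positivity)]
    nlinarith
  have hY : (4 * (4 * growth c) * max (algConst p) 1 : ENNReal) ≠ ⊤ :=
    ENNReal.mul_ne_top (ENNReal.mul_ne_top (by simp) (ENNReal.mul_ne_top (by simp)
      (growth_ne_top c))) (by simp [(algConst_lt_top hp).ne])
  obtain ⟨R₁, hR₁, hsmall⟩ := exists_smallPoint ha hp c
  obtain ⟨R₂, hR₂, hratio⟩ := exists_mul_ofReal_le hY
  -- The bound `ρ/2` ensures `R/2 ≤ ρ/3` for the midpoint map and `4‖w‖ ≤ ρ` for the tree sums, `R₁`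
  -- the convergence over trees, `R₂` that of the geometric series. None of these involves `L` or
  -- `b`. The `+ 1` makes the constant positive.
  refine ⟨min (ρ / 2) (min R₁ R₂), lt_min (by positivity) (lt_min hR₁ hR₂),
    (normConst p m c).toReal + 1, by positivity, fun R hR hRlt => ?_⟩
  have k1 : R < ρ / 2 := hRlt.trans_le (min_le_left _ _)
  have k2 : R < R₁ := hRlt.trans_le ((min_le_right _ _).trans (min_le_left _ _))
  have k3 : R < R₂ := hRlt.trans_le ((min_le_right _ _).trans (min_le_right _ _))
  obtain ⟨Γ, Z, hsrc, htgt, han, han', hZ, hder⟩ := exists_midpoint (T := T) hρ hT (R := R)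
    (by linarith)
  have hnorm : ∀ w ∈ Γ.source, ‖w‖ < R / 2 := fun w hw => by
    rw [hsrc] at hw
    exact mem_ball_zero_iff.1 hw
  have hsp : ∀ w ∈ Γ.source, SmallPoint c w := fun w hw =>
    hsmall w (by linarith [hnorm w hw])
  have hcoord : ∀ w ∈ Γ.source, ∀ s, coord (Z w) s = treeSum m I w s := fun w hw =>
    coord_eq_treeSum ha hp hc hT (hZ w hw).1 (hZ w hw).2.1 (hsp w hw) (by linarith [hnorm w hw])
  refine ⟨Γ, remainder m I, hsrc.trans (bidisc_eq_ball _).symm,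
    htgt.trans (bidisc_eq_ball _).symm.subset, han, han', fun w hw hreal => ?_,
    fun w hw v v' => ?_, fun w hw => ⟨summable_remainder ha hp hc (hsp w hw), ?_⟩,
    fun γ hγ => coeff_remainder_ne_zero hγ, fun L b h1 h2 h3 => ?_⟩
  · rw [← (hZ w hw).2.2]
    exact isRealPoint_halfStep ha hp hc hT (hZ w hw).1.le (hZ w hw).2.1 hreal
  · obtain ⟨v₀, hv, hv'⟩ := hder w hw v
    obtain ⟨u₀, hu, hu'⟩ := hder w hw v'
    rw [hv', hu', hv, hu]
    exact symplecticForm_cayley ha hp (symplecticForm_fderiv_cubic ha hp hc (Z w)) _ _ _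
  · rw [← (hZ w hw).2.2]
    exact hamiltonian_halfStep hm ha hp hc hcd0 (hsp w hw) (hZ w hw).2.1 (hcoord w hw)
  · have hb := quasiToplitzNorm_remainder_le (L := L) ha hp hm hc0 hc hcd (r := R / 2) (by linarith)
      (hratio (R / 2) (by linarith)) (hN₀' L b h1 h2 h3).2
    refine hb.trans ?_
    rw [ENNReal.ofReal_mul (by positivity), ENNReal.ofReal_pow hR.le]
    gcongr
    · refine (ENNReal.ofReal_toReal (normConst_ne_top hp)).symm.le.trans
        (ENNReal.ofReal_le_ofReal (by linarith))
    · linarith
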